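/- **Theorem D.** Let $F$ be a non-archimedean local field, and let $n\ge 1$ and $r\ge 2n+1$ be integers (so $r\ge 3$). Let $1\le p\le\infty$ satisfy $1\le p<2-\frac{2}{n+2}$ or $2+\frac2n<p\le\infty$. Let $G=SL_r(F)$ with a left Haar measure. Then $G$ does not have property $AP_{pcb}^{Schur}$: there do not exist a constant $C$ and a net $(\varphi_\alpha)$ in the Fourier algebra $A(G)$ (the coefficients of the left regular representation on $L^2(G)$) such that $\varphi_\alpha\to 1$ uniformly on compact subsets of $G$ and $\|\check\varphi_\alpha\|_{cbMS^p(L^2(G))}\le C$ for all $\alpha$. Moreover, there do not exist a constant $C$ and a net $(f_\alpha)$ in $C_0(G)$ such that $f_\alpha\to1$ uniformly on compact subsets of $G$ and $\|\check f_\alpha\|_{MS^p(L^2(G))}\le C$ for all $\alpha$. Here $\check\varphi(g,h)=\varphi(g^{-1}h)$. For $p<\infty$, $S^p(H)$ is the space of operators $A$ on the Hilbert space $H$ with $\|A\|_p=\mathrm{Tr}(|A|^p)^{1/p}<\infty$, and $S^\infty(H)$ is the space of compact operators with the operator norm. For $\psi\in L^\infty(G\times G)$, the Schur multiplier $M_\psi$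 multiplies by $\psi$ the kernel in $L^2(G\times G)$ of a Hilbert–Schmidt operator on $L^2(G)$. The number $\|\psi\|_{MS^p(L^2(G))}$ is the norm of the extension of $M_\psi$ from $S^2\cap S^p$ to a bounded map of $S^p(L^2(G))$ ($\infty$ if there is none), and $\|\psi\|_{cbMS^p(L^2(G))}$ is its completely bounded norm, $\sup_m\|M_\psi\otimes \mathrm{id}\|$ on $S^p(L^2(G)\otimes\ell^2_m)$. -/

import Mathlib

open MeasureTheory Filter
open scoped ENNReal NNReal ZeroAtInfty ComplexConjugate InnerProductSpace

universe u

noncomputable section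

namespace SchurAP

section Schatten

variable {H : Type*} [NormedAddCommGroup H] [InnerProductSpace ℂ H]

/-- The trace `Tr T ∈ [0, ∞]` of a positive operator `T` on a Hilbert space: the supremum of
`∑ ⟨e i, T (e i)⟩` over finite orthonormal systems. For positive `T` this is the sum of
`⟨e i, T (e i)⟩` over any orthonormal basis. -/
def posTrace (T : H →L[ℂ] H) : ℝ≥0∞ :=
  ⨆ (n : ℕ) (e : Fin n → H) (_ : Orthonormal ℂ e),
    ∑ i, ENNReal.ofReal (RCLike.re ⟪e i, T (e i)⟫_ℂ)

variable [CompleteSpace H]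

/-- The Schatten norm: `‖A‖_p = Tr(|A|^p)^(1/p)` for `p < ∞` (where `|A| = (A* A)^(1/2)` and the
powers are taken in the continuous functional calculus), and the operator norm for `p = ∞`. -/
def schattenNorm (p : ℝ≥0∞) (A : H →L[ℂ] H) : ℝ≥0∞ :=
  if p = ∞ then ‖A‖ₑ
  else (posTrace (CFC.rpow (CFC.abs A) p.toReal)) ^ (1 / p.toReal)

/-- Membership in the Schatten class `S^p(H)`: the compact operators for `p = ∞`, and the
operators with finite Schatten norm for `p < ∞`. -/
def MemSchatten (p : ℝ≥0∞) (A : H →L[ℂ] H) : Prop :=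
  if p = ∞ then IsCompactOperator A else schattenNorm p A < ∞

end Schatten

section Schur

variable {X : Type*} [MeasurableSpace X]

/-- The bounded operator `A` on `L²(X, μ)` is the integral operator with kernel `k`:
`(A f)(x) = ∫ k(x, y) f(y) dμ(y)`. The Hilbert-Schmidt operators are exactly the operators with a
kernel in `L²(X × X, μ ⊗ μ)`. -/
def HasKernel (μ : Measure X) (A : Lp ℂ 2 μ →L[ℂ] Lp ℂ 2 μ) (k : X × X → ℂ) : Prop :=
  ∀ f : Lp ℂ 2 μ, (A f : X → ℂ) =ᵐ[μ] fun x => ∫ y, k (x, y) * (f : X → ℂ) y ∂μ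

/-- `A ∈ S²(L²(X, μ))`, and `B = M_φ A` is the image of `A` under the Schur multiplier with
symbol `φ`: the kernel of `B` is `φ` times the `L²` kernel of `A`. -/
def IsSchurImage (μ : Measure X) (φ : X → X → ℂ) (A B : Lp ℂ 2 μ →L[ℂ] Lp ℂ 2 μ) : Prop :=
  ∃ k : X × X → ℂ, MemLp k 2 (μ.prod μ) ∧ HasKernel μ A k ∧
    HasKernel μ B (fun z => φ z.1 z.2 * k z)

/-- `‖φ‖_{MS^p(L²(X, μ))} ≤ C`, for a symbol `φ ∈ L^∞(X × X)`: the Schur multiplier with symbol `φ`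
maps `S² ∩ S^p` (a dense subspace of `S^p`) into `S^p`, with norm at most `C` for the norm
of `S^p`. -/
def MSNormLE (p : ℝ≥0∞) (μ : Measure X) (φ : X → X → ℂ) (C : ℝ≥0) : Prop :=
  ∀ (A : Lp ℂ 2 μ →L[ℂ] Lp ℂ 2 μ) (k : X × X → ℂ),
    MemLp k 2 (μ.prod μ) → HasKernel μ A k → MemSchatten p A →
      ∃ B : Lp ℂ 2 μ →L[ℂ] Lp ℂ 2 μ, IsSchurImage μ φ A B ∧
        MemSchatten p B ∧ schattenNorm p B ≤ C * schattenNorm p A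

/-- The `(i, j)` entry of an operator on `H ⊗ ℓ²_n = Hⁿ` (Hilbert direct sum), seen as an `n × n`
matrix of operators on `H`. -/
def entry {H : Type*} [NormedAddCommGroup H] [InnerProductSpace ℂ H] {n : ℕ}
    (A : PiLp 2 (fun _ : Fin n => H) →L[ℂ] PiLp 2 (fun _ : Fin n => H)) (i j : Fin n) :
    H →L[ℂ] H :=
  (PiLp.proj 2 (fun _ : Fin n => H) i : PiLp 2 (fun _ : Fin n => H) →L[ℂ] H) ∘L A ∘L
    ((PiLp.continuousLinearEquiv 2 ℂ (fun _ : Fin n => H)).symm :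
      (Fin n → H) →L[ℂ] PiLp 2 (fun _ : Fin n => H)) ∘L
    ContinuousLinearMap.single ℂ (fun _ : Fin n => H) j

/-- `‖φ‖_{cbMS^p(L²(X, μ))} ≤ C`, for a symbol `φ ∈ L^∞(X × X)`: for every `n`, the amplification
`M_φ ⊗ id` on `S^p(L²(X, μ)) ⊗ M_n(ℂ)`, that is the map `(A i j) ↦ (M_φ (A i j))` on
operator matrices, is bounded by `C` for the norm of `S^p(L²(X, μ) ⊗ ℓ²_n)`. -/
def CBMSNormLE (p : ℝ≥0∞) (μ : Measure X) (φ : X → X → ℂ) (C : ℝ≥0) : Prop :=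
  ∀ (n : ℕ)
    (A : PiLp 2 (fun _ : Fin n => Lp ℂ 2 μ) →L[ℂ] PiLp 2 (fun _ : Fin n => Lp ℂ 2 μ)),
    (∀ i j, ∃ k : X × X → ℂ, MemLp k 2 (μ.prod μ) ∧ HasKernel μ (entry A i j) k) →
    MemSchatten p A →
      ∃ B : PiLp 2 (fun _ : Fin n => Lp ℂ 2 μ) →L[ℂ] PiLp 2 (fun _ : Fin n => Lp ℂ 2 μ),
        (∀ i j, IsSchurImage μ φ (entry A i j) (entry B i j)) ∧
        MemSchatten p B ∧ schattenNorm p B ≤ C * schattenNorm p A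

end Schur

section Group

variable {G : Type u} [Group G]

/-- The Herz-Schur symbol `(g, h) ↦ φ(g⁻¹ h)` of a function `φ` on a group. -/
def herzSchur (φ : G → ℂ) : G → G → ℂ := fun g h => φ (g⁻¹ * h)

/-- The Fourier algebra `A(G)` (with respect to a left Haar measure `μ`): the coefficients
`g ↦ ⟨λ(g) ξ, η⟩` of the left regular representation `(λ(g) ξ)(x) = ξ(g⁻¹ x)` on `L²(G, μ)`. -/
def MemFourierAlgebra [MeasurableSpace G] (μ : Measure G) (φ : G → ℂ) : Prop :=
  ∃ ξ η : G → ℂ, MemLp ξ 2 μ ∧ MemLp η 2 μ ∧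
    ∀ g, φ g = ∫ x, ξ (g⁻¹ * x) * conj (η x) ∂μ

/-- The property of completely bounded approximation by Schur multipliers on `S^p` of a locally
compact second countable group `G` with left Haar measure `μ`: there are a constant `C` and a net
`φ` in `A(G)` which converges to `1` uniformly on compact subsets and whose Herz-Schur
multipliers have cb-norm at most `C` on `S^p(L²(G, μ))`. -/
def HasAPcbSchur [TopologicalSpace G] [MeasurableSpace G] (p : ℝ≥0∞) (μ : Measure G) : Prop :=
  ∃ (C : ℝ≥0) (ι : Type u) (_ : Preorder ι) (_ : IsDirectedOrder ι) (_ : Nonempty ι)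
    (φ : ι → G → ℂ),
    (∀ a, MemFourierAlgebra μ (φ a)) ∧
    (∀ K : Set G, IsCompact K → TendstoUniformlyOn φ (fun _ => 1) atTop K) ∧
    ∀ a, CBMSNormLE p μ (herzSchur (φ a)) C

/-- The constant function `1` is the limit, uniformly on compact subsets of `G`, of a net of
functions in `C₀(G)` whose Herz-Schur multipliers are uniformly bounded on `S^p(L²(G, μ))`. -/
def HasC0SchurApproximation [TopologicalSpace G] [MeasurableSpace G]
    (p : ℝ≥0∞) (μ : Measure G) : Prop :=
  ∃ (C : ℝ≥0) (ι : Type u) (_ : Preorder ι) (_ : IsDirectedOrder ι) (_ : Nonempty ι)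
    (φ : ι → C₀(G, ℂ)),
    (∀ K : Set G, IsCompact K → TendstoUniformlyOn (fun a => ⇑(φ a)) (fun _ => 1) atTop K) ∧
    ∀ a, MSNormLE p μ (herzSchur (φ a)) C

end Group

end SchurAP

end

/-
Let `O` be the ring of integers of `F`, `ϖ` a uniformizer and `R = O / ϖ ^ k`. The matrix
`T = idealDiff (z + w + x ⬝ y)`, with rows `(x, z)` and columns `(y, w)` in `Rⁿ × R`, satisfies
`Tᴴ * T = |R| ^ n • P` for a projection `P`. If `ψ (z + w + x ⬝ y)` is a Schur multiplier bounded
by `C` on `S^p`, and `ψ` is a constant `ψ₁` on the nonzero elements of the smallest nonzero ideal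
and invariant elsewhere under this ideal, then testing it on `T` when `2 ≤ p`, and on the matrix of
ones when `p ≤ 2`, gives `|ψ 0 - ψ₁| ≤ 2 ^ (1 + 1 / p) * C * |R| ^ (-ε)`, with `ε > 0` in the given
range of `p`.

Heisenberg groups in `SL_r` provide such `ψ` from the average of `f` over the double cosets of
`K = SL_r(O)`, with `ψ 0` and `ψ₁` its values at two diagonal elements which differ by a root. A
chain of such steps in the Weyl chamber, along which the bounds decay geometrically, goes to
infinity, where a function in `C₀(G)` vanishes. So the averages are small at a point which depends
only on `C`, and the functions cannot converge to `1` there.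
-/

noncomputable section

namespace SchurAP

section Schatten

variable {H : Type*} [NormedAddCommGroup H] [InnerProductSpace ℂ H]

lemma posTrace_mono {S T : H →L[ℂ] H} (h : S ≤ T) : posTrace S ≤ posTrace T := by
  refine iSup_mono fun n => iSup_mono fun e => iSup_mono fun _ => Finset.sum_le_sum fun i _ =>
    ENNReal.ofReal_le_ofReal ?_
  have hpos := ((ContinuousLinearMap.le_def _ _).1 h).re_inner_nonneg_right (e i)
  rwa [sub_apply, inner_sub_right, map_sub, sub_nonneg] at hpos

lemma sum_le_posTrace {ι : Type*} [Fintype ι] (T : H →L[ℂ] H) {e : ι → H} (he : Orthonormal ℂ e) :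
    ∑ i, ENNReal.ofReal (RCLike.re ⟪e i, T (e i)⟫_ℂ) ≤ posTrace T := by
  let σ := Fintype.equivFin ι
  rw [← σ.symm.sum_comp]
  exact le_iSup_of_le (Fintype.card ι) (le_iSup_of_le (e ∘ σ.symm)
    (le_iSup_of_le (he.comp _ σ.symm.injective) le_rfl))

lemma posTrace_smul (c : ℝ≥0) (T : H →L[ℂ] H) : posTrace (c • T) = c * posTrace T := by
  simp only [posTrace, ENNReal.mul_iSup, Finset.mul_sum]
  congr! 7 with n e _ i _
  have hsmul : (c • T) (e i) = ((c : ℝ) : ℂ) • T (e i) := by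
    rw [smul_apply, NNReal.smul_def, Complex.coe_smul]
  rw [hsmul, inner_smul_right]
  simp [ENNReal.ofReal_mul]

variable [CompleteSpace H]

lemma re_inner_star_mul_self (B : H →L[ℂ] H) (v : H) :
    RCLike.re ⟪v, (star B * B) v⟫_ℂ = ‖B v‖ ^ 2 := by
  rw [mul_apply_eq_comp, ContinuousLinearMap.star_eq_adjoint,
    ContinuousLinearMap.adjoint_inner_right, inner_self_eq_norm_sq]

lemma enorm_le_posTrace {X : H →L[ℂ] H} (hX : 0 ≤ X) : ‖X‖ₑ ≤ posTrace X := by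
  set S := CFC.sqrt X
  have hS : star S * S = X := by
    rw [(CFC.sqrt_nonneg X).isSelfAdjoint.star_eq, CFC.sqrt_mul_sqrt_self X hX]
  rcases eq_or_ne (posTrace X) ∞ with htop | htop
  · exact htop ▸ le_top
  have hunit (v : H) (hv : ‖v‖ = 1) : ‖S v‖ ≤ √(posTrace X).toReal := by
    have hle := sum_le_posTrace (ι := Unit) X (e := fun _ => v)
      ⟨fun _ => hv, fun i j h => (h (Subsingleton.elim _ _)).elim⟩
    rw [Fintype.sum_unique, ← hS, re_inner_star_mul_self, hS, ENNReal.ofReal_le_iff_le_toReal htop]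
      at hle
    exact Real.le_sqrt_of_sq_le hle
  have hnorm : ‖X‖ ≤ (posTrace X).toReal := by
    have hSnorm : ‖S‖ ≤ √(posTrace X).toReal :=
      ContinuousLinearMap.opNorm_le_of_unit_norm (Real.sqrt_nonneg _) hunit
    calc ‖X‖ = ‖S‖ * ‖S‖ := by rw [← hS, CStarRing.norm_star_mul_self]
      _ ≤ √(posTrace X).toReal * √(posTrace X).toReal := by gcongr
      _ = (posTrace X).toReal := Real.mul_self_sqrt ENNReal.toReal_nonneg
  rw [← ofReal_norm]
  exact ENNReal.ofReal_le_of_le_toReal hnorm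

lemma rpow_abs_eq_nnrpow (A : H →L[ℂ] H) {p : ℝ≥0} (hp : 0 < p) :
    CFC.rpow (CFC.abs A) (p : ℝ) = (star A * A) ^ (p / 2) := by
  rw [← CFC.abs_nnrpow, CFC.nnrpow_eq_rpow hp]
  rfl

lemma schattenNorm_coe (A : H →L[ℂ] H) {p : ℝ≥0} (hp : 0 < p) :
    schattenNorm p A = posTrace ((star A * A) ^ (p / 2)) ^ (1 / (p : ℝ)) := by
  rw [schattenNorm, if_neg ENNReal.coe_ne_top, ENNReal.coe_toReal, rpow_abs_eq_nnrpow A hp]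

lemma schattenNorm_top (A : H →L[ℂ] H) : schattenNorm ∞ A = ‖A‖ₑ := if_pos rfl

lemma enorm_le_schattenNorm (B : H →L[ℂ] H) {p : ℝ≥0∞} (hp : p ≠ 0) :
    ‖B‖ₑ ≤ schattenNorm p B := by
  induction p with
  | top => rw [schattenNorm_top]
  | coe p =>
    have hp0 : 0 < p := pos_iff_ne_zero.2 (ENNReal.coe_ne_zero.1 hp)
    have hpow : ‖(star B * B) ^ (p / 2)‖ₑ = ‖B‖ₑ ^ (p : ℝ) := by
      rw [enorm_eq_nnnorm, CFC.nnnorm_nnrpow _ (half_pos hp0), CStarRing.nnnorm_star_mul_self,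
        ← sq, ← NNReal.rpow_natCast, ← NNReal.rpow_mul, enorm_eq_nnnorm,
        ← ENNReal.coe_rpow_of_nonneg _ p.coe_nonneg]
      congr 2
      push_cast
      ring
    rw [schattenNorm_coe B hp0, one_div, ENNReal.le_rpow_inv_iff (by exact_mod_cast hp0), ← hpow]
    exact enorm_le_posTrace CFC.nnrpow_nonneg

lemma smul_nnrpow_of_isStarProjection {P : H →L[ℂ] H} (hP : IsStarProjection P) (c : ℝ≥0)
    {s : ℝ≥0} (hs : 0 < s) : (c • P) ^ s = (c ^ (s : ℝ)) • P := by
  have hspec : (quasispectrum ℝ≥0 P).EqOn (fun x => (c • x).nnrpow s)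
      (fun x => (c ^ (s : ℝ)) • id x) := by
    intro x hx
    have hx01 := hP.isIdempotentElem.quasispectrum_subset ℝ (quasispectrum.algebraMap_mem ℝ hx)
    have hx01' : x = 0 ∨ x = 1 := by simpa using hx01
    rcases hx01' with rfl | rfl <;> simp [hs.ne']
  rw [CFC.nnrpow_def, ← cfcₙ_comp_smul c _ P
    (NNReal.continuous_nnrpow_const s).continuousOn (by simp [hs.ne']) hP.nonneg,
    cfcₙ_congr hspec, cfcₙ_smul _ _ P continuousOn_id rfl, cfcₙ_id ℝ≥0 P hP.nonneg]

lemma posTrace_sq_smul_nnrpow_rpow {P : H →L[ℂ] H} (hP : IsStarProjection P) (c : ℝ≥0)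
    {p : ℝ≥0} (hp : 0 < p) :
    posTrace ((c ^ 2 • P) ^ (p / 2)) ^ (1 / (p : ℝ)) = c * posTrace P ^ (1 / (p : ℝ)) := by
  have hpow : (c ^ 2) ^ ((p / 2 : ℝ≥0) : ℝ) = c ^ (p : ℝ) := by
    rw [← NNReal.rpow_natCast, ← NNReal.rpow_mul]
    congr 1
    push_cast
    ring
  rw [smul_nnrpow_of_isStarProjection hP _ (half_pos hp), posTrace_smul,
    ENNReal.mul_rpow_of_nonneg _ _ (by positivity), hpow,
    ENNReal.coe_rpow_of_nonneg _ p.coe_nonneg, ← ENNReal.rpow_mul,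
    mul_one_div_cancel (NNReal.coe_ne_zero.2 hp.ne'), ENNReal.rpow_one]

lemma schattenNorm_eq_of_star_mul_self {A P : H →L[ℂ] H} (hP : IsStarProjection P) {c : ℝ≥0}
    (hA : star A * A = c ^ 2 • P) {p : ℝ≥0} (hp : 0 < p) :
    schattenNorm p A = c * posTrace P ^ (1 / (p : ℝ)) := by
  rw [schattenNorm_coe A hp, hA, posTrace_sq_smul_nnrpow_rpow hP c hp]

lemma enorm_le_of_star_mul_self {A P : H →L[ℂ] H} (hP : IsStarProjection P) {c : ℝ≥0}
    (hA : star A * A = c ^ 2 • P) : ‖A‖ₑ ≤ c := by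
  have hsq : ‖A‖₊ ^ 2 ≤ c ^ 2 := by
    rw [← NNReal.coe_le_coe, sq, ← CStarRing.nnnorm_star_mul_self, hA, coe_nnnorm,
      NNReal.smul_def, norm_smul, NNReal.norm_eq]
    exact mul_le_of_le_one_right (NNReal.coe_nonneg _) hP.norm_le
  exact ENNReal.coe_le_coe.2 ((pow_le_pow_iff_left₀ zero_le zero_le two_ne_zero).1 hsq)

lemma le_schattenNorm_of_smul_le_star_mul_self {B P : H →L[ℂ] H} (hP : IsStarProjection P)
    {c : ℝ≥0} (hB : c ^ 2 • P ≤ star B * B) {p : ℝ≥0} (hp0 : 0 < p) (hp2 : p ≤ 2) :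
    c * posTrace P ^ (1 / (p : ℝ)) ≤ schattenNorm p B := by
  rw [schattenNorm_coe B hp0, ← posTrace_sq_smul_nnrpow_rpow hP c hp0]
  gcongr
  exact posTrace_mono (CFC.monotone_nnrpow ⟨zero_le, (div_le_one two_pos).2 hp2⟩ hB)

lemma sq_smul_le_star_mul_self {B P : H →L[ℂ] H} (hP : IsStarProjection P) {c : ℝ≥0}
    (h : ∀ v, c * ‖P v‖ ≤ ‖B v‖) : c ^ 2 • P ≤ star B * B := by
  rw [ContinuousLinearMap.le_def, ContinuousLinearMap.isPositive_def']
  refine ⟨(IsSelfAdjoint.star_mul_self B).sub ((IsSelfAdjoint.all ((c ^ 2 : ℝ≥0) : ℝ)).smul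
    hP.isSelfAdjoint), fun v => ?_⟩
  have hPP : star P * P = P := by rw [hP.isSelfAdjoint.star_eq, hP.isIdempotentElem.eq]
  have hsmul : (c ^ 2 • P) v = ((c ^ 2 : ℝ) : ℂ) • (star P * P) v := by
    rw [hPP, Complex.coe_smul]
    rfl
  rw [ContinuousLinearMap.reApplyInnerSelf_apply, inner_re_symm, sub_apply, inner_sub_right,
    map_sub, re_inner_star_mul_self, hsmul, inner_smul_right, RCLike.re_to_complex,
    Complex.re_ofReal_mul, ← RCLike.re_to_complex, re_inner_star_mul_self, sub_nonneg, ← mul_pow]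
  exact pow_le_pow_left₀ (by positivity) (h v) 2

lemma mul_norm_starProjection_map_star_le {B : H →L[ℂ] H} {V W : Submodule ℂ H}
    [W.HasOrthogonalProjection] (hW : W = V.map (star B : H →L[ℂ] H).toLinearMap) {c : ℝ≥0}
    (h : ∀ u ∈ V, c * ‖u‖ ≤ ‖star B u‖) (v : H) : c * ‖W.starProjection v‖ ≤ ‖B v‖ := by
  set w := W.starProjection v
  obtain ⟨u, hu, huw : star B u = w⟩ := hW.le (Submodule.starProjection_apply_mem W v)
  have hsq : ‖w‖ ^ 2 ≤ ‖u‖ * ‖B v‖ := by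
    calc ‖w‖ ^ 2 = RCLike.re ⟪w, v⟫_ℂ := (Submodule.re_inner_starProjection_eq_normSq W v).symm
      _ = RCLike.re ⟪u, B v⟫_ℂ := by
          rw [← huw, ContinuousLinearMap.star_eq_adjoint, ContinuousLinearMap.adjoint_inner_left]
      _ ≤ ‖u‖ * ‖B v‖ := re_inner_le_norm u (B v)
  rcases (norm_nonneg w).eq_or_lt with h0 | h0
  · rw [← h0, mul_zero]
    positivity
  · refine le_of_mul_le_mul_right ?_ h0
    have hu' : c * ‖u‖ ≤ ‖w‖ := huw ▸ h u hu
    calc c * ‖w‖ * ‖w‖ = c * ‖w‖ ^ 2 := by ring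
      _ ≤ c * (‖u‖ * ‖B v‖) := by gcongr
      _ = c * ‖u‖ * ‖B v‖ := by ring
      _ ≤ ‖B v‖ * ‖w‖ := by rw [mul_comm ‖B v‖]; gcongr

omit [CompleteSpace H] in
lemma finrank_le_posTrace_starProjection (W : Submodule ℂ H) [FiniteDimensional ℂ W] :
    (Module.finrank ℂ W : ℝ≥0∞) ≤ posTrace W.starProjection := by
  let b := stdOrthonormalBasis ℂ W
  have hb : Orthonormal ℂ (fun i => (b i : H)) := b.orthonormal.comp_linearIsometry W.subtypeₗᵢ
  refine le_trans (le_of_eq ?_) (sum_le_posTrace _ hb)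
  simp [Submodule.starProjection_eq_self_iff.2 (b _).2, hb.1]

lemma le_schattenNorm_of_le_norm_star (B : H →L[ℂ] H) {p : ℝ≥0} (hp0 : 0 < p) (hp2 : p ≤ 2)
    (V : Submodule ℂ H) [FiniteDimensional ℂ V] {c : ℝ≥0}
    (h : ∀ u ∈ V, c * ‖u‖ ≤ ‖star B u‖) :
    c * (Module.finrank ℂ V : ℝ≥0∞) ^ (1 / (p : ℝ)) ≤ schattenNorm p B := by
  rcases eq_or_ne c 0 with rfl | hc
  · simp
  let L := (star B : H →L[ℂ] H).toLinearMap.domRestrict V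
  obtain ⟨W, hW⟩ : ∃ W, W = V.map (star B : H →L[ℂ] H).toLinearMap := ⟨_, rfl⟩
  have hWL : W = LinearMap.range L := hW.trans (LinearMap.range_domRestrict _ _).symm
  have : FiniteDimensional ℂ W := hWL ▸ inferInstance
  have hinj : Function.Injective L := (injective_iff_map_eq_zero L).2 fun u hu => by
    have hle := h u u.2
    rw [show star B (u : H) = 0 from hu, norm_zero] at hle
    exact Subtype.ext (norm_le_zero_iff.1
      (nonpos_of_mul_nonpos_right hle (NNReal.coe_pos.2 hc.bot_lt)))
  have hrank : Module.finrank ℂ V = Module.finrank ℂ W := by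
    rw [hWL, LinearMap.finrank_range_of_inj hinj]
  refine le_trans ?_ (le_schattenNorm_of_smul_le_star_mul_self isStarProjection_starProjection
    (sq_smul_le_star_mul_self isStarProjection_starProjection
      (mul_norm_starProjection_map_star_le hW h)) hp0 hp2)
  rw [hrank]
  gcongr
  exact finrank_le_posTrace_starProjection W

end Schatten

section Conj

variable {H H' : Type*} [NormedAddCommGroup H] [InnerProductSpace ℂ H] [CompleteSpace H]
  [NormedAddCommGroup H'] [InnerProductSpace ℂ H'] [CompleteSpace H']

lemma posTrace_conj_le (e : H ≃ₗᵢ[ℂ] H') (A : H →L[ℂ] H) :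
    posTrace (e.conjStarAlgEquiv A) ≤ posTrace A := by
  refine iSup_le fun n => iSup_le fun f => iSup_le fun hf => ?_
  refine le_trans (Finset.sum_le_sum fun i _ => le_of_eq ?_)
    (sum_le_posTrace A (hf.comp_linearIsometryEquiv e.symm))
  rw [LinearIsometryEquiv.conjStarAlgEquiv_apply_apply, Function.comp_apply,
    ← e.inner_map_map (_ : H), e.apply_symm_apply]

lemma posTrace_conj (e : H ≃ₗᵢ[ℂ] H') (A : H →L[ℂ] H) :
    posTrace (e.conjStarAlgEquiv A) = posTrace A := by
  refine (posTrace_conj_le e A).antisymm ?_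
  have hle := posTrace_conj_le e.symm (e.conjStarAlgEquiv A)
  rwa [← LinearIsometryEquiv.symm_conjStarAlgEquiv, StarAlgEquiv.symm_apply_apply] at hle

lemma map_nnrpow_conj (e : H ≃ₗᵢ[ℂ] H') {X : H →L[ℂ] H} (hX : 0 ≤ X) {s : ℝ≥0} (hs : s ≠ 0) :
    e.conjStarAlgEquiv (X ^ s) = e.conjStarAlgEquiv X ^ s :=
  NonUnitalStarAlgHomClass.map_cfcₙ (R := ℝ≥0) (S := ℂ) e.conjStarAlgEquiv _ _
    (NNReal.continuous_nnrpow_const s).continuousOn (by simp [hs])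
    e.toContinuousLinearEquiv.conjContinuousAlgEquiv.continuous hX (map_nonneg _ hX)

lemma schattenNorm_conj (e : H ≃ₗᵢ[ℂ] H') (A : H →L[ℂ] H) {p : ℝ≥0∞} (hp : p ≠ 0) :
    schattenNorm p (e.conjStarAlgEquiv A) = schattenNorm p A := by
  induction p with
  | top =>
    rw [schattenNorm_top, schattenNorm_top, ← ofReal_norm,
      NonUnitalStarAlgHom.norm_map e.conjStarAlgEquiv e.conjStarAlgEquiv.injective, ofReal_norm]
  | coe p =>
    have hp0 : 0 < p := pos_iff_ne_zero.2 (ENNReal.coe_ne_zero.1 hp)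
    rw [schattenNorm_coe _ hp0, schattenNorm_coe _ hp0, ← map_star, ← map_mul,
      ← map_nnrpow_conj e (star_mul_self_nonneg A) (half_pos hp0).ne', posTrace_conj e]

lemma MemSchatten.conj {A : H →L[ℂ] H} {p : ℝ≥0∞} (h : MemSchatten p A) (hp : p ≠ 0)
    (e : H ≃ₗᵢ[ℂ] H') : MemSchatten p (e.conjStarAlgEquiv A) := by
  unfold MemSchatten at *
  split_ifs at h ⊢ with hp'
  · exact (h.comp_clm (e.symm : H' →L[ℂ] H)).clm_comp (e : H →L[ℂ] H')
  · rwa [schattenNorm_conj e A hp]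

end Conj

section MatOp

open InnerProductSpace Matrix

variable {H : Type*} [NormedAddCommGroup H] [InnerProductSpace ℂ H]
  {ι : Type*} [Fintype ι]

/-- The finite-rank operator `∑ T i j |e i⟩⟨g j|` attached to a matrix and two families of vectors.
For orthonormal families it embeds matrices isometrically for every Schatten norm. -/
def matOp (e g : ι → H) (T : Matrix ι ι ℂ) : H →L[ℂ] H :=
  ∑ i, ∑ j, T i j • rankOne ℂ (e i) (g j)

lemma matOp_apply (e g : ι → H) (T : Matrix ι ι ℂ) (v : H) :
    matOp e g T v = ∑ i, (∑ j, T i j * ⟪g j, v⟫_ℂ) • e i := by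
  simp [matOp, Finset.sum_smul, mul_smul]

lemma isCompactOperator_matOp (e g : ι → H) (T : Matrix ι ι ℂ) :
    IsCompactOperator (matOp e g T) := by
  have : FiniteDimensional ℂ (Submodule.span ℂ (Set.range e)) :=
    FiniteDimensional.span_of_finite ℂ (Set.finite_range e)
  let f : H →L[ℂ] Submodule.span ℂ (Set.range e) := (matOp e g T).codRestrict _ fun v => by
    rw [matOp_apply]
    exact Submodule.sum_mem _ fun i _ =>
      Submodule.smul_mem _ _ (Submodule.subset_span ⟨i, rfl⟩)
  have : ProperSpace (Submodule.span ℂ (Set.range e)) := FiniteDimensional.proper ℂ _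
  have hf : IsCompactOperator f := isCompactOperator_of_locallyCompactSpace_dom f
  exact hf.clm_comp (Submodule.subtypeL _)

lemma inner_matOp {g : ι → H} (hg : Orthonormal ℂ g) (f : ι → H)
    (T : Matrix ι ι ℂ) (i : ι) (v : H) :
    ⟪g i, matOp g f T v⟫_ℂ = ∑ j, T i j * ⟪f j, v⟫_ℂ := by
  rw [matOp_apply, hg.inner_right_fintype]

lemma inner_sum_smul_matOp (e g : ι → H) (x y : ι → ℂ) (B : H →L[ℂ] H) :
    ⟪∑ i, x i • e i, B (∑ j, y j • g j)⟫_ℂ =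
      star x ⬝ᵥ (Matrix.of fun i j => ⟪e i, B (g j)⟫_ℂ) *ᵥ y := by
  simp only [map_sum, map_smul, sum_inner, inner_smul_left, dotProduct, mulVec, Pi.star_apply,
    of_apply]
  refine Finset.sum_congr rfl fun i _ => ?_
  rw [inner_sum]
  simp only [inner_smul_right, RCLike.star_def, mul_comm]

lemma norm_sq_sum_smul {e : ι → H} (he : Orthonormal ℂ e) (x : ι → ℂ) :
    ‖∑ i, x i • e i‖ ^ 2 = ∑ i, ‖x i‖ ^ 2 := by
  rw [← inner_self_eq_norm_sq (𝕜 := ℂ), he.inner_sum, map_sum]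
  exact Finset.sum_congr rfl fun i _ => by
    rw [Complex.conj_mul', RCLike.re_to_complex, ← Complex.ofReal_pow, Complex.ofReal_re]

lemma matOp_mul {f : ι → H} (hf : Orthonormal ℂ f) (e g : ι → H)
    (S T : Matrix ι ι ℂ) : matOp e f S * matOp f g T = matOp e g (S * T) := by
  ext v
  rw [mul_apply_eq_comp, matOp_apply, matOp_apply e g]
  refine Finset.sum_congr rfl fun i _ => ?_
  congr 1
  simp only [inner_matOp hf, mul_apply, Finset.mul_sum, Finset.sum_mul]
  rw [Finset.sum_comm]
  simp [mul_assoc]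

lemma matOp_smul (e g : ι → H) (c : ℝ≥0) (T : Matrix ι ι ℂ) :
    matOp e g (c • T) = c • matOp e g T := by
  simp [matOp, Finset.smul_sum]

variable [CompleteSpace H]

lemma star_matOp (e g : ι → H) (T : Matrix ι ι ℂ) : star (matOp e g T) = matOp g e Tᴴ := by
  simp only [matOp, star_sum, star_smul, ContinuousLinearMap.star_eq_adjoint, adjoint_rankOne,
    conjTranspose_apply]
  exact Finset.sum_comm

lemma isStarProjection_matOp {g : ι → H} (hg : Orthonormal ℂ g)
    {P : Matrix ι ι ℂ} (hP : IsStarProjection P) : IsStarProjection (matOp g g P) where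
  isIdempotentElem := by
    rw [IsIdempotentElem, matOp_mul hg, hP.isIdempotentElem.eq]
  isSelfAdjoint := by
    rw [IsSelfAdjoint, star_matOp, ← star_eq_conjTranspose, hP.isSelfAdjoint.star_eq]

lemma re_inner_eq_norm_sq_of_isStarProjection {Q : H →L[ℂ] H} (hQ : IsStarProjection Q) (u : H) :
    RCLike.re ⟪u, Q u⟫_ℂ = ‖Q u‖ ^ 2 := by
  rw [← re_inner_star_mul_self, hQ.isSelfAdjoint.star_eq, hQ.isIdempotentElem.eq]

lemma norm_sq_matOp {g : ι → H} (hg : Orthonormal ℂ g) (e : ι → H) (T : Matrix ι ι ℂ) (u : H) :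
    ‖matOp g e T u‖ ^ 2 = ∑ j, ‖⟪star (matOp g e T) (g j), u⟫_ℂ‖ ^ 2 := by
  simp only [matOp_apply g e T u, norm_sq_sum_smul hg, ContinuousLinearMap.star_eq_adjoint,
    ContinuousLinearMap.adjoint_inner_left, hg.inner_right_fintype]

lemma sum_norm_sq_matOp {g : ι → H} (hg : Orthonormal ℂ g) {P : Matrix ι ι ℂ}
    (hP : IsStarProjection P) : ∑ j, ‖matOp g g P (g j)‖ ^ 2 = RCLike.re P.trace := by
  classical
  rw [trace, map_sum]
  refine Finset.sum_congr rfl fun j _ => ?_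
  rw [← re_inner_eq_norm_sq_of_isStarProjection (isStarProjection_matOp hg hP), inner_matOp hg]
  simp [orthonormal_iff_ite.1 hg]

lemma posTrace_matOp_le {g : ι → H} (hg : Orthonormal ℂ g) {P : Matrix ι ι ℂ}
    (hP : IsStarProjection P) : posTrace (matOp g g P) ≤ ENNReal.ofReal (RCLike.re P.trace) := by
  have hQ := isStarProjection_matOp hg hP
  refine iSup_le fun n => iSup_le fun f => iSup_le fun hf => ?_
  simp only [re_inner_eq_norm_sq_of_isStarProjection hQ]
  rw [← ENNReal.ofReal_sum_of_nonneg (fun i _ => by positivity), ← sum_norm_sq_matOp hg hP]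
  simp only [norm_sq_matOp hg g P (f _), hQ.isSelfAdjoint.star_eq]
  rw [Finset.sum_comm]
  refine ENNReal.ofReal_le_ofReal (Finset.sum_le_sum fun j _ => ?_)
  simp only [norm_inner_symm (matOp g g P (g j))]
  exact hf.sum_inner_products_le _

lemma star_matOp_mul_self {e : ι → H} (he : Orthonormal ℂ e) (g : ι → H)
    (T : Matrix ι ι ℂ) : star (matOp e g T) * matOp e g T = matOp g g (Tᴴ * T) := by
  rw [star_matOp, matOp_mul he]

lemma schattenNorm_matOp_le {e g : ι → H} (he : Orthonormal ℂ e) (hg : Orthonormal ℂ g)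
    {T P : Matrix ι ι ℂ} (hP : IsStarProjection P) {c k : ℝ≥0} (hT : Tᴴ * T = c ^ 2 • P)
    (hk : P.trace = k) {p : ℝ≥0∞} (hp : p ≠ 0) :
    schattenNorm p (matOp e g T) ≤ c * k ^ (1 / p.toReal) := by
  have hQ := isStarProjection_matOp hg hP
  have hmul : star (matOp e g T) * matOp e g T = c ^ 2 • matOp g g P := by
    rw [star_matOp_mul_self he, hT, matOp_smul]
  induction p with
  | top => simpa [schattenNorm_top] using enorm_le_of_star_mul_self hQ hmul
  | coe p =>
    rw [schattenNorm_eq_of_star_mul_self hQ hmul (pos_iff_ne_zero.2 (ENNReal.coe_ne_zero.1 hp)),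
      ENNReal.coe_toReal]
    gcongr
    refine (posTrace_matOp_le hg hP).trans_eq ?_
    rw [hk]
    exact ENNReal.ofReal_coe_nnreal

end MatOp

section FiniteRing

open Matrix

open scoped Classical in
/-- The Dirac mass at `0` minus the uniform probability measure on an ideal, as a function. It is an
idempotent for additive convolution. -/
def idealDiff {R : Type*} [CommRing R] (𝔞 : Ideal R) (s : R) : ℂ :=
  (if s = 0 then 1 else 0) - (if s ∈ 𝔞 then (Nat.card 𝔞 : ℂ)⁻¹ else 0)

variable {R : Type*} [CommRing R] {𝔞 : Ideal R}

lemma idealDiff_neg (s : R) : idealDiff 𝔞 (-s) = idealDiff 𝔞 s := by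
  classical
  simp only [idealDiff]
  congr 1
  · exact if_congr neg_eq_zero rfl rfl
  · exact if_congr (neg_mem_iff (S := Ideal R)) rfl rfl

lemma star_idealDiff (s : R) : star (idealDiff 𝔞 s) = idealDiff 𝔞 s := by
  simp only [idealDiff, star_sub]
  split_ifs <;> simp

lemma card_ideal_ne_zero (𝔞 : Ideal R) [Finite 𝔞] : (Nat.card 𝔞 : ℂ) ≠ 0 := by
  exact_mod_cast Nat.card_pos.ne'

lemma sum_idealDiff_add [Fintype 𝔞] (c : R) : ∑ t : 𝔞, idealDiff 𝔞 (t + c) = 0 := by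
  classical
  simp only [idealDiff, Finset.sum_sub_distrib]
  by_cases hc : c ∈ 𝔞
  · have hzero (t : 𝔞) : ((t : R) + c = 0) ↔ t = ⟨-c, 𝔞.neg_mem hc⟩ := by
      rw [Subtype.ext_iff, add_eq_zero_iff_eq_neg]
    have hmem (t : 𝔞) : (t : R) + c ∈ 𝔞 := 𝔞.add_mem t.2 hc
    simp [hzero, hmem]
  · have hmem (t : 𝔞) : (t : R) + c ∉ 𝔞 := fun h => hc ((𝔞.add_mem_iff_right t.2).1 h)
    have hzero (t : 𝔞) : (t : R) + c ≠ 0 := fun h => hmem t (h ▸ 𝔞.zero_mem)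
    simp [hmem, hzero]

lemma sum_ideal_of_const {ψ : R → ℂ} {ψ₁ : ℂ} [Fintype 𝔞] (hconst : ∀ t ∈ 𝔞, t ≠ 0 → ψ t = ψ₁) :
    ∑ t : 𝔞, ψ t = ψ 0 + (Nat.card 𝔞 - 1) * ψ₁ := by
  classical
  rw [← Finset.add_sum_erase _ _ (Finset.mem_univ (0 : 𝔞)), Finset.sum_congr rfl
    (g := fun _ => ψ₁) fun (t : 𝔞) ht => hconst t t.2 (by simpa using Finset.ne_of_mem_erase ht)]
  simp only [Finset.sum_const, Finset.card_erase_of_mem (Finset.mem_univ _), Finset.card_univ,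
    nsmul_eq_mul, Nat.card_eq_fintype_card, ZeroMemClass.coe_zero]
  rw [Nat.cast_sub Fintype.card_pos, Nat.cast_one]

variable [Fintype R]

lemma sum_mul_idealDiff (ψ : R → ℂ) (𝔞 : Ideal R) [Fintype 𝔞] :
    ∑ s, ψ s * idealDiff 𝔞 s = ψ 0 - (Nat.card 𝔞 : ℂ)⁻¹ * ∑ t : 𝔞, ψ t := by
  classical
  simp only [idealDiff, mul_sub, Finset.sum_sub_distrib, mul_ite, mul_one, mul_zero]
  rw [Finset.sum_ite_eq' Finset.univ (0 : R), if_pos (Finset.mem_univ _), ← Finset.sum_filter,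
    Finset.mul_sum]
  congr 1
  rw [Finset.sum_subtype (p := (· ∈ 𝔞)) _ (by simp)]
  exact Fintype.sum_congr _ _ fun t => mul_comm _ _

lemma sum_mul_idealDiff_of_const {ψ : R → ℂ} {ψ₁ : ℂ} (hconst : ∀ t ∈ 𝔞, t ≠ 0 → ψ t = ψ₁) :
    ∑ s, ψ s * idealDiff 𝔞 s = (1 - (Nat.card 𝔞 : ℂ)⁻¹) * (ψ 0 - ψ₁) := by
  have : Fintype 𝔞 := Fintype.ofFinite _
  have hc := card_ideal_ne_zero 𝔞
  rw [sum_mul_idealDiff, sum_ideal_of_const hconst]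
  field_simp
  ring

lemma sum_idealDiff_mul_idealDiff (u v : R) :
    ∑ z, idealDiff 𝔞 (z + u) * idealDiff 𝔞 (z + v) = idealDiff 𝔞 (u - v) := by
  have : Fintype 𝔞 := Fintype.ofFinite _
  rw [← Equiv.sum_comp (Equiv.subRight v)]
  simp only [Equiv.subRight_apply, sub_add_cancel]
  rw [sum_mul_idealDiff (fun z => idealDiff 𝔞 (z - v + u))]
  have (t : R) : t - v + u = t + (u - v) := by ring
  simp only [this, sum_idealDiff_add, mul_zero, sub_zero, zero_add]

lemma sum_idealDiff_dotProduct {n : ℕ} (hdvd : ∀ t ∈ 𝔞, ∀ d : R, d ≠ 0 → d ∣ t) (d : Fin n → R)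
    (hd : d ≠ 0) (w : R) : ∑ x : Fin n → R, idealDiff 𝔞 (w + x ⬝ᵥ d) = 0 := by
  have : Fintype 𝔞 := Fintype.ofFinite _
  obtain ⟨k, hk⟩ := Function.ne_iff.1 hd
  have htrans (t : 𝔞) : ∑ x : Fin n → R, idealDiff 𝔞 (t + (w + x ⬝ᵥ d)) =
      ∑ x : Fin n → R, idealDiff 𝔞 (w + x ⬝ᵥ d) := by
    obtain ⟨c, hc⟩ := hdvd t t.2 (d k) hk
    rw [← Equiv.sum_comp (Equiv.addRight (Pi.single k c)) (fun x => idealDiff 𝔞 (w + x ⬝ᵥ d))]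
    refine Fintype.sum_congr _ _ fun x => ?_
    rw [Equiv.coe_addRight, add_dotProduct, single_dotProduct, hc]
    ring_nf
  have hsum : ∑ t : 𝔞, ∑ x : Fin n → R, idealDiff 𝔞 (t + (w + x ⬝ᵥ d)) = 0 := by
    rw [Finset.sum_comm]
    exact Finset.sum_eq_zero fun x _ => sum_idealDiff_add _
  simp only [htrans, Finset.sum_const, Finset.card_univ, nsmul_eq_mul] at hsum
  refine (mul_eq_zero.1 hsum).resolve_left ?_
  rw [← Nat.card_eq_fintype_card]
  exact card_ideal_ne_zero 𝔞

/-- The matrix `ψ (z + w + x ⬝ y)`, with rows `(x, z)` and columns `(y, w)`: a Herz-Schur symbol of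
the Heisenberg group over `R`, restricted to two of its abelian subgroups. -/
def heisMatrix (n : ℕ) (ψ : R → ℂ) : Matrix ((Fin n → R) × R) ((Fin n → R) × R) ℂ :=
  Matrix.of fun i j => ψ (i.2 + j.2 + i.1 ⬝ᵥ j.1)

open scoped Classical in
/-- The matrix of the convolution by `idealDiff 𝔞` in the last variable. -/
def heisProj (n : ℕ) (𝔞 : Ideal R) : Matrix ((Fin n → R) × R) ((Fin n → R) × R) ℂ :=
  Matrix.of fun i j => if i.1 = j.1 then idealDiff 𝔞 (i.2 - j.2) else 0

lemma heisMatrix_mul_heisProj (n : ℕ) (ψ : R → ℂ) :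
    heisMatrix n ψ * heisProj n 𝔞 = heisMatrix n fun s => ∑ v, ψ (s + v) * idealDiff 𝔞 v := by
  classical
  ext i j
  simp only [mul_apply, heisMatrix, heisProj, of_apply, Fintype.sum_prod_type, mul_ite, mul_zero]
  rw [Finset.sum_comm]
  simp only [Finset.sum_ite_eq', Finset.mem_univ, if_true]
  rw [← Equiv.sum_comp (Equiv.addRight j.2)]
  refine Fintype.sum_congr _ _ fun v => ?_
  simp only [Equiv.coe_addRight, add_sub_cancel_right]
  ring_nf

lemma isStarProjection_heisProj (n : ℕ) : IsStarProjection (heisProj n 𝔞) where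
  isIdempotentElem := by
    classical
    ext i j
    simp only [mul_apply, heisProj, of_apply, Fintype.sum_prod_type]
    rw [Finset.sum_comm]
    simp only [mul_ite, mul_zero, Finset.sum_ite_eq', Finset.mem_univ, if_true, ite_mul, zero_mul]
    split_ifs with h
    · have := sum_idealDiff_mul_idealDiff (𝔞 := 𝔞) (-i.2) (-j.2)
      rw [← idealDiff_neg, show -(i.2 - j.2) = -i.2 - -j.2 by ring, ← this]
      refine Fintype.sum_congr _ _ fun v => ?_
      rw [← idealDiff_neg, neg_sub, sub_eq_add_neg, sub_eq_add_neg]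
    · simp
  isSelfAdjoint := by
    classical
    ext i j
    simp only [star_eq_conjTranspose, conjTranspose_apply, heisProj, of_apply, apply_ite star,
      star_idealDiff, star_zero]
    rw [← idealDiff_neg, neg_sub]
    exact if_congr eq_comm rfl rfl

lemma trace_heisProj (n : ℕ) : (heisProj n 𝔞).trace =
    (Nat.card R : ℂ) ^ (n + 1) * (1 - (Nat.card 𝔞 : ℂ)⁻¹) := by
  simp [trace, heisProj, idealDiff, Nat.card_eq_fintype_card, pow_succ, mul_sub]

lemma conjTranspose_heisMatrix_mul_self (n : ℕ) (hdvd : ∀ t ∈ 𝔞, ∀ d : R, d ≠ 0 → d ∣ t) :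
    (heisMatrix n (idealDiff 𝔞))ᴴ * heisMatrix n (idealDiff 𝔞) =
      ((Nat.card R : ℝ≥0) ^ n) • heisProj n 𝔞 := by
  classical
  ext i j
  simp only [mul_apply, conjTranspose_apply, heisMatrix, of_apply, star_idealDiff,
    Matrix.smul_apply, heisProj, Fintype.sum_prod_type]
  have hconv (x : Fin n → R) : ∑ z, idealDiff 𝔞 (z + i.2 + x ⬝ᵥ i.1) *
      idealDiff 𝔞 (z + j.2 + x ⬝ᵥ j.1) = idealDiff 𝔞 (i.2 - j.2 + x ⬝ᵥ (i.1 - j.1)) := by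
    simp only [add_assoc]
    rw [sum_idealDiff_mul_idealDiff, dotProduct_sub]
    ring_nf
  simp only [hconv]
  split_ifs with h
  · simp [h, NNReal.smul_def, Nat.card_eq_fintype_card]
  · rw [smul_zero, sum_idealDiff_dotProduct hdvd _ (sub_ne_zero.2 h)]

lemma heisMatrix_mul_heisProj_of_radial (n : ℕ) {ψ : R → ℂ} {ψ₁ : ℂ}
    (hconst : ∀ t ∈ 𝔞, t ≠ 0 → ψ t = ψ₁) (hinv : ∀ s ∉ 𝔞, ∀ t ∈ 𝔞, ψ (s + t) = ψ s) :
    heisMatrix n ψ * heisProj n 𝔞 = (ψ 0 - ψ₁) • heisMatrix n (idealDiff 𝔞) := by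
  classical
  have : Fintype 𝔞 := Fintype.ofFinite _
  have hc := card_ideal_ne_zero 𝔞
  rw [heisMatrix_mul_heisProj]
  ext i j
  simp only [heisMatrix, of_apply, Matrix.smul_apply, smul_eq_mul]
  generalize i.2 + j.2 + i.1 ⬝ᵥ j.1 = s
  rw [sum_mul_idealDiff (fun v => ψ (s + v)), add_zero]
  by_cases hs : s ∈ 𝔞
  · have hshift : ∑ t : 𝔞, ψ (s + t) = ∑ t : 𝔞, ψ t :=
      Equiv.sum_comp (Equiv.addLeft (⟨s, hs⟩ : 𝔞)) (fun t => ψ t)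
    rw [hshift, sum_ideal_of_const hconst, idealDiff, if_pos hs]
    split_ifs with h0
    · rw [h0]; field_simp; ring
    · rw [hconst s hs h0]; field_simp; ring
  · have h0 : s ≠ 0 := fun h => hs (h ▸ 𝔞.zero_mem)
    rw [idealDiff, if_neg hs, if_neg h0]
    simp only [hinv s hs _ (Subtype.prop _), Finset.sum_const, Finset.card_univ, nsmul_eq_mul,
      ← Nat.card_eq_fintype_card]
    field_simp
    ring

lemma sum_heisMatrix (n : ℕ) (ψ : R → ℂ) :
    ∑ i, ∑ j, heisMatrix n ψ i j = (Nat.card R : ℂ) ^ (2 * n + 1) * ∑ s, ψ s := by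
  simp only [heisMatrix, of_apply, Fintype.sum_prod_type]
  have (x y : Fin n → R) (z : R) : ∑ w, ψ (z + w + x ⬝ᵥ y) = ∑ s, ψ s := by
    rw [← Equiv.sum_comp (Equiv.addLeft (z + x ⬝ᵥ y)) ψ]
    refine Fintype.sum_congr _ _ fun v => ?_
    rw [Equiv.coe_addLeft]
    ring_nf
  simp only [this, Finset.sum_const, Finset.card_univ, Fintype.card_pi, Finset.prod_const,
    Fintype.card_fin, nsmul_eq_mul, Nat.card_eq_fintype_card]
  push_cast
  ring

end FiniteRing

section MatSchur

open Matrix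

variable {H : Type*} [NormedAddCommGroup H] [InnerProductSpace ℂ H] [CompleteSpace H]
  {ι : Type*} [Fintype ι]

/-- The finite form of `MSNormLE`: Schur multiplication by the matrix `m`, in the coordinates given
by the families `e` (rows) and `g` (columns), has norm at most `C` on `S^p`. The image `B` is only
pinned down through its matrix coefficients. -/
def MatSchurLE (p : ℝ≥0∞) (e g : ι → H) (m : Matrix ι ι ℂ) (C : ℝ≥0) : Prop :=
  ∀ T : Matrix ι ι ℂ, schattenNorm p (matOp e g T) < ∞ → ∃ B : H →L[ℂ] H,
    (∀ i j, ⟪e i, B (g j)⟫_ℂ = m i j * T i j) ∧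
      schattenNorm p B ≤ C * schattenNorm p (matOp e g T)

variable {e g : ι → H}

lemma MatSchurLE.exists_schattenNorm_le {p : ℝ≥0∞} {m : Matrix ι ι ℂ} {C : ℝ≥0}
    (h : MatSchurLE p e g m C) (he : Orthonormal ℂ e) (hg : Orthonormal ℂ g)
    {T P : Matrix ι ι ℂ} (hP : IsStarProjection P) {c k : ℝ≥0} (hT : Tᴴ * T = c ^ 2 • P)
    (hk : P.trace = k) (hp : p ≠ 0) :
    ∃ B : H →L[ℂ] H, (∀ i j, ⟪e i, B (g j)⟫_ℂ = m i j * T i j) ∧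
      schattenNorm p B ≤ (C * (c * k ^ (1 / p.toReal)) : ℝ≥0) := by
  have hle : schattenNorm p (matOp e g T) ≤ (c * k ^ (1 / p.toReal) : ℝ≥0) := by
    rw [ENNReal.coe_mul, ENNReal.coe_rpow_of_nonneg _ (by positivity)]
    exact schattenNorm_matOp_le he hg hP hT hk hp
  obtain ⟨B, hB, hBC⟩ := h T (hle.trans_lt ENNReal.coe_lt_top)
  exact ⟨B, hB, hBC.trans ((mul_le_mul_right hle _).trans_eq (ENNReal.coe_mul _ _).symm)⟩

omit [CompleteSpace H] in
lemma norm_sum_inner_le (he : Orthonormal ℂ e) (hg : Orthonormal ℂ g) (B : H →L[ℂ] H) :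
    ‖∑ i, ∑ j, ⟪e i, B (g j)⟫_ℂ‖ ≤ Fintype.card ι * ‖B‖ := by
  have hnorm {f : ι → H} (hf : Orthonormal ℂ f) : ‖∑ i, f i‖ = √(Fintype.card ι) := by
    rw [← Real.sqrt_sq (norm_nonneg _)]
    simpa using congrArg Real.sqrt (norm_sq_sum_smul hf fun _ => 1)
  calc ‖∑ i, ∑ j, ⟪e i, B (g j)⟫_ℂ‖ = ‖⟪∑ i, e i, B (∑ j, g j)⟫_ℂ‖ := by
        rw [Finset.sum_comm]
        simp only [map_sum, sum_inner, inner_sum]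
    _ ≤ ‖∑ i, e i‖ * (‖B‖ * ‖∑ j, g j‖) := (norm_inner_le_norm _ _).trans (by
        gcongr
        exact B.le_opNorm _)
    _ = Fintype.card ι * ‖B‖ := by
        rw [hnorm he, hnorm hg, mul_left_comm, Real.mul_self_sqrt (Nat.cast_nonneg _), mul_comm]

lemma star_dotProduct_self (x : ι → ℂ) : star x ⬝ᵥ x = ((∑ i, ‖x i‖ ^ 2 : ℝ) : ℂ) := by
  simp [dotProduct, Complex.conj_mul']

lemma sum_norm_sq_mulVec {T P : Matrix ι ι ℂ} {c : ℝ≥0} (hT : Tᴴ * T = c ^ 2 • P) {x : ι → ℂ}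
    (hx : P *ᵥ x = x) : ∑ i, ‖(T *ᵥ x) i‖ ^ 2 = (c : ℝ) ^ 2 * ∑ j, ‖x j‖ ^ 2 := by
  have hdot : star (T *ᵥ x) ⬝ᵥ (T *ᵥ x) = ((c : ℝ) : ℂ) ^ 2 * (star x ⬝ᵥ x) := by
    rw [star_mulVec, ← dotProduct_mulVec, mulVec_mulVec, hT, smul_mulVec, hx, dotProduct_smul,
      NNReal.smul_def, Complex.real_smul]
    push_cast
    rfl
  rw [star_dotProduct_self, star_dotProduct_self] at hdot
  exact_mod_cast hdot

omit [CompleteSpace H] in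
lemma norm_sum_mulVec_smul (he : Orthonormal ℂ e) (hg : Orthonormal ℂ g) {T P : Matrix ι ι ℂ}
    {c : ℝ≥0} (hT : Tᴴ * T = c ^ 2 • P) {x : ι → ℂ} (hx : P *ᵥ x = x) :
    ‖∑ i, (T *ᵥ x) i • e i‖ = c * ‖∑ j, x j • g j‖ := by
  rw [← sq_eq_sq₀ (norm_nonneg _) (by positivity), norm_sq_sum_smul he, mul_pow,
    norm_sq_sum_smul hg, sum_norm_sq_mulVec hT hx]

omit [CompleteSpace H] in
lemma finrank_map_linearCombination (he : Orthonormal ℂ e) {T P : Matrix ι ι ℂ}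
    (hP : IsIdempotentElem P) {c : ℝ≥0} (hc : c ≠ 0) (hT : Tᴴ * T = c ^ 2 • P) :
    Module.finrank ℂ ((LinearMap.range P.mulVecLin).map
      (Fintype.linearCombination ℂ e ∘ₗ T.mulVecLin)) =
      Module.finrank ℂ (LinearMap.range P.mulVecLin) := by
  rw [← LinearMap.range_domRestrict]
  refine LinearMap.finrank_range_of_inj ((injective_iff_map_eq_zero _).2 ?_)
  rintro ⟨_, y, rfl⟩ hx
  have hzero : ∑ i, (T *ᵥ (P *ᵥ y)) i • e i = 0 := hx
  have hsq := sum_norm_sq_mulVec hT (x := P *ᵥ y) (by rw [mulVec_mulVec, hP.eq])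
  rw [← norm_sq_sum_smul he, hzero, norm_zero, sq, zero_mul, eq_comm, mul_eq_zero] at hsq
  have hsum := hsq.resolve_left (by positivity)
  rw [Finset.sum_eq_zero_iff_of_nonneg fun _ _ => by positivity] at hsum
  ext i
  simpa using hsum i (Finset.mem_univ i)

/-- The lower bound comes from testing `B*` on the image of the range of `P` under `T`, on which
`B*` acts like `z̄ T*`. -/
lemma le_schattenNorm_of_mul_eq_smul (he : Orthonormal ℂ e) (hg : Orthonormal ℂ g)
    {T P : Matrix ι ι ℂ} (hP : IsStarProjection P) {c : ℝ≥0} (hc : c ≠ 0)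
    (hT : Tᴴ * T = c ^ 2 • P) {B : H →L[ℂ] H} {z : ℂ}
    (hB : (Matrix.of fun i j => ⟪e i, B (g j)⟫_ℂ) * P = z • T) {p : ℝ≥0} (hp0 : 0 < p)
    (hp2 : p ≤ 2) :
    (‖z‖₊ * c : ℝ≥0) * (Module.finrank ℂ (LinearMap.range P.mulVecLin) : ℝ≥0∞) ^ (1 / (p : ℝ)) ≤
      schattenNorm p B := by
  rw [← finrank_map_linearCombination he hP.isIdempotentElem hc hT]
  refine le_schattenNorm_of_le_norm_star B hp0 hp2 _ ?_
  rintro _ ⟨_, ⟨y, rfl⟩, rfl⟩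
  set x := P *ᵥ y
  have hx : P *ᵥ x = x := by rw [mulVec_mulVec, hP.isIdempotentElem.eq]
  set u := ∑ i, (T *ᵥ x) i • e i
  change _ * ‖u‖ ≤ ‖star B u‖
  have hu : ‖u‖ = c * ‖∑ j, x j • g j‖ := norm_sum_mulVec_smul he hg hT hx
  have hBx : (Matrix.of fun i j => ⟪e i, B (g j)⟫_ℂ) *ᵥ x = z • T *ᵥ x := by
    conv_lhs => rw [← hx, mulVec_mulVec, hB, smul_mulVec]
  have hinner : ⟪star B u, ∑ j, x j • g j⟫_ℂ = z * ((‖u‖ ^ 2 : ℝ) : ℂ) := by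
    rw [ContinuousLinearMap.star_eq_adjoint, ContinuousLinearMap.adjoint_inner_left,
      inner_sum_smul_matOp, hBx, norm_sq_sum_smul he, dotProduct_smul, star_dotProduct_self,
      smul_eq_mul]
  have hle := norm_inner_le_norm (𝕜 := ℂ) (star B u) (∑ j, x j • g j)
  rw [hinner, norm_mul, Complex.norm_real, norm_pow, norm_norm, hu] at hle
  rw [hu, NNReal.coe_mul, coe_nnnorm]
  rcases (norm_nonneg (∑ j, x j • g j)).eq_or_lt with h0 | h0
  · rw [← h0, mul_zero, mul_zero]
    positivity
  · refine le_of_mul_le_mul_right (le_trans (le_of_eq ?_) hle) h0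
    ring

lemma isStarProjection_const (ι : Type*) [Fintype ι] [Nonempty ι] :
    IsStarProjection (Matrix.of fun _ _ : ι => (Fintype.card ι : ℂ)⁻¹) where
  isIdempotentElem := by
    ext i j
    simp [mul_apply]
  isSelfAdjoint := by
    ext i j
    simp

lemma trace_const_inv_card (ι : Type*) [Fintype ι] [Nonempty ι] :
    (Matrix.of fun _ _ : ι => (Fintype.card ι : ℂ)⁻¹).trace = ((1 : ℝ≥0) : ℝ) := by
  simp [trace]

lemma conjTranspose_mul_self_const_one (ι : Type*) [Fintype ι] :
    (Matrix.of fun _ _ : ι => (1 : ℂ))ᴴ * (Matrix.of fun _ _ : ι => (1 : ℂ)) =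
      (Fintype.card ι : ℝ≥0) ^ 2 • Matrix.of fun _ _ : ι => (Fintype.card ι : ℂ)⁻¹ := by
  ext i j
  have := Nonempty.intro i
  simp [mul_apply, NNReal.smul_def, sq]

end MatSchur

section HeisenbergEstimate

open Matrix

/-- The rate of decay `(n + 1) |1 / p - 1 / 2| - 1 / 2`, as a power of the cardinality of the ring,
which boundedness on `S^p` forces on symbols on a Heisenberg group of dimension `2 n + 1`.
The convention `1 / ∞.toReal = 1 / 0 = 0` gives the right value `n / 2` for `p = ∞`. -/
def heisExponent (n : ℕ) (p : ℝ≥0∞) : ℝ :=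
  (n + 1) * |1 / p.toReal - 1 / 2| - 1 / 2

lemma heisExponent_of_two_le (n : ℕ) {p : ℝ≥0∞} (hp : 2 ≤ p) :
    heisExponent n p = n / 2 - (n + 1) / p.toReal := by
  have hle : 1 / p.toReal ≤ 1 / 2 := by
    rcases eq_or_ne p ∞ with rfl | htop
    · simp
    · exact one_div_le_one_div_of_le two_pos (by simpa using ENNReal.toReal_mono htop hp)
  rw [heisExponent, abs_of_nonpos (sub_nonpos.2 hle)]
  ring

lemma heisExponent_of_le_two (n : ℕ) {p : ℝ≥0∞} (hp0 : 0 < p) (hp2 : p ≤ 2) :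
    heisExponent n p = (n + 1) / p.toReal - (n / 2 + 1) := by
  have hle : 1 / 2 ≤ 1 / p.toReal :=
    one_div_le_one_div_of_le (ENNReal.toReal_pos hp0.ne' (ne_top_of_le_ne_top (by simp) hp2))
      (by simpa using ENNReal.toReal_mono (by simp) hp2)
  rw [heisExponent, abs_of_nonneg (sub_nonneg.2 hle)]
  ring

lemma heisExponent_pos_of_lt {n : ℕ} {p : ℝ≥0∞} (hp0 : 0 < p)
    (hp : p < ENNReal.ofReal (2 - 2 / ((n : ℝ) + 2))) : 0 < heisExponent n p := by
  have hle : ENNReal.ofReal (2 - 2 / ((n : ℝ) + 2)) ≤ 2 :=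
    ENNReal.ofReal_le_of_le_toReal (by simpa using (by positivity : (0 : ℝ) ≤ 2 / (n + 2)))
  have hlt := (ENNReal.lt_ofReal_iff_toReal_lt hp.ne_top).1 hp
  have hpos : 0 < p.toReal := ENNReal.toReal_pos hp0.ne' hp.ne_top
  rw [heisExponent_of_le_two n hp0 (hp.le.trans hle), sub_pos, lt_div_iff₀ hpos]
  calc ((n : ℝ) / 2 + 1) * p.toReal < (n / 2 + 1) * (2 - 2 / (n + 2)) := by gcongr
    _ = n + 1 := by field_simp; ring

lemma heisExponent_pos_of_gt {n : ℕ} (hn : 1 ≤ n) {p : ℝ≥0∞}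
    (hp : ENNReal.ofReal (2 + 2 / (n : ℝ)) < p) : 0 < heisExponent n p := by
  have hn0 : (0 : ℝ) < n := by exact_mod_cast hn
  have hle : 2 ≤ ENNReal.ofReal (2 + 2 / (n : ℝ)) := by
    rw [← ENNReal.ofReal_ofNat]
    exact ENNReal.ofReal_le_ofReal (le_add_of_nonneg_right (by positivity))
  rw [heisExponent_of_two_le n (hle.trans hp.le), sub_pos]
  rcases eq_or_ne p ∞ with rfl | htop
  · simpa using hn0
  have hlt := (ENNReal.ofReal_lt_iff_lt_toReal (by positivity) htop).1 hp
  rw [div_lt_iff₀ (lt_trans (by positivity) hlt)]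
  calc (n : ℝ) + 1 = n / 2 * (2 + 2 / n) := by field_simp
    _ < n / 2 * p.toReal := by gcongr

variable {R : Type*} [CommRing R] [Fintype R] {𝔞 : Ideal R}

lemma trace_eq_finrank_range {ι : Type*} [Fintype ι] {P : Matrix ι ι ℂ}
    (hP : IsIdempotentElem P) : P.trace = Module.finrank ℂ (LinearMap.range P.mulVecLin) := by
  classical
  have hQ : IsIdempotentElem P.mulVecLin := by
    rw [IsIdempotentElem, Module.End.mul_eq_comp, ← mulVecLin_mul, hP.eq]
  rw [← (LinearMap.IsIdempotentElem.isProj_range _ hQ).trace, ← toLin'_apply', trace_toLin'_eq]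

lemma finrank_range_heisProj_le (n : ℕ) :
    Module.finrank ℂ (LinearMap.range (heisProj n 𝔞).mulVecLin) ≤ Nat.card R ^ (n + 1) := by
  refine (Submodule.finrank_le _).trans_eq ?_
  simp [Nat.card_eq_fintype_card, pow_succ]

lemma le_two_mul_finrank_range_heisProj (n : ℕ) (hcard : 2 ≤ Nat.card 𝔞) :
    (Nat.card R : ℝ) ^ (n + 1) ≤
      2 * Module.finrank ℂ (LinearMap.range (heisProj n 𝔞).mulVecLin) := by
  have htrace := trace_eq_finrank_range (isStarProjection_heisProj (𝔞 := 𝔞) n).isIdempotentElem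
  rw [trace_heisProj] at htrace
  have hrank : (Nat.card R : ℝ) ^ (n + 1) * (1 - (Nat.card 𝔞 : ℝ)⁻¹) =
      Module.finrank ℂ (LinearMap.range (heisProj n 𝔞).mulVecLin) := by
    apply Complex.ofReal_injective
    push_cast
    exact htrace
  have hinv : (Nat.card 𝔞 : ℝ)⁻¹ ≤ 2⁻¹ := inv_anti₀ two_pos (by exact_mod_cast hcard)
  rw [← hrank]
  nlinarith [pow_nonneg (Nat.cast_nonneg (α := ℝ) (Nat.card R)) (n + 1)]

lemma half_norm_le_norm_one_sub_inv_mul {N : ℕ} (hN : 2 ≤ N) (z : ℂ) :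
    ‖z‖ / 2 ≤ ‖(1 - (N : ℂ)⁻¹) * z‖ := by
  have hinv : (N : ℝ)⁻¹ ≤ 2⁻¹ := inv_anti₀ two_pos (by exact_mod_cast hN)
  have hle : 1 / 2 ≤ ‖1 - (N : ℂ)⁻¹‖ := by
    refine le_trans ?_ (norm_sub_norm_le _ _)
    rw [norm_one, norm_inv, Complex.norm_natCast]
    linarith
  rw [norm_mul]
  nlinarith [norm_nonneg z]

lemma conjTranspose_heisMatrix_mul_self_sq (n : ℕ) (hdvd : ∀ t ∈ 𝔞, ∀ d : R, d ≠ 0 → d ∣ t) :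
    (heisMatrix n (idealDiff 𝔞))ᴴ * heisMatrix n (idealDiff 𝔞) =
      ((Nat.card R : ℝ≥0) ^ ((n : ℝ) / 2)) ^ 2 • heisProj n 𝔞 := by
  rw [conjTranspose_heisMatrix_mul_self n hdvd, ← NNReal.rpow_natCast, ← NNReal.rpow_natCast,
    ← NNReal.rpow_mul]
  congr 2
  push_cast
  ring

lemma pow_rpow_one_div {N : ℝ} (hN : 0 ≤ N) (n : ℕ) (q : ℝ) :
    (N ^ (n + 1)) ^ (1 / q) = N ^ ((n + 1) / q) := by
  rw [← Real.rpow_natCast, ← Real.rpow_mul hN]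
  push_cast
  ring_nf

variable {H : Type*} [NormedAddCommGroup H] [InnerProductSpace ℂ H] [CompleteSpace H] {n : ℕ}
  {ψ : R → ℂ} {ψ₁ : ℂ} {e g : (Fin n → R) × R → H} {p : ℝ≥0∞} {C : ℝ≥0}

/-- The multiplier is tested on the matrix of `idealDiff 𝔞`. -/
lemma norm_sub_le_of_idealDiff (hdvd : ∀ t ∈ 𝔞, ∀ d : R, d ≠ 0 → d ∣ t)
    (hcard : 2 ≤ Nat.card 𝔞) (hconst : ∀ t ∈ 𝔞, t ≠ 0 → ψ t = ψ₁) (he : Orthonormal ℂ e)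
    (hg : Orthonormal ℂ g) (hp : p ≠ 0) (hC : MatSchurLE p e g (heisMatrix n ψ) C) :
    ‖ψ 0 - ψ₁‖ ≤ 2 * C * (Nat.card R : ℝ) ^ ((n + 1) / p.toReal - n / 2) := by
  have hP := isStarProjection_heisProj (𝔞 := 𝔞) n
  obtain ⟨B, hB, hBC⟩ := hC.exists_schattenNorm_le he hg hP
    (conjTranspose_heisMatrix_mul_self_sq n hdvd)
    (k := Module.finrank ℂ (LinearMap.range (heisProj n 𝔞).mulVecLin))
    (by simpa using trace_eq_finrank_range hP.isIdempotentElem) hp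
  set N : ℝ := (Nat.card R : ℝ) with hN
  have hN0 : 0 < N := Nat.cast_pos.2 Nat.card_pos
  have hBnorm : ‖B‖ ≤ C * (N ^ ((n : ℝ) / 2) * N ^ ((n + 1) / p.toReal)) := by
    rw [← pow_rpow_one_div hN0.le]
    refine le_trans (b := C * (N ^ ((n : ℝ) / 2) * (Module.finrank ℂ
      (LinearMap.range (heisProj n 𝔞).mulVecLin) : ℝ) ^ (1 / p.toReal))) ?_ ?_
    · exact_mod_cast ENNReal.coe_le_coe.1 ((enorm_le_schattenNorm B hp).trans hBC)
    · gcongr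
      rw [hN]
      exact_mod_cast finrank_range_heisProj_le n
  have hcoeff : ∑ i, ∑ j, ⟪e i, B (g j)⟫_ℂ =
      (N : ℂ) ^ (2 * n + 1) * ((1 - (Nat.card 𝔞 : ℂ)⁻¹) * (ψ 0 - ψ₁)) := by
    rw [← sum_mul_idealDiff_of_const hconst, hN, Complex.ofReal_natCast, ← sum_heisMatrix]
    simp only [hB, heisMatrix, of_apply]
  have hdim : (Fintype.card ((Fin n → R) × R) : ℝ) = N ^ (n + 1) := by
    simp [hN, Nat.card_eq_fintype_card, pow_succ]
  have htest : N ^ (2 * n + 1) * (‖ψ 0 - ψ₁‖ / 2) ≤ N ^ (n + 1) * ‖B‖ := by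
    have hle := norm_sum_inner_le he hg B
    rw [hcoeff, norm_mul, norm_pow, Complex.norm_real, Real.norm_of_nonneg hN0.le, hdim] at hle
    exact le_trans (by gcongr; exact half_norm_le_norm_one_sub_inv_mul hcard _) hle
  have hpow : N ^ (n + 1) * (N ^ ((n : ℝ) / 2) * N ^ ((n + 1) / p.toReal)) =
      N ^ (2 * n + 1) * N ^ ((n + 1) / p.toReal - n / 2) := by
    simp only [← Real.rpow_natCast, ← Real.rpow_add hN0]
    push_cast
    ring_nf
  refine le_of_mul_le_mul_left ?_ (by positivity : 0 < N ^ (2 * n + 1))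
  linarith [mul_le_mul_of_nonneg_left hBnorm (by positivity : 0 ≤ 2 * N ^ (n + 1)),
    congrArg (2 * (C : ℝ) * ·) hpow]

/-- The multiplier is tested on the rank one matrix with all entries `1`. -/
lemma norm_sub_le_of_le_two (hdvd : ∀ t ∈ 𝔞, ∀ d : R, d ≠ 0 → d ∣ t) (hcard : 2 ≤ Nat.card 𝔞)
    (hconst : ∀ t ∈ 𝔞, t ≠ 0 → ψ t = ψ₁) (hinv : ∀ s ∉ 𝔞, ∀ t ∈ 𝔞, ψ (s + t) = ψ s)
    (he : Orthonormal ℂ e) (hg : Orthonormal ℂ g) {p : ℝ≥0} (hp0 : 0 < p) (hp2 : p ≤ 2)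
    (hC : MatSchurLE p e g (heisMatrix n ψ) C) :
    ‖ψ 0 - ψ₁‖ ≤
      2 ^ (1 / (p : ℝ)) * C * (Nat.card R : ℝ) ^ (n / 2 + 1 - (n + 1) / (p : ℝ)) := by
  obtain ⟨B, hB, hBC⟩ := hC.exists_schattenNorm_le he hg (isStarProjection_const _)
    (conjTranspose_mul_self_const_one _) (trace_const_inv_card _) (by exact_mod_cast hp0.ne')
  have hcoeff : (Matrix.of fun i j => ⟪e i, B (g j)⟫_ℂ) = heisMatrix n ψ := by
    ext i j
    simp [hB]
  have hlow := (le_schattenNorm_of_mul_eq_smul he hg (isStarProjection_heisProj (𝔞 := 𝔞) n)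
    (NNReal.rpow_pos (by exact_mod_cast Nat.card_pos (α := R))).ne'
    (conjTranspose_heisMatrix_mul_self_sq n hdvd)
    (hcoeff ▸ heisMatrix_mul_heisProj_of_radial n hconst hinv) hp0 hp2).trans hBC
  set N : ℝ := (Nat.card R : ℝ) with hN
  set d := Module.finrank ℂ (LinearMap.range (heisProj n 𝔞).mulVecLin)
  have hN0 : 0 < N := Nat.cast_pos.2 Nat.card_pos
  have htest : ‖ψ 0 - ψ₁‖ * N ^ ((n : ℝ) / 2) * (d : ℝ) ^ (1 / (p : ℝ)) ≤ C * N ^ (n + 1) := by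
    have hdim : (Fintype.card ((Fin n → R) × R) : ℝ≥0) = (Nat.card R : ℝ≥0) ^ (n + 1) := by
      simp [Nat.card_eq_fintype_card, pow_succ]
    rw [← ENNReal.coe_natCast, ← ENNReal.coe_rpow_of_nonneg _ (by positivity), NNReal.one_rpow,
      mul_one, hdim] at hlow
    rw [hN]
    exact_mod_cast NNReal.coe_le_coe.2 (ENNReal.coe_le_coe.1 hlow)
  have hrank : N ^ ((n + 1) / (p : ℝ)) ≤ 2 ^ (1 / (p : ℝ)) * (d : ℝ) ^ (1 / (p : ℝ)) := by
    rw [← pow_rpow_one_div hN0.le, ← Real.mul_rpow two_pos.le (Nat.cast_nonneg _)]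
    gcongr
    exact le_two_mul_finrank_range_heisProj n hcard
  have hpow : N ^ (n + 1) =
      N ^ (n / 2 + 1 - (n + 1) / (p : ℝ)) * (N ^ ((n : ℝ) / 2) * N ^ ((n + 1) / (p : ℝ))) := by
    simp only [← Real.rpow_natCast, ← Real.rpow_add hN0]
    push_cast
    ring_nf
  refine le_of_mul_le_mul_right ?_
    (by positivity : 0 < N ^ ((n : ℝ) / 2) * N ^ ((n + 1) / (p : ℝ)))
  calc ‖ψ 0 - ψ₁‖ * (N ^ ((n : ℝ) / 2) * N ^ ((n + 1) / (p : ℝ)))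
      ≤ ‖ψ 0 - ψ₁‖ * (N ^ ((n : ℝ) / 2) * (2 ^ (1 / (p : ℝ)) * (d : ℝ) ^ (1 / (p : ℝ)))) := by
        gcongr
    _ = 2 ^ (1 / (p : ℝ)) * (‖ψ 0 - ψ₁‖ * N ^ ((n : ℝ) / 2) * (d : ℝ) ^ (1 / (p : ℝ))) := by ring
    _ ≤ 2 ^ (1 / (p : ℝ)) * (C * N ^ (n + 1)) := by gcongr
    _ = _ := by rw [hpow]; ring

lemma norm_sub_le_of_matSchurLE (hdvd : ∀ t ∈ 𝔞, ∀ d : R, d ≠ 0 → d ∣ t)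
    (hcard : 2 ≤ Nat.card 𝔞) (hconst : ∀ t ∈ 𝔞, t ≠ 0 → ψ t = ψ₁)
    (hinv : ∀ s ∉ 𝔞, ∀ t ∈ 𝔞, ψ (s + t) = ψ s) (he : Orthonormal ℂ e) (hg : Orthonormal ℂ g)
    (hp : p ≠ 0) (hC : MatSchurLE p e g (heisMatrix n ψ) C) :
    ‖ψ 0 - ψ₁‖ ≤ 2 ^ (1 + 1 / p.toReal) * C * (Nat.card R : ℝ) ^ (-heisExponent n p) := by
  rcases le_total 2 p with hp2 | hp2
  · rw [heisExponent_of_two_le n hp2, neg_sub]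
    refine (norm_sub_le_of_idealDiff hdvd hcard hconst he hg hp hC).trans ?_
    gcongr
    exact Real.self_le_rpow_of_one_le one_le_two (le_add_of_nonneg_right (by positivity))
  · rw [heisExponent_of_le_two n hp.bot_lt hp2, neg_sub]
    lift p to ℝ≥0 using ne_top_of_le_ne_top (by simp) hp2
    refine (norm_sub_le_of_le_two hdvd hcard hconst hinv he hg
      (pos_iff_ne_zero.2 (ENNReal.coe_ne_zero.1 hp)) (by exact_mod_cast hp2) hC).trans ?_
    rw [ENNReal.coe_toReal]
    gcongr
    · exact one_le_two
    · exact le_add_of_nonneg_left zero_le_one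

end HeisenbergEstimate

section Kernel

variable {X : Type*} [MeasurableSpace X] {μ : Measure X}

lemma inner_eq_integral {g : Lp ℂ 2 μ} {g' : X → ℂ} (hg : g =ᵐ[μ] g') (f : Lp ℂ 2 μ) :
    ⟪g, f⟫_ℂ = ∫ y, conj (g' y) * f y ∂μ := by
  rw [L2.inner_def]
  refine integral_congr_ae ?_
  filter_upwards [hg] with y hy
  rw [hy, RCLike.inner_apply, mul_comm]

lemma integrable_conj_mul {g : Lp ℂ 2 μ} {g' : X → ℂ} (hg : g =ᵐ[μ] g') (f : Lp ℂ 2 μ) :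
    Integrable (fun y => conj (g' y) * f y) μ := by
  refine (L2.integrable_inner (𝕜 := ℂ) g f).congr ?_
  filter_upwards [hg] with y hy
  rw [hy, RCLike.inner_apply, mul_comm]

lemma ae_memLp_prodMk_left [SFinite μ] {k : X × X → ℂ} (hk : MemLp k 2 (μ.prod μ)) :
    ∀ᵐ x ∂μ, MemLp (fun y => k (x, y)) 2 μ := by
  have hsq := (memLp_two_iff_integrable_sq_norm hk.1).1 hk
  filter_upwards [hk.1.prodMk_left, hsq.prod_right_ae] with x hmeas hint
  exact (memLp_two_iff_integrable_sq_norm hmeas).2 hint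

lemma HasKernel.ae_unique [SFinite μ] [MeasurableSpace.CountablyGenerated X]
    {A : Lp ℂ 2 μ →L[ℂ] Lp ℂ 2 μ} {k k' : X × X → ℂ} (hk : MemLp k 2 (μ.prod μ))
    (hk' : MemLp k' 2 (μ.prod μ)) (hA : HasKernel μ A k) (hA' : HasKernel μ A k') :
    ∀ᵐ x ∂μ, ∀ᵐ y ∂μ, k (x, y) = k' (x, y) := by
  have : Fact ((2 : ℝ≥0∞) ≠ ∞) := ⟨by norm_num⟩
  let f : ℕ → Lp ℂ 2 μ := TopologicalSpace.denseSeq (Lp ℂ 2 μ)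
  have hf : DenseRange f := TopologicalSpace.denseRange_denseSeq _
  have hpair : ∀ᵐ x ∂μ, ∀ n, ∫ y, k (x, y) * f n y ∂μ = ∫ y, k' (x, y) * f n y ∂μ :=
    ae_all_iff.2 fun n => (hA (f n)).symm.trans (hA' (f n))
  filter_upwards [hpair, ae_memLp_prodMk_left hk, ae_memLp_prodMk_left hk'] with x hx hkx hkx'
  have inner_star {g : X → ℂ} (hg : MemLp g 2 μ) (v : Lp ℂ 2 μ) :
      ⟪hg.star.toLp _, v⟫_ℂ = ∫ y, g y * v y ∂μ := by
    simp [inner_eq_integral hg.star.coeFn_toLp]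
  have heq : hkx.star.toLp _ = hkx'.star.toLp _ :=
    hf.eq_of_inner_left ℂ fun n =>
      (inner_star hkx _).trans ((hx n).trans (inner_star hkx' _).symm)
  filter_upwards [(MemLp.toLp_eq_toLp_iff hkx.star hkx'.star).1 heq] with y hy
  exact star_injective hy

variable {ι : Type*} [Fintype ι]

lemma memLp_sum_mul_prod [SFinite μ] {e g : ι → X → ℂ} (he : ∀ i, MemLp (e i) 2 μ)
    (hg : ∀ i, MemLp (g i) 2 μ) (T : Matrix ι ι ℂ) :
    MemLp (fun z : X × X => ∑ i, ∑ j, T i j * (e i z.1 * conj (g j z.2))) 2 (μ.prod μ) := by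
  refine memLp_finsetSum _ fun i _ => memLp_finsetSum _ fun j _ => MemLp.const_mul ?_ _
  have hmeas : AEStronglyMeasurable (fun z : X × X => e i z.1 * conj (g j z.2)) (μ.prod μ) :=
    (he i).1.comp_fst.mul (hg j).star.1.comp_snd
  rw [memLp_two_iff_integrable_sq_norm hmeas]
  have hei := (memLp_two_iff_integrable_sq_norm (he i).1).1 (he i)
  have hgj := (memLp_two_iff_integrable_sq_norm (hg j).1).1 (hg j)
  simpa [mul_pow] using hei.mul_prod hgj

lemma coeFn_sum_smul {e : ι → Lp ℂ 2 μ} {e' : ι → X → ℂ} (he : ∀ i, e i =ᵐ[μ] e' i) (c : ι → ℂ) :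
    (∑ i, c i • e i : Lp ℂ 2 μ) =ᵐ[μ] fun x => ∑ i, c i * e' i x := by
  have hterm : ∀ᵐ x ∂μ, ∀ i, (c i • e i : Lp ℂ 2 μ) x = c i * e' i x := by
    refine ae_all_iff.2 fun i => ?_
    filter_upwards [Lp.coeFn_smul (c i) (e i), he i] with x hsmul hx
    rw [hsmul, Pi.smul_apply, hx, smul_eq_mul]
  refine (Lp.coeFn_finsetSum _ _).trans ?_
  filter_upwards [hterm] with x hx
  simp [hx]

lemma hasKernel_matOp {e g : ι → Lp ℂ 2 μ} {e' g' : ι → X → ℂ}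
    (he : ∀ i, e i =ᵐ[μ] e' i) (hg : ∀ i, g i =ᵐ[μ] g' i) (T : Matrix ι ι ℂ) :
    HasKernel μ (matOp e g T) fun z => ∑ i, ∑ j, T i j * (e' i z.1 * conj (g' j z.2)) := by
  intro f
  rw [matOp_apply]
  refine (coeFn_sum_smul he _).trans (Eventually.of_forall fun x => ?_)
  have expand (y : X) : (∑ i, ∑ j, T i j * (e' i x * conj (g' j y))) * f y =
      ∑ i, ∑ j, T i j * e' i x * (conj (g' j y) * f y) := by
    simp only [Finset.sum_mul]
    exact Finset.sum_congr rfl fun i _ => Finset.sum_congr rfl fun j _ => by ring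
  have hint (j : ι) := integrable_conj_mul (hg j) f
  simp only [expand]
  rw [integral_finsetSum _ fun i _ => integrable_finsetSum _ fun j _ => (hint j).const_mul _]
  refine Finset.sum_congr rfl fun i _ => ?_
  rw [integral_finsetSum _ fun j _ => (hint j).const_mul _, Finset.sum_mul]
  refine Finset.sum_congr rfl fun j _ => ?_
  rw [integral_const_mul, inner_eq_integral (hg j)]
  ring

end Kernel

section UnitIndicator

lemma sum_mul_indicator_eq {X ι : Type*} [Fintype ι] {E E' : ι → Set X}
    (hd : Pairwise fun i j => Disjoint (E i) (E j))
    (hd' : Pairwise fun i j => Disjoint (E' i) (E' j)) (T : Matrix ι ι ℂ) (c d : ι → ℂ) {i j : ι}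
    {x y : X} (hx : x ∈ E i) (hy : y ∈ E' j) :
    ∑ a, ∑ b, T a b * ((E a).indicator (fun _ => c a) x *
      conj ((E' b).indicator (fun _ => d b) y)) = T i j * (c i * conj (d j)) := by
  rw [Fintype.sum_eq_single i, Fintype.sum_eq_single j]
  · rw [Set.indicator_of_mem hx, Set.indicator_of_mem hy]
  · intro b hb
    rw [Set.indicator_of_notMem (s := E' b) ((hd' hb).notMem_of_mem_right hy)]
    simp
  · intro a ha
    rw [Set.indicator_of_notMem (s := E a) ((hd ha).notMem_of_mem_right hx)]
    simp

variable {X : Type*} [MeasurableSpace X] {μ : Measure X}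

/-- The indicator function of a set of finite measure, normalised in `L²`. -/
def unitIndicator (μ : Measure X) {E : Set X} (hE : MeasurableSet E) (h : μ E ≠ ∞) : Lp ℂ 2 μ :=
  indicatorConstLp 2 hE h (((Real.sqrt (μ.real E))⁻¹ : ℝ) : ℂ)

lemma coeFn_unitIndicator {E : Set X} (hE : MeasurableSet E) (h : μ E ≠ ∞) :
    unitIndicator μ hE h =ᵐ[μ] E.indicator fun _ => (((Real.sqrt (μ.real E))⁻¹ : ℝ) : ℂ) :=
  indicatorConstLp_coeFn

lemma orthonormal_unitIndicator {ι : Type*} {E : ι → Set X} (hE : ∀ i, MeasurableSet (E i))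
    (h : ∀ i, μ (E i) ≠ ∞) (h0 : ∀ i, μ (E i) ≠ 0) (hd : Pairwise fun i j => Disjoint (E i) (E j)) :
    Orthonormal ℂ fun i => unitIndicator μ (hE i) (h i) := by
  classical
  rw [orthonormal_iff_ite]
  intro i j
  have hpos : 0 < μ.real (E i) := ENNReal.toReal_pos (h0 i) (h i)
  rw [unitIndicator, unitIndicator, L2.inner_indicatorConstLp_indicatorConstLp _ _ (h i) (h j)]
  split_ifs with hij
  · subst hij
    rw [Set.inter_self, RCLike.inner_apply, Complex.conj_ofReal, ← Complex.ofReal_mul, ← mul_inv,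
      Real.mul_self_sqrt hpos.le]
    simp [hpos.ne']
  · rw [(hd hij).inter_eq]
    simp

lemma HasKernel.inner_unitIndicator {B : Lp ℂ 2 μ →L[ℂ] Lp ℂ 2 μ} {k : X × X → ℂ}
    (hB : HasKernel μ B k) {E E' : Set X} (hE : MeasurableSet E) (hE' : MeasurableSet E')
    (h : μ E ≠ ∞) (h' : μ E' ≠ ∞) :
    ⟪unitIndicator μ hE h, B (unitIndicator μ hE' h')⟫_ℂ =
      (((Real.sqrt (μ.real E))⁻¹ * (Real.sqrt (μ.real E'))⁻¹ : ℝ) : ℂ) *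
        ∫ x in E, ∫ y in E', k (x, y) ∂μ ∂μ := by
  rw [inner_eq_integral (coeFn_unitIndicator hE h), ← integral_const_mul, ← integral_indicator hE]
  refine integral_congr_ae ?_
  filter_upwards [hB (unitIndicator μ hE' h')] with x hx
  rw [hx]
  by_cases hxE : x ∈ E
  · have hy : ∫ y, k (x, y) * unitIndicator μ hE' h' y ∂μ =
        ∫ y in E', k (x, y) * (((Real.sqrt (μ.real E'))⁻¹ : ℝ) : ℂ) ∂μ := by
      rw [← integral_indicator hE']
      refine integral_congr_ae ?_
      filter_upwards [coeFn_unitIndicator hE' h'] with y hy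
      by_cases hyE : y ∈ E' <;> simp [hy, hyE]
    rw [hy, integral_mul_const, Set.indicator_of_mem hxE, Set.indicator_of_mem hxE,
      Complex.conj_ofReal]
    push_cast
    ring
  · simp [hxE]

variable [SFinite μ] [MeasurableSpace.CountablyGenerated X] {ι : Type*} [Fintype ι]
  {p : ℝ≥0∞} {φ : X → X → ℂ} {C : ℝ≥0}

/- The multiplier is tested on operators between the spans of the indicators, whose kernels are
constant on the sets `E i ×ˢ E' j`; compressing the result averages the symbol over these sets. -/
lemma MSNormLE.matSchurLE (hφ : MSNormLE p μ φ C) {E E' : ι → Set X}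
    (hE : ∀ i, MeasurableSet (E i)) (hE' : ∀ i, MeasurableSet (E' i))
    (hd : Pairwise fun i j => Disjoint (E i) (E j))
    (hd' : Pairwise fun i j => Disjoint (E' i) (E' j)) {m : ℝ≥0∞} (hm : m ≠ ∞)
    (h : ∀ i, μ (E i) = m) (h' : ∀ i, μ (E' i) = m) :
    MatSchurLE p (fun i => unitIndicator μ (hE i) ((h i).trans_ne hm))
      (fun i => unitIndicator μ (hE' i) ((h' i).trans_ne hm))
      (Matrix.of fun i j => ((m.toReal ^ 2)⁻¹ : ℂ) * ∫ x in E i, ∫ y in E' j, φ x y ∂μ ∂μ) C := by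
  intro T hT
  set e : ι → Lp ℂ 2 μ := fun i => unitIndicator μ (hE i) ((h i).trans_ne hm)
  set g : ι → Lp ℂ 2 μ := fun i => unitIndicator μ (hE' i) ((h' i).trans_ne hm)
  have he' (i) := coeFn_unitIndicator (hE i) ((h i).trans_ne hm)
  have hg' (i) := coeFn_unitIndicator (hE' i) ((h' i).trans_ne hm)
  have hk := hasKernel_matOp he' hg' T
  have hk2 := memLp_sum_mul_prod (μ := μ) (fun i => (memLp_congr_ae (he' i)).1 (Lp.memLp (e i)))
    (fun i => (memLp_congr_ae (hg' i)).1 (Lp.memLp (g i))) T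
  have hmem : MemSchatten p (matOp e g T) := by
    unfold MemSchatten
    split_ifs
    exacts [isCompactOperator_matOp e g T, hT]
  obtain ⟨B, ⟨k', hk'2, hk', hB⟩, -, hBC⟩ := hφ _ _ hk2 hk hmem
  refine ⟨B, fun i j => ?_, hBC⟩
  set c : ℝ := (Real.sqrt m.toReal)⁻¹ with hc
  have hc4 : c ^ 4 = (m.toReal ^ 2)⁻¹ := by
    rw [hc, inv_pow, show 4 = 2 * 2 by rfl, pow_mul, Real.sq_sqrt ENNReal.toReal_nonneg]
  have hcE (i) : (Real.sqrt (μ.real (E i)))⁻¹ = c := by rw [hc, Measure.real, h i]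
  have hcE' (i) : (Real.sqrt (μ.real (E' i)))⁻¹ = c := by rw [hc, Measure.real, h' i]
  have hkernel : ∫ x in E i, ∫ y in E' j, φ x y * k' (x, y) ∂μ ∂μ =
      (∫ x in E i, ∫ y in E' j, φ x y ∂μ ∂μ) * (T i j * (c * c)) := by
    rw [← integral_mul_const]
    refine setIntegral_congr_ae (hE i) ?_
    filter_upwards [HasKernel.ae_unique hk2 hk'2 hk hk'] with x hx hxE
    rw [← integral_mul_const]
    refine setIntegral_congr_ae (hE' j) ?_
    filter_upwards [hx] with y hy hyE
    rw [← hy, sum_mul_indicator_eq hd hd' T _ _ hxE hyE, hcE, hcE', Complex.conj_ofReal]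
  rw [hB.inner_unitIndicator, hcE, hcE', hkernel, Matrix.of_apply]
  have hc4' : (c : ℂ) ^ 4 = ((m.toReal : ℂ) ^ 2)⁻¹ := by exact_mod_cast congrArg Complex.ofReal hc4
  rw [← hc4']
  push_cast
  ring

end UnitIndicator

section CompletelyBounded

/-- The unitary identification of `H` with the Hilbert direct sum of one copy of `H`. -/
def piLpOneEquiv (H : Type*) [NormedAddCommGroup H] [InnerProductSpace ℂ H] :
    PiLp 2 (fun _ : Fin 1 => H) ≃ₗᵢ[ℂ] H where
  toLinearEquiv := (PiLp.equivOfUnique 2 ℂ (fun _ : Fin 1 => H)).toLinearEquiv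
  norm_map' x := by
    rw [PiLp.norm_eq_of_L2]
    simp

lemma entry_eq_conj_piLpOneEquiv {H : Type*} [NormedAddCommGroup H] [InnerProductSpace ℂ H]
    [CompleteSpace H] (A : PiLp 2 (fun _ : Fin 1 => H) →L[ℂ] PiLp 2 (fun _ : Fin 1 => H))
    (i j : Fin 1) : entry A i j = (piLpOneEquiv H).conjStarAlgEquiv A := by
  obtain rfl := Subsingleton.elim i 0
  obtain rfl := Subsingleton.elim j 0
  ext1 v
  have hsingle : (Pi.single 0 v : Fin 1 → H) = (piLpOneEquiv H).symm v := by
    funext a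
    obtain rfl := Subsingleton.elim a 0
    rw [Pi.single_eq_same]
    rfl
  change A (WithLp.toLp 2 (Pi.single 0 v)) 0 = A ((piLpOneEquiv H).symm v) 0
  rw [hsingle]

lemma CBMSNormLE.msNormLE {X : Type*} [MeasurableSpace X] {μ : Measure X} {p : ℝ≥0∞} (hp : p ≠ 0)
    {φ : X → X → ℂ} {C : ℝ≥0} (hφ : CBMSNormLE p μ φ C) : MSNormLE p μ φ C := by
  intro A k hk hA hAp
  let U := piLpOneEquiv (Lp ℂ 2 μ)
  have hUA (i j) : entry (U.symm.conjStarAlgEquiv A) i j = A := by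
    rw [entry_eq_conj_piLpOneEquiv, ← LinearIsometryEquiv.symm_conjStarAlgEquiv]
    exact U.conjStarAlgEquiv.apply_symm_apply A
  obtain ⟨B, hB, hBp, hBC⟩ := hφ 1 (U.symm.conjStarAlgEquiv A)
    (fun i j => ⟨k, hk, by rwa [hUA]⟩) (hAp.conj hp _)
  refine ⟨U.conjStarAlgEquiv B, ?_, hBp.conj hp _, ?_⟩
  · simpa only [hUA, entry_eq_conj_piLpOneEquiv] using hB 0 0
  · simpa only [schattenNorm_conj _ _ hp] using hBC

end CompletelyBounded

section Average

open Matrix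

variable {G : Type*} [Group G]

/-- A function on `G` which is constant on the double cosets `K g K`. -/
structure IsBiinvariant (K : Subgroup G) (Φ : G → ℂ) : Prop where
  mul_left : ∀ (g : G) {k : G}, k ∈ K → Φ (k * g) = Φ g
  mul_right : ∀ (g : G) {k : G}, k ∈ K → Φ (g * k) = Φ g

lemma IsBiinvariant.conj {K : Subgroup G} {Φ : G → ℂ} (hΦ : IsBiinvariant K Φ) (g : G) {k : G}
    (hk : k ∈ K) : Φ (k * g * k⁻¹) = Φ g := by
  rw [hΦ.mul_right _ (K.inv_mem hk), hΦ.mul_left _ hk]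

lemma disjoint_preimage_coset {K : Subgroup G} {a b : G} (h : a * b⁻¹ ∉ K) :
    Disjoint ((fun u => a * u) ⁻¹' (K : Set G)) ((fun u => b * u) ⁻¹' (K : Set G)) := by
  rw [Set.disjoint_left]
  intro u ha hb
  refine h ?_
  simpa [mul_assoc] using K.mul_mem ha (K.inv_mem hb)

variable [MeasurableSpace G]

/-- The average of a function over the double coset of `g`, taken as the average of
`f (u⁻¹ * g * w)` over `u` and `w` in `K`. -/
def doubleCosetAvg (μ : Measure G) (K : Subgroup G) (f : G → ℂ) (g : G) : ℂ :=
  ((μ K).toReal ^ 2)⁻¹ * ∫ u in (K : Set G), ∫ w in (K : Set G), f (u⁻¹ * g * w) ∂μ ∂μ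

variable [MeasurableMul G] {μ : Measure G} [μ.IsMulLeftInvariant] {K : Subgroup G}

lemma setIntegral_preimage_mul_left (F : G → ℂ) (a : G) (s : Set G) :
    ∫ u in (fun u => a * u) ⁻¹' s, F (a * u) ∂μ = ∫ x in s, F x ∂μ :=
  (measurePreserving_mul_left μ a).setIntegral_preimage_emb (measurableEmbedding_mulLeft a) F s

lemma setIntegral_preimage_coset (F : G → ℂ) (a : G) (s : Set G) :
    ∫ u in (fun u => a * u) ⁻¹' s, F u ∂μ = ∫ x in s, F (a⁻¹ * x) ∂μ := by
  rw [← setIntegral_preimage_mul_left (fun x => F (a⁻¹ * x)) a s]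
  simp

lemma setIntegral_mul_left_of_mem (F : G → ℂ) {k : G} (hk : k ∈ K) :
    ∫ u in (K : Set G), F (k * u) ∂μ = ∫ u in (K : Set G), F u ∂μ := by
  rw [← setIntegral_preimage_mul_left F k]
  congr 2
  ext u
  simp [K.mul_mem_cancel_left hk]

lemma isBiinvariant_doubleCosetAvg (f : G → ℂ) : IsBiinvariant K (doubleCosetAvg μ K f) where
  mul_left g k hk := by
    unfold doubleCosetAvg
    congr 1
    rw [← setIntegral_mul_left_of_mem (fun u => ∫ w in (K : Set G), f (u⁻¹ * (k * g) * w) ∂μ) hk]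
    simp [mul_assoc]
  mul_right g k hk := by
    unfold doubleCosetAvg
    congr 2
    funext u
    rw [← setIntegral_mul_left_of_mem (fun w => f (u⁻¹ * g * w)) hk]
    simp [mul_assoc]

variable [SFinite μ] [MeasurableSpace.CountablyGenerated G]

lemma norm_sub_le_of_doubleCosetAvg
    (hK : MeasurableSet (K : Set G)) (hK0 : μ K ≠ 0) (hKt : μ K ≠ ∞)
    {R : Type*} [CommRing R] [Finite R] {𝔞 : Ideal R} {n : ℕ}
    (hdvd : ∀ t ∈ 𝔞, ∀ d : R, d ≠ 0 → d ∣ t) (hcard : 2 ≤ Nat.card 𝔞)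
    {ψ : R → ℂ} {ψ₁ : ℂ} (hconst : ∀ t ∈ 𝔞, t ≠ 0 → ψ t = ψ₁)
    (hinv : ∀ s ∉ 𝔞, ∀ t ∈ 𝔞, ψ (s + t) = ψ s)
    {x y : (Fin n → R) × R → G} (hx : ∀ i j, x i * (x j)⁻¹ ∈ K → i = j)
    (hy : ∀ i j, (y i)⁻¹ * y j ∈ K → i = j) {f : G → ℂ}
    (hf : ∀ i j, doubleCosetAvg μ K f (x i * y j) = heisMatrix n ψ i j)
    {p : ℝ≥0∞} (hp : p ≠ 0) {C : ℝ≥0} (hC : MSNormLE p μ (herzSchur f) C) :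
    ‖ψ 0 - ψ₁‖ ≤ 2 ^ (1 + 1 / p.toReal) * C * (Nat.card R : ℝ) ^ (-heisExponent n p) := by
  have := Fintype.ofFinite R
  have hE (i) : μ ((fun u => x i * u) ⁻¹' (K : Set G)) = μ K := measure_preimage_mul _ _ _
  have hE' (j) : μ ((fun u => (y j)⁻¹ * u) ⁻¹' (K : Set G)) = μ K := measure_preimage_mul _ _ _
  have hmeas (a : G) : MeasurableSet ((fun u => a * u) ⁻¹' (K : Set G)) :=
    measurable_const_mul a hK
  have hd : Pairwise fun i j =>
      Disjoint ((fun u => x i * u) ⁻¹' (K : Set G)) ((fun u => x j * u) ⁻¹' (K : Set G)) :=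
    fun i j hij => disjoint_preimage_coset fun h => hij (hx i j h)
  have hd' : Pairwise fun i j => Disjoint ((fun u => (y i)⁻¹ * u) ⁻¹' (K : Set G))
      ((fun u => (y j)⁻¹ * u) ⁻¹' (K : Set G)) :=
    fun i j hij => disjoint_preimage_coset fun h => hij (hy i j (by simpa using h))
  have hmatrix : (Matrix.of fun i j => (((μ K).toReal ^ 2)⁻¹ : ℂ) *
      ∫ g in (fun u => x i * u) ⁻¹' (K : Set G),
        ∫ h in (fun u => (y j)⁻¹ * u) ⁻¹' (K : Set G), herzSchur f g h ∂μ ∂μ) =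
      heisMatrix n ψ := by
    ext i j
    rw [of_apply, ← hf, doubleCosetAvg]
    simp [setIntegral_preimage_coset, herzSchur, mul_assoc]
  have hschur := hC.matSchurLE (fun i => hmeas (x i)) (fun j => hmeas (y j)⁻¹) hd hd' hKt hE hE'
  rw [hmatrix] at hschur
  exact norm_sub_le_of_matSchurLE hdvd hcard hconst hinv
    (orthonormal_unitIndicator _ _ (fun i => (hE i).trans_ne hK0) hd)
    (orthonormal_unitIndicator _ _ (fun i => (hE' i).trans_ne hK0) hd') hp hschur

end Average

section Heisenberg

open Matrix

/-- Two families of elements of a group `G`, parametrised by `Oⁿ × O`, whose products are those of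
the elements `(x, 0, z)` and `(0, y, w)` of the Heisenberg group of `O`. -/
structure HeisenbergPair (n : ℕ) (O G : Type*) [CommRing O] [Group G] where
  /-- The image of `(x, 0, z)`. -/
  left : (Fin n → O) → O → G
  /-- The image of `(0, y, w)`. -/
  right : (Fin n → O) → O → G
  left_mul_inv : ∀ x z x' z', left x z * (left x' z')⁻¹ = left (x - x') (z - z')
  inv_mul_right : ∀ y w y' w', (right y w)⁻¹ * right y' w' = right (y' - y) (w' - w)
  left_mul_right : ∀ x z y w,
    left x z * right y w = right y 0 * left 0 (z + w + x ⬝ᵥ y) * left x 0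

namespace HeisenbergPair

variable {n : ℕ} {O G : Type*} [CommRing O] [Group G]

lemma left_zero_zero (P : HeisenbergPair n O G) : P.left 0 0 = 1 := by
  simpa using (P.left_mul_inv 0 0 0 0).symm

/-- The conditions under which the double coset of `D * left x z * right y w * D'` depends only on
`z + w + x ⬝ᵥ y` modulo `I`, while different `(x, z)` modulo `I` give different cosets
`K * (D * left x z)`, and different `(y, w)` different cosets `right y w * D' * K`. -/
structure IsDoubleCosetFamily (P : HeisenbergPair n O G) (K : Subgroup G) (I : Ideal O)
    (D D' : G) : Prop where
  conj_right_mem : ∀ y, D * P.right y 0 * D⁻¹ ∈ K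
  conj_left_mem : ∀ x, D'⁻¹ * P.left x 0 * D' ∈ K
  conj_center_mem : ∀ c ∈ I, D * P.left 0 c * D⁻¹ ∈ K
  of_conj_left_mem : ∀ x z, D * P.left x z * D⁻¹ ∈ K → (∀ i, x i ∈ I) ∧ z ∈ I
  of_conj_right_mem : ∀ y w, D'⁻¹ * P.right y w * D' ∈ K → (∀ i, y i ∈ I) ∧ w ∈ I

/-- The representative `D * left x z` of a right coset `K g`, for `(x, z)` modulo `I`. -/
def rowPoint (P : HeisenbergPair n O G) (I : Ideal O) (D : G) (i : (Fin n → O ⧸ I) × (O ⧸ I)) : G :=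
  D * P.left (fun k => (i.1 k).out) i.2.out

/-- The representative `right y w * D'` of a left coset `g K`, for `(y, w)` modulo `I`. -/
def colPoint (P : HeisenbergPair n O G) (I : Ideal O) (D' : G) (j : (Fin n → O ⧸ I) × (O ⧸ I)) :
    G :=
  P.right (fun k => (j.1 k).out) j.2.out * D'

/-- The function `s ↦ Φ (D * left 0 s * D')` on `O`, seen on `O ⧸ I`. -/
def symbol (P : HeisenbergPair n O G) (I : Ideal O) (D D' : G) (Φ : G → ℂ) (s : O ⧸ I) : ℂ :=
  Φ (D * P.left 0 s.out * D')

lemma prod_ext_of_out_sub_mem {I : Ideal O} {i j : (Fin n → O ⧸ I) × (O ⧸ I)}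
    (hfst : ∀ k, (i.1 k).out - (j.1 k).out ∈ I) (hsnd : i.2.out - j.2.out ∈ I) : i = j := by
  refine Prod.ext (funext fun k => ?_) ?_
  · rw [← Ideal.Quotient.mk_out (i.1 k), ← Ideal.Quotient.mk_out (j.1 k)]
    exact Ideal.Quotient.eq.2 (hfst k)
  · rw [← Ideal.Quotient.mk_out i.2, ← Ideal.Quotient.mk_out j.2]
    exact Ideal.Quotient.eq.2 hsnd

namespace IsDoubleCosetFamily

variable {P : HeisenbergPair n O G} {K : Subgroup G} {I : Ideal O} {D D' : G}

lemma eq_of_rowPoint_mul_inv_mem (hP : P.IsDoubleCosetFamily K I D D')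
    (i j : (Fin n → O ⧸ I) × (O ⧸ I)) (h : P.rowPoint I D i * (P.rowPoint I D j)⁻¹ ∈ K) :
    i = j := by
  have hmem := hP.of_conj_left_mem ((fun k => (i.1 k).out) - fun k => (j.1 k).out)
    (i.2.out - j.2.out) (by rw [← P.left_mul_inv]; simpa [rowPoint, mul_assoc] using h)
  exact prod_ext_of_out_sub_mem hmem.1 hmem.2

lemma eq_of_inv_colPoint_mul_mem (hP : P.IsDoubleCosetFamily K I D D')
    (i j : (Fin n → O ⧸ I) × (O ⧸ I)) (h : (P.colPoint I D' i)⁻¹ * P.colPoint I D' j ∈ K) :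
    i = j := by
  have hmem := hP.of_conj_right_mem ((fun k => (j.1 k).out) - fun k => (i.1 k).out)
    (j.2.out - i.2.out) (by rw [← P.inv_mul_right]; simpa [colPoint, mul_assoc] using h)
  exact (prod_ext_of_out_sub_mem hmem.1 hmem.2).symm

variable {Φ : G → ℂ}

lemma symbol_mk (hP : P.IsDoubleCosetFamily K I D D') (hΦ : IsBiinvariant K Φ) (s : O) :
    P.symbol I D D' Φ (Ideal.Quotient.mk I s) = Φ (D * P.left 0 s * D') := by
  set s' : O := (Ideal.Quotient.mk I s).out
  have hmem : s' - s ∈ I := Ideal.Quotient.eq.1 (Ideal.Quotient.mk_out _)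
  rw [symbol, ← hΦ.mul_left (D * P.left 0 s * D') (hP.conj_center_mem _ hmem)]
  have hsplit := P.left_mul_inv 0 s' 0 s
  rw [sub_zero] at hsplit
  rw [← hsplit]
  simp [mul_assoc, s']

lemma apply_rowPoint_mul_colPoint (hP : P.IsDoubleCosetFamily K I D D') (hΦ : IsBiinvariant K Φ)
    (i j : (Fin n → O ⧸ I) × (O ⧸ I)) :
    Φ (P.rowPoint I D i * P.colPoint I D' j) = heisMatrix n (P.symbol I D D' Φ) i j := by
  set x : Fin n → O := fun k => (i.1 k).out
  set y : Fin n → O := fun k => (j.1 k).out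
  have hfactor : P.rowPoint I D i * P.colPoint I D' j =
      (D * P.right y 0 * D⁻¹) * (D * P.left 0 (i.2.out + j.2.out + x ⬝ᵥ y) * D') *
        (D'⁻¹ * P.left x 0 * D') := by
    rw [show P.rowPoint I D i * P.colPoint I D' j =
      D * (P.left x i.2.out * P.right y j.2.out) * D' by simp [rowPoint, colPoint, mul_assoc, x, y],
      P.left_mul_right]
    group
  rw [hfactor, hΦ.mul_right _ (hP.conj_left_mem x), hΦ.mul_left _ (hP.conj_right_mem y),
    ← hP.symbol_mk hΦ]
  simp only [heisMatrix, of_apply]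
  congr 1
  simp [map_add, dotProduct, x, y]

end IsDoubleCosetFamily

end HeisenbergPair

end Heisenberg

section DVR

variable {O : Type*} [CommRing O]

/-- The ideal of `O ⧸ (ϖ ^ (k + 1))` generated by `ϖ ^ k`: its smallest nonzero ideal, when `O` is
a discrete valuation ring with uniformizer `ϖ`. -/
def socleIdeal (ϖ : O) (k : ℕ) : Ideal (O ⧸ Ideal.span {ϖ ^ (k + 1)}) :=
  Ideal.span {Ideal.Quotient.mk _ (ϖ ^ k)}

variable [IsDomain O] {ϖ : O} (hϖ : Irreducible ϖ) {k : ℕ}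

include hϖ

lemma two_le_card_socleIdeal [Finite (O ⧸ Ideal.span {ϖ ^ (k + 1)})] :
    2 ≤ Nat.card (socleIdeal ϖ k) := by
  refine Finite.one_lt_card_iff_nontrivial.2 ⟨⟨0, ⟨_, Ideal.mem_span_singleton_self _⟩, ?_⟩⟩
  intro h
  have hdvd := Ideal.mem_span_singleton.1
    (Ideal.Quotient.eq_zero_iff_mem.1 (congrArg Subtype.val h).symm)
  rw [pow_dvd_pow_iff hϖ.ne_zero hϖ.not_isUnit] at hdvd
  omega

variable [IsDiscreteValuationRing O]

lemma dvd_of_mem_socleIdeal {t d : O ⧸ Ideal.span {ϖ ^ (k + 1)}} (ht : t ∈ socleIdeal ϖ k)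
    (hd : d ≠ 0) : d ∣ t := by
  obtain ⟨d, rfl⟩ := Ideal.Quotient.mk_surjective d
  refine dvd_trans ?_ (Ideal.mem_span_singleton.1 ht)
  have hd0 : d ≠ 0 := by rintro rfl; simp at hd
  obtain ⟨j, u, rfl⟩ := IsDiscreteValuationRing.eq_unit_mul_pow_irreducible hd0 hϖ
  have hj : j ≤ k := by
    by_contra! hj
    refine hd (Ideal.Quotient.eq_zero_iff_mem.2 (Ideal.mem_span_singleton.2 ?_))
    exact (pow_dvd_pow _ hj).mul_left _
  refine map_dvd _ ?_
  rw [Units.mul_left_dvd]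
  exact pow_dvd_pow _ hj

lemma eq_of_unit_invariant {ψ : O ⧸ Ideal.span {ϖ ^ (k + 1)} → ℂ}
    (hψ : ∀ (u : Oˣ) s, ψ (Ideal.Quotient.mk _ (u * s)) = ψ (Ideal.Quotient.mk _ s))
    {t : O ⧸ Ideal.span {ϖ ^ (k + 1)}} (ht : t ∈ socleIdeal ϖ k) (ht0 : t ≠ 0) :
    ψ t = ψ (Ideal.Quotient.mk _ (ϖ ^ k)) := by
  obtain ⟨c, rfl⟩ := Ideal.mem_span_singleton.1 ht
  obtain ⟨c, rfl⟩ := Ideal.Quotient.mk_surjective c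
  rw [← map_mul, mul_comm] at ht0 ⊢
  by_cases hc : IsUnit c
  · obtain ⟨u, rfl⟩ := hc
    exact hψ _ _
  · refine absurd (Ideal.Quotient.eq_zero_iff_mem.2 (Ideal.mem_span_singleton.2 ?_)) ht0
    rw [pow_succ']
    refine mul_dvd_mul_right ?_ _
    rw [← Ideal.mem_span_singleton, ← hϖ.maximalIdeal_eq]
    exact hc

lemma isUnit_unit_add_pow_mul (u : Oˣ) (i : ℕ) (c : O) : IsUnit ((u : O) + ϖ ^ (i + 1) * c) := by
  by_contra h
  rw [← mem_nonunits_iff, ← IsLocalRing.mem_maximalIdeal, hϖ.maximalIdeal_eq,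
    Ideal.mem_span_singleton] at h
  have hdvd : ϖ ∣ (u : O) :=
    (dvd_add_left ((dvd_pow_self ϖ (Nat.succ_ne_zero i)).mul_right c)).1 h
  exact hϖ.not_isUnit (isUnit_of_dvd_unit hdvd u.isUnit)

lemma add_eq_of_unit_invariant {ψ : O ⧸ Ideal.span {ϖ ^ (k + 1)} → ℂ}
    (hψ : ∀ (u : Oˣ) s, ψ (Ideal.Quotient.mk _ (u * s)) = ψ (Ideal.Quotient.mk _ s))
    {s t : O ⧸ Ideal.span {ϖ ^ (k + 1)}} (hs : s ∉ socleIdeal ϖ k) (ht : t ∈ socleIdeal ϖ k) :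
    ψ (s + t) = ψ s := by
  obtain ⟨c, rfl⟩ := Ideal.mem_span_singleton.1 ht
  obtain ⟨c, rfl⟩ := Ideal.Quotient.mk_surjective c
  obtain ⟨s, rfl⟩ := Ideal.Quotient.mk_surjective s
  have hs0 : s ≠ 0 := by rintro rfl; simp at hs
  obtain ⟨j, u, rfl⟩ := IsDiscreteValuationRing.eq_unit_mul_pow_irreducible hs0 hϖ
  have hj : j < k := by
    by_contra! hj
    exact hs (Ideal.mem_span_singleton.2 (map_dvd _ ((pow_dvd_pow _ hj).mul_left _)))
  obtain ⟨i, rfl⟩ := Nat.exists_eq_add_of_lt hj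
  obtain ⟨v, hv⟩ := isUnit_unit_add_pow_mul hϖ u i c
  rw [← map_mul, ← map_add, hψ u, ← hψ v (ϖ ^ j), hv]
  congr 2
  ring

lemma card_quotient_pow (k : ℕ) :
    Nat.card (O ⧸ Ideal.span {ϖ ^ k}) = Nat.card (O ⧸ Ideal.span {ϖ}) ^ k := by
  rw [← Ideal.span_singleton_pow]
  have := (Ideal.span_singleton_prime hϖ.ne_zero).2 hϖ.prime
  exact cardQuot_pow_of_prime (P := Ideal.span {ϖ}) (by simpa using hϖ.ne_zero)

end DVR

section HeisenbergAverage

variable {G : Type*} [Group G] [MeasurableSpace G] [MeasurableMul G] {μ : Measure G}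
  [μ.IsMulLeftInvariant] {K : Subgroup G} [SFinite μ] [MeasurableSpace.CountablyGenerated G]
  {O : Type*} [CommRing O] [IsDomain O] [IsDiscreteValuationRing O] {ϖ : O}
  [Finite (O ⧸ Ideal.span {ϖ})] {k n : ℕ} {P : HeisenbergPair n O G} {D D' : G}

lemma HeisenbergPair.IsDoubleCosetFamily.norm_sub_le
    (hP : P.IsDoubleCosetFamily K (Ideal.span {ϖ ^ (k + 1)}) D D') (hϖ : Irreducible ϖ)
    (hK : MeasurableSet (K : Set G)) (hK0 : μ K ≠ 0) (hKt : μ K ≠ ∞)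
    (hunit : ∀ (u : Oˣ) (s : O),
      ∃ T ∈ K, T * (D * P.left 0 s * D') * T⁻¹ = D * P.left 0 (u * s) * D')
    {f : G → ℂ} {p : ℝ≥0∞} (hp : p ≠ 0) {C : ℝ≥0} (hC : MSNormLE p μ (herzSchur f) C) :
    ‖doubleCosetAvg μ K f (D * D') - doubleCosetAvg μ K f (D * P.left 0 (ϖ ^ k) * D')‖ ≤
      2 ^ (1 + 1 / p.toReal) * C *
        ((Nat.card (O ⧸ Ideal.span {ϖ}) : ℝ) ^ (k + 1)) ^ (-heisExponent n p) := by
  have hΦ : IsBiinvariant K (doubleCosetAvg μ K f) := isBiinvariant_doubleCosetAvg f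
  set ψ := P.symbol (Ideal.span {ϖ ^ (k + 1)}) D D' (doubleCosetAvg μ K f)
  have hψ (s : O) : ψ (Ideal.Quotient.mk _ s) = doubleCosetAvg μ K f (D * P.left 0 s * D') :=
    hP.symbol_mk hΦ s
  have hψu (u : Oˣ) (s : O) : ψ (Ideal.Quotient.mk _ (u * s)) = ψ (Ideal.Quotient.mk _ s) := by
    obtain ⟨T, hT, hconj⟩ := hunit u s
    rw [hψ, hψ, ← hconj, hΦ.conj _ hT]
  have hcard := card_quotient_pow hϖ (k + 1)
  have : Finite (O ⧸ Ideal.span {ϖ ^ (k + 1)}) :=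
    Nat.finite_of_card_ne_zero (hcard ▸ pow_ne_zero _ Nat.card_pos.ne')
  have hle := norm_sub_le_of_doubleCosetAvg hK hK0 hKt
    (fun t ht d hd => dvd_of_mem_socleIdeal hϖ ht hd) (two_le_card_socleIdeal hϖ)
    (fun t ht ht0 => eq_of_unit_invariant hϖ hψu ht ht0)
    (fun s hs t ht => add_eq_of_unit_invariant hϖ hψu hs ht)
    hP.eq_of_rowPoint_mul_inv_mem hP.eq_of_inv_colPoint_mul_mem (hP.apply_rowPoint_mul_colPoint hΦ)
    hp hC
  rw [hψ, ← map_zero (Ideal.Quotient.mk _), hψ, P.left_zero_zero, mul_one, hcard] at hle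
  exact_mod_cast hle

end HeisenbergAverage

section SpecialLinear

open Matrix

variable {ι R : Type*} [Fintype ι] [DecidableEq ι] [CommRing R]

lemma SL_ext_smul {A B : SpecialLinearGroup ι R} (h : ∀ w : ι → R, A • w = B • w) : A = B :=
  Subtype.ext (Matrix.ext_of_mulVec_single fun _ => h _)

lemma det_one_add_vecMulVec {u v : ι → R} (h : v ⬝ᵥ u = 0) : (1 + vecMulVec u v).det = 1 := by
  rw [vecMulVec_eq Unit, det_one_add_replicateCol_mul_replicateRow, h, add_zero]

/-- The unipotent element `1 + u ⊗ v` of the special linear group, for `v ⬝ u = 0`. -/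
def rankOneSL (u v : ι → R) (h : v ⬝ᵥ u = 0) : SpecialLinearGroup ι R :=
  ⟨1 + vecMulVec u v, det_one_add_vecMulVec h⟩

lemma rankOneSL_apply (u v : ι → R) (h : v ⬝ᵥ u = 0) (i j : ι) :
    rankOneSL u v h i j = (1 : Matrix ι ι R) i j + u i * v j := rfl

lemma rankOneSL_smul (u v : ι → R) (h : v ⬝ᵥ u = 0) (w : ι → R) :
    rankOneSL u v h • w = w + (v ⬝ᵥ w) • u := by
  change (1 + vecMulVec u v) *ᵥ w = _
  rw [add_mulVec, one_mulVec, vecMulVec_mulVec, op_smul_eq_smul]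

lemma rankOneSL_mul_right {u v v' : ι → R} (h : v ⬝ᵥ u = 0) (h' : v' ⬝ᵥ u = 0) :
    rankOneSL u v h * rankOneSL u v' h' = rankOneSL u (v + v') (by simp [h, h']) := by
  refine SL_ext_smul fun w => ?_
  simp only [mul_smul, rankOneSL_smul, dotProduct_add, dotProduct_smul, h, add_dotProduct,
    add_smul, smul_zero, add_zero]
  abel

lemma rankOneSL_mul_left {u u' v : ι → R} (h : v ⬝ᵥ u = 0) (h' : v ⬝ᵥ u' = 0) :
    rankOneSL u v h * rankOneSL u' v h' = rankOneSL (u + u') v (by simp [h, h']) := by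
  refine SL_ext_smul fun w => ?_
  simp only [mul_smul, rankOneSL_smul, dotProduct_smul, h', smul_add, smul_zero, zero_smul,
    add_zero]
  abel

lemma rankOneSL_inv_right {u v : ι → R} (h : v ⬝ᵥ u = 0) :
    (rankOneSL u v h)⁻¹ = rankOneSL u (-v) (by simp [h]) := by
  rw [inv_eq_iff_mul_eq_one, rankOneSL_mul_right]
  ext i j
  simp [rankOneSL]

lemma rankOneSL_inv_left {u v : ι → R} (h : v ⬝ᵥ u = 0) :
    (rankOneSL u v h)⁻¹ = rankOneSL (-u) v (by simp [h]) := by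
  rw [inv_eq_iff_mul_eq_one, rankOneSL_mul_left]
  ext i j
  simp [rankOneSL]

lemma transvection_smul {i j : ι} (hij : i ≠ j) (c : R) (w : ι → R) :
    SpecialLinearGroup.transvection hij c • w = w + (c * w j) • Pi.single i 1 := by
  rw [Matrix.SpecialLinearGroup.smul_def, smul_eq_mulVec, SpecialLinearGroup.transvection_coe,
    add_mulVec, one_mulVec, single_mulVec_eq]

lemma map_transvection {R' : Type*} [CommRing R'] (f : R →+* R') {i j : ι} (hij : i ≠ j) (c : R) :
    SpecialLinearGroup.map f (SpecialLinearGroup.transvection hij c) =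
      SpecialLinearGroup.transvection hij (f c) := by
  refine Subtype.ext ?_
  change f.mapMatrix (1 + single i j c) = 1 + single i j (f c)
  rw [map_add, map_one, RingHom.mapMatrix_apply, map_single]

/-- The diagonal element of the special linear group with entries `t i`. -/
def diagSL (t : ι → Rˣ) (h : ∏ i, t i = 1) : SpecialLinearGroup ι R :=
  ⟨diagonal fun i => (t i : R), by rw [det_diagonal, ← Units.coe_prod, h, Units.val_one]⟩

lemma diagSL_apply (t : ι → Rˣ) (h : ∏ i, t i = 1) (i j : ι) :
    diagSL t h i j = if i = j then (t i : R) else 0 := rfl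

lemma diagSL_smul (t : ι → Rˣ) (h : ∏ i, t i = 1) (w : ι → R) :
    diagSL t h • w = fun i => t i * w i := by
  ext i
  exact mulVec_diagonal _ _ i

lemma diagSL_mul_diagSL {t t' : ι → Rˣ} (h : ∏ i, t i = 1) (h' : ∏ i, t' i = 1) :
    diagSL t h * diagSL t' h' = diagSL (t * t') (by simp [Finset.prod_mul_distrib, h, h']) := by
  refine SL_ext_smul fun w => ?_
  simp only [mul_smul, diagSL_smul, Pi.mul_apply, Units.val_mul, mul_assoc]

lemma commute_diagSL {t t' : ι → Rˣ} (h : ∏ i, t i = 1) (h' : ∏ i, t' i = 1) :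
    Commute (diagSL t h) (diagSL t' h') := by
  simp only [commute_iff_eq, diagSL_mul_diagSL, mul_comm]

lemma map_diagSL {R' : Type*} [CommRing R'] (f : R →+* R') {t : ι → Rˣ} (h : ∏ i, t i = 1) :
    SpecialLinearGroup.map f (diagSL t h) =
      diagSL (fun i => Units.map (f : R →* R') (t i)) (by rw [← map_prod, h, map_one]) := by
  ext i j
  change f (diagSL t h i j) = _
  rw [diagSL_apply, diagSL_apply, apply_ite f, map_zero]
  rfl

lemma diagSL_inv {t : ι → Rˣ} (h : ∏ i, t i = 1) :
    (diagSL t h)⁻¹ = diagSL t⁻¹ (by simp [h]) := by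
  rw [inv_eq_iff_mul_eq_one, diagSL_mul_diagSL]
  ext i j
  simp [diagSL_apply, one_apply]

lemma diagSL_mul_mul_inv_apply {t : ι → Rˣ} (h : ∏ i, t i = 1) (g : SpecialLinearGroup ι R)
    (i j : ι) : (diagSL t h * g * (diagSL t h)⁻¹) i j = (t i / t j : Rˣ) * g i j := by
  rw [diagSL_inv]
  change (diagonal (fun i => (t i : R)) * (g : Matrix ι ι R) *
    diagonal fun i => ((t⁻¹ i : Rˣ) : R)) i j = _
  rw [mul_diagonal, diagonal_mul, div_eq_mul_inv, Units.val_mul, Pi.inv_apply]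
  ring

lemma diagSL_mul_transvection {t : ι → Rˣ} (h : ∏ i, t i = 1) {i j : ι} (hij : i ≠ j) (c : R) :
    diagSL t h * SpecialLinearGroup.transvection hij c =
      SpecialLinearGroup.transvection hij ((t i / t j : Rˣ) * c) * diagSL t h := by
  rw [← mul_inv_eq_iff_eq_mul]
  ext i' j'
  rw [diagSL_mul_mul_inv_apply, SpecialLinearGroup.transvection_coe,
    SpecialLinearGroup.transvection_coe, Matrix.add_apply, Matrix.add_apply, single_apply,
    single_apply, one_apply]
  split_ifs with hdiag hsingle hsingle
  · exact absurd (hsingle.1.trans (hdiag.trans hsingle.2.symm)) hij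
  · simp [hdiag]
  · simp [hsingle.1, hsingle.2]
  · simp

end SpecialLinear

section Weights

open Matrix

variable {ι R : Type*} [Fintype ι]

variable (ι) in
/-- The vectors of integers with sum zero: the exponents of the diagonal elements of the special
linear group with powers of a given unit as entries. -/
def weightLattice : AddSubgroup (ι → ℤ) where
  carrier := {a | ∑ i, a i = 0}
  add_mem' ha hb := by simp_all [Finset.sum_add_distrib]
  zero_mem' := by simp
  neg_mem' ha := by simp_all

lemma mem_weightLattice {a : ι → ℤ} : a ∈ weightLattice ι ↔ ∑ i, a i = 0 := Iff.rfl

lemma prod_zpow_eq_one {M : Type*} [CommGroup M] (π : M) (a : weightLattice ι) :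
    ∏ i, π ^ a.1 i = 1 := by
  have hsum (s : Finset ι) : ∏ i ∈ s, π ^ a.1 i = π ^ ∑ i ∈ s, a.1 i := by
    classical
    induction s using Finset.induction_on with
    | empty => simp
    | insert i s hi ih => rw [Finset.prod_insert hi, Finset.sum_insert hi, ih, _root_.zpow_add]
  rw [hsum, mem_weightLattice.1 a.2, zpow_zero]

variable [DecidableEq ι]

/-- The root `e_p - e_q`. -/
def rootVector (p q : ι) : weightLattice ι :=
  ⟨Pi.single p 1 - Pi.single q 1, by simp [mem_weightLattice]⟩

lemma rootVector_apply (p q i : ι) :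
    (rootVector p q).1 i = (if i = p then 1 else 0) - if i = q then 1 else 0 := by
  simp [rootVector, Pi.single_apply]

variable [CommRing R]

/-- The diagonal element of the special linear group with entries `π ^ a i`. -/
def zpowSL (π : Rˣ) (a : weightLattice ι) : SpecialLinearGroup ι R :=
  diagSL (fun i => π ^ a.1 i) (prod_zpow_eq_one π a)

lemma zpowSL_add (π : Rˣ) (a b : weightLattice ι) :
    zpowSL π (a + b) = zpowSL π a * zpowSL π b := by
  rw [zpowSL, zpowSL, zpowSL, diagSL_mul_diagSL]
  congr 1
  funext i
  exact _root_.zpow_add π _ _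

lemma zpowSL_neg (π : Rˣ) (a : weightLattice ι) : zpowSL π (-a) = (zpowSL π a)⁻¹ := by
  rw [zpowSL, zpowSL, diagSL_inv]
  congr 1
  funext i
  exact _root_.zpow_neg π _

lemma zpowSL_mul_transvection (π : Rˣ) (a : weightLattice ι) {i j : ι} (hij : i ≠ j) (c : R) :
    zpowSL π a * SpecialLinearGroup.transvection hij c =
      SpecialLinearGroup.transvection hij ((π ^ (a.1 i - a.1 j) : Rˣ) * c) * zpowSL π a := by
  rw [zpowSL, diagSL_mul_transvection, _root_.zpow_sub, div_eq_mul_inv]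

/-- An explicit form of the Cartan decomposition of the transvection of parameter `π⁻¹`. -/
lemma transvection_inv_eq_mul_zpowSL (π : Rˣ) {p q : ι} (hpq : p ≠ q) :
    SpecialLinearGroup.transvection hpq ((π⁻¹ : Rˣ) : R) =
      SpecialLinearGroup.transvection hpq.symm (π : R) *
        (SpecialLinearGroup.transvection hpq 1 * SpecialLinearGroup.transvection hpq.symm (-1) *
          SpecialLinearGroup.transvection hpq 1) *
        SpecialLinearGroup.transvection hpq.symm ((π⁻¹ : Rˣ) : R) *
        zpowSL π (rootVector p q) := by
  refine SL_ext_smul fun w => funext fun i => ?_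
  simp only [mul_smul, transvection_smul, zpowSL, diagSL_smul, rootVector_apply]
  rcases eq_or_ne i p with rfl | hip
  · simp [hpq, hpq.symm]
    ring
  rcases eq_or_ne i q with rfl | hiq
  · simp [hpq, hpq.symm]
    ring_nf
    rw [mul_right_comm, Units.inv_mul, one_mul]
  · simp [hip, hiq]

end Weights

section Integral

open Matrix

variable {ι S O : Type*} [Fintype ι] [DecidableEq ι] [CommRing S] [CommRing O] [Algebra O S]

variable (ι S O) in
/-- The subgroup of the matrices with entries in `O`. -/
def integralSL : Subgroup (SpecialLinearGroup ι S) :=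
  (SpecialLinearGroup.map (n := ι) (algebraMap O S)).range

lemma map_mem_integralSL (g : SpecialLinearGroup ι O) :
    SpecialLinearGroup.map (algebraMap O S) g ∈ integralSL ι S O := ⟨g, rfl⟩

lemma transvection_mem_integralSL {i j : ι} (hij : i ≠ j) (c : O) :
    SpecialLinearGroup.transvection hij (algebraMap O S c) ∈ integralSL ι S O := by
  rw [← map_transvection]
  exact map_mem_integralSL _

lemma mem_integralSL [FaithfulSMul O S] {g : SpecialLinearGroup ι S} :
    g ∈ integralSL ι S O ↔ ∀ i j, g i j ∈ (algebraMap O S).range := by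
  constructor
  · rintro ⟨A, rfl⟩ i j
    exact ⟨A i j, rfl⟩
  · intro h
    choose A hA using h
    have hmap : (algebraMap O S).mapMatrix (of A) = g := by ext i j; exact hA i j
    refine ⟨⟨of A, ?_⟩, Subtype.ext hmap⟩
    apply FaithfulSMul.algebraMap_injective O S
    rw [RingHom.map_det, hmap, g.2, map_one]

variable {π : Sˣ} {ϖ : O} (hπ : (π : S) = algebraMap O S ϖ)

include hπ

lemma zpow_mul_algebraMap_pow (e : ℤ) (m : ℕ) :
    ((π ^ e : Sˣ) : S) * algebraMap O S (ϖ ^ m) = (π ^ (e + m) : Sˣ) := by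
  rw [map_pow, ← hπ, ← Units.val_pow_eq_pow_val, ← zpow_natCast, ← Units.val_mul,
    ← _root_.zpow_add]

variable [FaithfulSMul O S]

lemma zpow_mul_mem_range_iff (e : ℤ) (x : O) :
    ((π ^ e : Sˣ) : S) * algebraMap O S x ∈ (algebraMap O S).range ↔ ϖ ^ (-e).toNat ∣ x := by
  obtain ⟨m, rfl | rfl⟩ := e.eq_nat_or_neg
  · rw [zpow_natCast, Units.val_pow_eq_pow_val, hπ, ← map_pow, ← map_mul]
    exact iff_of_true ⟨_, rfl⟩ (by simp)
  · have hcancel : algebraMap O S (ϖ ^ m) * ((π ^ (-m : ℤ) : Sˣ) : S) = 1 := by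
      rw [mul_comm, zpow_mul_algebraMap_pow hπ, neg_add_cancel, zpow_zero, Units.val_one]
    simp only [neg_neg, Int.toNat_natCast]
    constructor
    · rintro ⟨c, hc⟩
      refine ⟨c, FaithfulSMul.algebraMap_injective O S ?_⟩
      rw [map_mul, hc, ← mul_assoc, hcancel, one_mul]
    · rintro ⟨c, rfl⟩
      refine ⟨c, ?_⟩
      rw [map_mul, ← mul_assoc, mul_comm _ (algebraMap O S (ϖ ^ m)), hcancel, one_mul]

lemma zpowSL_conj_mem_integralSL_iff (a : weightLattice ι) (g : SpecialLinearGroup ι O) :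
    zpowSL π a * SpecialLinearGroup.map (algebraMap O S) g * (zpowSL π a)⁻¹ ∈ integralSL ι S O ↔
      ∀ i j, ϖ ^ (a.1 j - a.1 i).toNat ∣ g i j := by
  rw [mem_integralSL]
  refine forall₂_congr fun i j => ?_
  rw [← neg_sub (a.1 i), ← zpow_mul_mem_range_iff hπ, zpowSL, diagSL_mul_mul_inv_apply,
    _root_.zpow_sub, div_eq_mul_inv]
  rfl

lemma zpowSL_conj_rankOneSL_mem_iff (a : weightLattice ι) {u v : ι → O} (h : v ⬝ᵥ u = 0) :
    zpowSL π a * SpecialLinearGroup.map (algebraMap O S) (rankOneSL u v h) * (zpowSL π a)⁻¹ ∈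
      integralSL ι S O ↔ ∀ i j, ϖ ^ (a.1 j - a.1 i).toNat ∣ u i * v j := by
  rw [zpowSL_conj_mem_integralSL_iff hπ]
  refine forall₂_congr fun i j => ?_
  rw [rankOneSL_apply]
  refine dvd_add_right ?_
  rcases eq_or_ne i j with rfl | hij
  · simp
  · simp [hij]

end Integral

section HeisenbergIndex

open Matrix

/-- Two distinct indices `p`, `q` and a list of `n` further indices `j`: the positions in a matrix
group of a Heisenberg group with center in position `(p, q)` and the other entries in the positions
`(p, j k)` and `(j k, q)`. -/
structure HeisenbergIndex (n : ℕ) (ι : Type*) where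
  /-- The row of the central entry. -/
  p : ι
  /-- The column of the central entry. -/
  q : ι
  /-- The intermediate indices. -/
  j : Fin n → ι
  p_ne_q : p ≠ q
  j_injective : Function.Injective j
  j_ne_p : ∀ k, j k ≠ p
  j_ne_q : ∀ k, j k ≠ q

namespace HeisenbergIndex

variable {n : ℕ} {ι O : Type*} [CommRing O] (s : HeisenbergIndex n ι)

/-- The extension by zero of a vector along the indices `j`. -/
def ext : (Fin n → O) →ₗ[O] ι → O := Function.ExtendByZero.linearMap O s.j

lemma ext_j (x : Fin n → O) (k : Fin n) : s.ext x (s.j k) = x k :=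
  s.j_injective.extend_apply _ _ _

lemma ext_of_ne (x : Fin n → O) {i : ι} (hi : ∀ k, s.j k ≠ i) : s.ext x i = 0 :=
  Function.extend_apply' _ _ _ fun ⟨k, hk⟩ => hi k hk

lemma ext_p (x : Fin n → O) : s.ext x s.p = 0 := s.ext_of_ne x s.j_ne_p

lemma ext_q (x : Fin n → O) : s.ext x s.q = 0 := s.ext_of_ne x s.j_ne_q

lemma ext_dotProduct [Fintype ι] (x y : Fin n → O) : s.ext x ⬝ᵥ s.ext y = x ⬝ᵥ y := by
  symm
  refine Finset.sum_of_injOn s.j s.j_injective.injOn (by simp) (fun i _ hi => ?_)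
    (fun k _ => by rw [ext_j, ext_j])
  rw [s.ext_of_ne x fun k hk => hi ⟨k, by simp, hk⟩, zero_mul]

variable [DecidableEq ι]

lemma forall_dvd_ext_add_single_iff {m : ι} (hm : ∀ k, s.j k ≠ m) (φ : ι → O) (x : Fin n → O)
    (z : O) :
    (∀ i, φ i ∣ (s.ext x + Pi.single m z : ι → O) i) ↔ (∀ k, φ (s.j k) ∣ x k) ∧ φ m ∣ z := by
  constructor
  · refine fun h => ⟨fun k => ?_, ?_⟩
    · simpa [ext_j, hm k] using h (s.j k)
    · simpa [s.ext_of_ne x hm] using h m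
  · rintro ⟨hx, hz⟩ i
    rcases eq_or_ne i m with rfl | him
    · simpa [s.ext_of_ne x hm] using hz
    by_cases hi : ∃ k, s.j k = i
    · obtain ⟨k, rfl⟩ := hi
      simpa [ext_j, hm k] using hx k
    · push Not at hi
      simp [s.ext_of_ne x hi, him]

variable [Fintype ι]

/-- The unipotent element with row `p` equal to `e_p + x + z e_q`. -/
def rowSL (x : Fin n → O) (z : O) : SpecialLinearGroup ι O :=
  rankOneSL (Pi.single s.p 1) (s.ext x + Pi.single s.q z) (by simp [s.p_ne_q, ext_p])

/-- The unipotent element with column `q` equal to `e_q + y + w e_p`. -/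
def colSL (y : Fin n → O) (w : O) : SpecialLinearGroup ι O :=
  rankOneSL (s.ext y + Pi.single s.p w) (Pi.single s.q 1) (by simp [s.p_ne_q.symm, ext_q])

lemma rowSL_smul (x : Fin n → O) (z : O) (v : ι → O) :
    s.rowSL x z • v = v + (s.ext x ⬝ᵥ v + z * v s.q) • Pi.single s.p 1 := by
  rw [rowSL, rankOneSL_smul, add_dotProduct, single_dotProduct]

lemma colSL_smul (y : Fin n → O) (w : O) (v : ι → O) :
    s.colSL y w • v = v + v s.q • (s.ext y + Pi.single s.p w) := by
  rw [colSL, rankOneSL_smul, single_dotProduct, one_mul]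

lemma rowSL_zero_left (z : O) : s.rowSL 0 z = SpecialLinearGroup.transvection s.p_ne_q z :=
  SL_ext_smul fun v => by rw [rowSL_smul, transvection_smul, map_zero, zero_dotProduct, zero_add]

lemma colSL_zero_left (w : O) : s.colSL 0 w = SpecialLinearGroup.transvection s.p_ne_q w :=
  SL_ext_smul fun v => by
    rw [colSL_smul, transvection_smul, map_zero, zero_add, ← Pi.single_smul', ← Pi.single_smul',
      smul_eq_mul, smul_eq_mul, mul_one, mul_comm]

lemma rowSL_mul (x : Fin n → O) (z : O) (x' : Fin n → O) (z' : O) :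
    s.rowSL x z * s.rowSL x' z' = s.rowSL (x + x') (z + z') := by
  simp only [rowSL, rankOneSL_mul_right, map_add, Pi.single_add, add_add_add_comm]

lemma colSL_mul (y : Fin n → O) (w : O) (y' : Fin n → O) (w' : O) :
    s.colSL y w * s.colSL y' w' = s.colSL (y + y') (w + w') := by
  simp only [colSL, rankOneSL_mul_left, map_add, Pi.single_add, add_add_add_comm]

lemma rowSL_inv (x : Fin n → O) (z : O) : (s.rowSL x z)⁻¹ = s.rowSL (-x) (-z) := by
  simp only [rowSL, rankOneSL_inv_right, map_neg, Pi.single_neg, neg_add]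

lemma colSL_inv (y : Fin n → O) (w : O) : (s.colSL y w)⁻¹ = s.colSL (-y) (-w) := by
  simp only [colSL, rankOneSL_inv_left, map_neg, Pi.single_neg, neg_add]

lemma rowSL_mul_colSL (x : Fin n → O) (z : O) (y : Fin n → O) (w : O) :
    s.rowSL x z * s.colSL y w = s.colSL y 0 * s.rowSL 0 (z + w + x ⬝ᵥ y) * s.rowSL x 0 := by
  refine SL_ext_smul fun v => funext fun i => ?_
  simp only [mul_smul, rowSL_smul, colSL_smul]
  rcases eq_or_ne i s.p with rfl | hi
  · simp [ext_dotProduct, ext_p, ext_q, s.p_ne_q.symm]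
    ring
  · simp [ext_q, s.p_ne_q.symm, hi]

lemma colSL_mul_rowSL (y : Fin n → O) (w : O) (x : Fin n → O) (z : O) :
    s.colSL y w * s.rowSL x z = s.rowSL x 0 * s.colSL 0 (w + z - x ⬝ᵥ y) * s.colSL y 0 := by
  apply inv_injective
  rw [_root_.mul_inv_rev, _root_.mul_inv_rev, _root_.mul_inv_rev, colSL_inv, colSL_inv, colSL_inv,
    rowSL_inv, rowSL_inv, rowSL_mul_colSL, neg_zero, neg_zero, rowSL_zero_left, colSL_zero_left,
    ← mul_assoc, neg_dotProduct_neg]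
  congr 3
  ring

/-- The Heisenberg group with its elements `(x, 0, z)` in the row `p`. -/
def rowPair : HeisenbergPair n O (SpecialLinearGroup ι O) where
  left := s.rowSL
  right := s.colSL
  left_mul_inv x z x' z' := by rw [rowSL_inv, rowSL_mul, ← sub_eq_add_neg, ← sub_eq_add_neg]
  inv_mul_right y w y' w' := by
    rw [colSL_inv, colSL_mul, neg_add_eq_sub, neg_add_eq_sub]
  left_mul_right := s.rowSL_mul_colSL

/-- The Heisenberg group with its elements `(x, 0, z)` in the column `q`; the sign turns the
commutator `-x ⬝ y` of `colSL x 0` and `rowSL y 0` into `x ⬝ y`. -/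
def colPair : HeisenbergPair n O (SpecialLinearGroup ι O) where
  left x z := s.colSL (-x) z
  right := s.rowSL
  left_mul_inv x z x' z' := by
    rw [colSL_inv, colSL_mul, neg_sub, neg_neg, neg_add_eq_sub, ← sub_eq_add_neg]
  inv_mul_right y w y' w' := by
    rw [rowSL_inv, rowSL_mul, neg_add_eq_sub, neg_add_eq_sub]
  left_mul_right x z y w := by
    rw [colSL_mul_rowSL, neg_zero, dotProduct_neg, sub_neg_eq_add, dotProduct_comm]

lemma rowPair_left_zero (z : O) :
    s.rowPair.left 0 z = SpecialLinearGroup.transvection s.p_ne_q z := s.rowSL_zero_left z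

lemma colPair_left_zero (z : O) :
    s.colPair.left 0 z = SpecialLinearGroup.transvection s.p_ne_q z := by
  rw [← colSL_zero_left]
  simp only [colPair, neg_zero]

end HeisenbergIndex

end HeisenbergIndex

section DoubleCosetFamily

open Matrix

/-- The image of a pair of families under a group homomorphism. -/
def HeisenbergPair.map {n : ℕ} {O G G' : Type*} [CommRing O] [Group G] [Group G']
    (P : HeisenbergPair n O G) (f : G →* G') : HeisenbergPair n O G' where
  left x z := f (P.left x z)
  right y w := f (P.right y w)
  left_mul_inv x z x' z' := by rw [← map_inv, ← map_mul, P.left_mul_inv]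
  inv_mul_right y w y' w' := by rw [← map_inv, ← map_mul, P.inv_mul_right]
  left_mul_right x z y w := by rw [← map_mul, P.left_mul_right, map_mul, map_mul]

variable {n : ℕ} {ι S O : Type*} [Fintype ι] [DecidableEq ι] [CommRing S] [CommRing O]
  [Algebra O S] [FaithfulSMul O S] {π : Sˣ} {ϖ : O}

namespace HeisenbergIndex

variable (s : HeisenbergIndex n ι) (hπ : (π : S) = algebraMap O S ϖ)

include hπ

lemma zpowSL_conj_rowSL_mem_iff (a : weightLattice ι) (x : Fin n → O) (z : O) :
    zpowSL π a * SpecialLinearGroup.map (algebraMap O S) (s.rowSL x z) * (zpowSL π a)⁻¹ ∈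
        integralSL ι S O ↔
      (∀ k, ϖ ^ (a.1 (s.j k) - a.1 s.p).toNat ∣ x k) ∧ ϖ ^ (a.1 s.q - a.1 s.p).toNat ∣ z := by
  rw [rowSL, zpowSL_conj_rankOneSL_mem_iff hπ, ← s.forall_dvd_ext_add_single_iff s.j_ne_q
    (fun i => ϖ ^ (a.1 i - a.1 s.p).toNat)]
  refine ⟨fun h i => by simpa using h s.p i, fun h i i' => ?_⟩
  rcases eq_or_ne i s.p with rfl | hi
  · simpa using h i'
  · simp [hi]

lemma zpowSL_conj_colSL_mem_iff (a : weightLattice ι) (y : Fin n → O) (w : O) :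
    zpowSL π a * SpecialLinearGroup.map (algebraMap O S) (s.colSL y w) * (zpowSL π a)⁻¹ ∈
        integralSL ι S O ↔
      (∀ k, ϖ ^ (a.1 s.q - a.1 (s.j k)).toNat ∣ y k) ∧ ϖ ^ (a.1 s.q - a.1 s.p).toNat ∣ w := by
  rw [colSL, zpowSL_conj_rankOneSL_mem_iff hπ, ← s.forall_dvd_ext_add_single_iff s.j_ne_p
    (fun i => ϖ ^ (a.1 s.q - a.1 i).toNat)]
  refine ⟨fun h i => by simpa using h i s.q, fun h i i' => ?_⟩
  rcases eq_or_ne i' s.q with rfl | hi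
  · simpa using h i
  · simp [hi]

lemma zpowSL_inv_conj_rowSL_mem_iff (b : weightLattice ι) (x : Fin n → O) (z : O) :
    (zpowSL π b)⁻¹ * SpecialLinearGroup.map (algebraMap O S) (s.rowSL x z) * zpowSL π b ∈
        integralSL ι S O ↔
      (∀ k, ϖ ^ (b.1 s.p - b.1 (s.j k)).toNat ∣ x k) ∧ ϖ ^ (b.1 s.p - b.1 s.q).toNat ∣ z := by
  simpa [zpowSL_neg, neg_add_eq_sub] using s.zpowSL_conj_rowSL_mem_iff hπ (-b) x z

lemma zpowSL_inv_conj_colSL_mem_iff (b : weightLattice ι) (y : Fin n → O) (w : O) :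
    (zpowSL π b)⁻¹ * SpecialLinearGroup.map (algebraMap O S) (s.colSL y w) * zpowSL π b ∈
        integralSL ι S O ↔
      (∀ k, ϖ ^ (b.1 (s.j k) - b.1 s.q).toNat ∣ y k) ∧ ϖ ^ (b.1 s.p - b.1 s.q).toNat ∣ w := by
  simpa [zpowSL_neg, neg_add_eq_sub] using s.zpowSL_conj_colSL_mem_iff hπ (-b) y w

variable {k : ℕ} {a b : weightLattice ι} (ha : a.1 s.q = a.1 s.p + (k + 1))
  (hb : b.1 s.q + (k + 1) ≤ b.1 s.p)

include ha hb

lemma isDoubleCosetFamily_rowPair (haj : ∀ i, a.1 s.q ≤ a.1 (s.j i))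
    (hbj : ∀ i, b.1 s.p ≤ b.1 (s.j i)) :
    (s.rowPair.map (SpecialLinearGroup.map (algebraMap O S))).IsDoubleCosetFamily
      (integralSL ι S O) (Ideal.span {ϖ ^ (k + 1)}) (zpowSL π a) (zpowSL π b) where
  conj_right_mem y := (s.zpowSL_conj_colSL_mem_iff hπ a y 0).2
    ⟨fun i => by simp [Int.toNat_of_nonpos (sub_nonpos.2 (haj i))], dvd_zero _⟩
  conj_left_mem x := (s.zpowSL_inv_conj_rowSL_mem_iff hπ b x 0).2
    ⟨fun i => by simp [Int.toNat_of_nonpos (sub_nonpos.2 (hbj i))], dvd_zero _⟩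
  conj_center_mem c hc := (s.zpowSL_conj_rowSL_mem_iff hπ a 0 c).2
    ⟨fun i => dvd_zero _, (pow_dvd_pow _ (by omega)).trans (Ideal.mem_span_singleton.1 hc)⟩
  of_conj_left_mem x z h := by
    obtain ⟨hx, hz⟩ := (s.zpowSL_conj_rowSL_mem_iff hπ a x z).1 h
    refine ⟨fun i => ?_, ?_⟩ <;> rw [Ideal.mem_span_singleton]
    · exact (pow_dvd_pow _ (by have := haj i; omega)).trans (hx i)
    · exact (pow_dvd_pow _ (by omega)).trans hz
  of_conj_right_mem y w h := by
    obtain ⟨hy, hw⟩ := (s.zpowSL_inv_conj_colSL_mem_iff hπ b y w).1 h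
    refine ⟨fun i => ?_, ?_⟩ <;> rw [Ideal.mem_span_singleton]
    · exact (pow_dvd_pow _ (by have := hbj i; omega)).trans (hy i)
    · exact (pow_dvd_pow _ (by omega)).trans hw

lemma isDoubleCosetFamily_colPair (haj : ∀ i, a.1 (s.j i) ≤ a.1 s.p)
    (hbj : ∀ i, b.1 (s.j i) ≤ b.1 s.q) :
    (s.colPair.map (SpecialLinearGroup.map (algebraMap O S))).IsDoubleCosetFamily
      (integralSL ι S O) (Ideal.span {ϖ ^ (k + 1)}) (zpowSL π a) (zpowSL π b) where
  conj_right_mem y := (s.zpowSL_conj_rowSL_mem_iff hπ a y 0).2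
    ⟨fun i => by simp [Int.toNat_of_nonpos (sub_nonpos.2 (haj i))], dvd_zero _⟩
  conj_left_mem x := (s.zpowSL_inv_conj_colSL_mem_iff hπ b (-x) 0).2
    ⟨fun i => by simp [Int.toNat_of_nonpos (sub_nonpos.2 (hbj i))], dvd_zero _⟩
  conj_center_mem c hc := (s.zpowSL_conj_colSL_mem_iff hπ a (-0) c).2
    ⟨fun i => by simp, (pow_dvd_pow _ (by omega)).trans (Ideal.mem_span_singleton.1 hc)⟩
  of_conj_left_mem x z h := by
    obtain ⟨hx, hz⟩ := (s.zpowSL_conj_colSL_mem_iff hπ a (-x) z).1 h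
    refine ⟨fun i => ?_, ?_⟩ <;> rw [Ideal.mem_span_singleton]
    · exact (pow_dvd_pow _ (by have := haj i; omega)).trans (dvd_neg.1 (hx i))
    · exact (pow_dvd_pow _ (by omega)).trans hz
  of_conj_right_mem y w h := by
    obtain ⟨hy, hw⟩ := (s.zpowSL_inv_conj_rowSL_mem_iff hπ b y w).1 h
    refine ⟨fun i => ?_, ?_⟩ <;> rw [Ideal.mem_span_singleton]
    · exact (pow_dvd_pow _ (by have := hbj i; omega)).trans (hy i)
    · exact (pow_dvd_pow _ (by omega)).trans hw

end HeisenbergIndex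

end DoubleCosetFamily

section Transvection

open Matrix

variable {ι S O : Type*} [Fintype ι] [DecidableEq ι] [CommRing S] [CommRing O] [Algebra O S]
  (π : Sˣ)

lemma exists_conj_zpowSL_mul_transvection_mul_zpowSL (a b : weightLattice ι) {p q m : ι}
    (hpq : p ≠ q) (hmp : m ≠ p) (hmq : m ≠ q) (u : Oˣ) (c : O) :
    ∃ T ∈ integralSL ι S O,
      T * (zpowSL π a * SpecialLinearGroup.transvection hpq (algebraMap O S c) * zpowSL π b) *
          T⁻¹ =
        zpowSL π a * SpecialLinearGroup.transvection hpq (algebraMap O S (u * c)) *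
          zpowSL π b := by
  let t : ι → Oˣ := Pi.mulSingle p u * Pi.mulSingle m u⁻¹
  have ht : ∏ i, t i = 1 := by simp [t, Finset.prod_mul_distrib]
  have htpq : t p / t q = u := by simp [t, hmp.symm, hmq.symm, hpq.symm]
  set T := SpecialLinearGroup.map (algebraMap O S) (diagSL t ht) with hT
  have hcomm (d : weightLattice ι) : T * zpowSL π d = zpowSL π d * T := by
    rw [hT, map_diagSL]
    exact commute_diagSL _ _
  have htransvection : T * SpecialLinearGroup.transvection hpq (algebraMap O S c) =
      SpecialLinearGroup.transvection hpq (algebraMap O S (u * c)) * T := by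
    rw [← map_transvection, hT, ← map_mul, diagSL_mul_transvection, htpq, map_mul,
      map_transvection]
  refine ⟨T, map_mem_integralSL _, ?_⟩
  rw [mul_inv_eq_iff_eq_mul, ← mul_assoc, ← mul_assoc, hcomm, mul_assoc (zpowSL π a),
    htransvection, mul_assoc _ _ (T : SpecialLinearGroup ι S), ← hcomm b]
  simp only [mul_assoc]

variable {π} {ϖ : O} (hπ : (π : S) = algebraMap O S ϖ)

include hπ

lemma exists_transvection_mul_zpowSL_eq (c : weightLattice ι) {p q : ι} (hpq : p ≠ q)
    (hc : c.1 q + 1 ≤ c.1 p) :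
    ∃ V ∈ integralSL ι S O,
      SpecialLinearGroup.transvection hpq.symm ((π⁻¹ : Sˣ) : S) * zpowSL π c =
        zpowSL π c * V := by
  obtain ⟨e, he⟩ := Int.eq_ofNat_of_zero_le (sub_nonneg.2 hc)
  refine ⟨_, transvection_mem_integralSL hpq.symm (ϖ ^ e), ?_⟩
  rw [zpowSL_mul_transvection, zpow_mul_algebraMap_pow hπ, ← he, ← _root_.zpow_neg_one]
  congr 4
  ring

lemma IsBiinvariant.apply_zpowSL_mul_transvection_mul_zpowSL
    {Φ : SpecialLinearGroup ι S → ℂ} (hΦ : IsBiinvariant (integralSL ι S O) Φ)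
    {k : ℕ} {a b : weightLattice ι} {p q : ι} (hpq : p ≠ q) (ha : a.1 q = a.1 p + (k + 1))
    (hab : (a + b).1 q ≤ (a + b).1 p) :
    Φ (zpowSL π a * SpecialLinearGroup.transvection hpq (algebraMap O S (ϖ ^ k)) * zpowSL π b) =
      Φ (zpowSL π (a + b + rootVector p q)) := by
  have hcoeff : ((π ^ (a.1 p - a.1 q) : Sˣ) : S) * algebraMap O S (ϖ ^ k) = (π⁻¹ : Sˣ) := by
    rw [zpow_mul_algebraMap_pow hπ, ← _root_.zpow_neg_one]
    congr 2
    omega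
  obtain ⟨V, hV, hright⟩ := exists_transvection_mul_zpowSL_eq hπ (a + b + rootVector p q) hpq
    (by simpa [rootVector_apply, hpq, hpq.symm] using Int.le_add_one hab)
  have hfactor := transvection_inv_eq_mul_zpowSL π hpq
  set E := SpecialLinearGroup.transvection (F := S) hpq
  set L := SpecialLinearGroup.transvection (F := S) hpq.symm
  have hE : E 1 ∈ integralSL ι S O := by
    simpa using transvection_mem_integralSL (S := S) hpq (1 : O)
  have hL : L (-1) ∈ integralSL ι S O := by
    simpa using transvection_mem_integralSL (S := S) hpq.symm (-1 : O)
  have hLπ : L π ∈ integralSL ι S O := hπ ▸ transvection_mem_integralSL hpq.symm ϖ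
  calc Φ (zpowSL π a * E (algebraMap O S (ϖ ^ k)) * zpowSL π b)
      = Φ (E (π⁻¹ : Sˣ) * zpowSL π (a + b)) := by
        rw [zpowSL_mul_transvection, hcoeff, zpowSL_add, mul_assoc]
    _ = Φ (L π * (E 1 * L (-1) * E 1) * (L (π⁻¹ : Sˣ) * zpowSL π (a + b + rootVector p q))) := by
        rw [hfactor, add_comm (a + b), zpowSL_add π (rootVector p q)]
        simp only [mul_assoc]
    _ = Φ (zpowSL π (a + b + rootVector p q)) := by
        rw [hright, hΦ.mul_left _ (mul_mem hLπ (mul_mem (mul_mem hE hL) hE)), hΦ.mul_right _ hV]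

end Transvection

section RootStep

open Matrix

namespace HeisenbergIndex

section Weight

variable {n : ℕ} {ι : Type*} [Fintype ι] [DecidableEq ι] (s : HeisenbergIndex n ι)

/-- The weight with value `-(n + 1)` at `p` and `1` at `q` and at the indices `j`. -/
def rowWeight : weightLattice ι := rootVector s.q s.p + ∑ k, rootVector (s.j k) s.p

/-- The weight with value `n + 1` at `q` and `-1` at `p` and at the indices `j`. -/
def colWeight : weightLattice ι := rootVector s.q s.p + ∑ k, rootVector s.q (s.j k)

lemma rowWeight_p : s.rowWeight.1 s.p = -(n + 1) := by
  simp [rowWeight, rootVector_apply, s.p_ne_q, fun k => (s.j_ne_p k).symm]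

lemma rowWeight_q : s.rowWeight.1 s.q = 1 := by
  simp [rowWeight, rootVector_apply, s.p_ne_q.symm, fun k => (s.j_ne_q k).symm]

lemma rowWeight_j (i : Fin n) : s.rowWeight.1 (s.j i) = 1 := by
  simp [rowWeight, rootVector_apply, s.j_ne_p, s.j_ne_q, s.j_injective.eq_iff]

lemma colWeight_p : s.colWeight.1 s.p = -1 := by
  simp [colWeight, rootVector_apply, s.p_ne_q, fun k => (s.j_ne_p k).symm]

lemma colWeight_q : s.colWeight.1 s.q = n + 1 := by
  simp [colWeight, rootVector_apply, s.p_ne_q.symm, fun k => (s.j_ne_q k).symm]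
  ring

lemma colWeight_j (i : Fin n) : s.colWeight.1 (s.j i) = -1 := by
  simp [colWeight, rootVector_apply, s.j_ne_p, s.j_ne_q, s.j_injective.eq_iff]

end Weight

variable {n : ℕ} [NeZero n] {ι S O : Type*} [Fintype ι] [DecidableEq ι] [CommRing S]
  [CommRing O] [IsDomain O] [IsDiscreteValuationRing O] [Algebra O S]
  (s : HeisenbergIndex n ι) {ϖ : O} (hϖ : Irreducible ϖ) [Finite (O ⧸ Ideal.span {ϖ})]
  {π : Sˣ} (hπ : (π : S) = algebraMap O S ϖ)
  [MeasurableSpace (SpecialLinearGroup ι S)] [MeasurableMul (SpecialLinearGroup ι S)]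
  [MeasurableSpace.CountablyGenerated (SpecialLinearGroup ι S)]
  {μ : Measure (SpecialLinearGroup ι S)} [μ.IsMulLeftInvariant] [SFinite μ]
  (hK : MeasurableSet (integralSL ι S O : Set (SpecialLinearGroup ι S)))
  (hK0 : μ (integralSL ι S O) ≠ 0) (hKt : μ (integralSL ι S O) ≠ ∞)
  {f : SpecialLinearGroup ι S → ℂ} {p : ℝ≥0∞} (hp : p ≠ 0)
  {C : ℝ≥0} (hC : MSNormLE p μ (herzSchur f) C)

include hϖ hπ hK hK0 hKt hp hC

lemma norm_sub_le_of_isDoubleCosetFamily {P : HeisenbergPair n O (SpecialLinearGroup ι O)}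
    (hPcenter : ∀ z, P.left 0 z = SpecialLinearGroup.transvection s.p_ne_q z)
    {k : ℕ} {a b : weightLattice ι} (ha : a.1 s.q = a.1 s.p + (k + 1))
    (hab : (a + b).1 s.q ≤ (a + b).1 s.p)
    (hP : (P.map (SpecialLinearGroup.map (algebraMap O S))).IsDoubleCosetFamily
      (integralSL ι S O) (Ideal.span {ϖ ^ (k + 1)}) (zpowSL π a) (zpowSL π b)) :
    ‖doubleCosetAvg μ (integralSL ι S O) f (zpowSL π (a + b)) -
        doubleCosetAvg μ (integralSL ι S O) f (zpowSL π (a + b + rootVector s.p s.q))‖ ≤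
      2 ^ (1 + 1 / p.toReal) * C *
        ((Nat.card (O ⧸ Ideal.span {ϖ}) : ℝ) ^ (k + 1)) ^ (-heisExponent n p) := by
  have hcenter (z : O) : (P.map (SpecialLinearGroup.map (algebraMap O S))).left 0 z =
      SpecialLinearGroup.transvection s.p_ne_q (algebraMap O S z) := by
    rw [← map_transvection, ← hPcenter]
    rfl
  have hle := hP.norm_sub_le hϖ hK hK0 hKt (fun u c => by
    simpa only [hcenter] using exists_conj_zpowSL_mul_transvection_mul_zpowSL π a b s.p_ne_q
      (s.j_ne_p 0) (s.j_ne_q 0) u c) hp hC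
  rwa [hcenter, (isBiinvariant_doubleCosetAvg f).apply_zpowSL_mul_transvection_mul_zpowSL hπ
    s.p_ne_q ha hab, ← zpowSL_add] at hle

variable [FaithfulSMul O S] {l : ℕ} (hl : l ≠ 0) {w : weightLattice ι} (hpq : w.1 s.q ≤ w.1 s.p)

include hl hpq

lemma norm_sub_le_of_le_apply_j (hj : ∀ k, w.1 s.p + (n + 2) * l ≤ w.1 (s.j k)) :
    ‖doubleCosetAvg μ (integralSL ι S O) f (zpowSL π w) -
        doubleCosetAvg μ (integralSL ι S O) f (zpowSL π (w + rootVector s.p s.q))‖ ≤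
      2 ^ (1 + 1 / p.toReal) * C *
        ((Nat.card (O ⧸ Ideal.span {ϖ}) : ℝ) ^ ((n + 2) * l)) ^ (-heisExponent n p) := by
  obtain ⟨k, hk⟩ := Nat.exists_eq_succ_of_ne_zero (mul_ne_zero (Nat.succ_ne_zero (n + 1)) hl)
  have hkl : ((n : ℤ) + 2) * l = k + 1 := by exact_mod_cast hk
  have hnl : (n : ℤ) * l = k + 1 - 2 * l := by linarith
  set a : weightLattice ι := l • s.rowWeight
  have hap : a.1 s.p = l - (k + 1) := by simp [a, rowWeight_p]; linarith
  have haq : a.1 s.q = l := by simp [a, rowWeight_q]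
  have haj (i : Fin n) : a.1 (s.j i) = l := by simp [a, rowWeight_j]
  have ha : a.1 s.q = a.1 s.p + (k + 1) := by omega
  have hP := s.isDoubleCosetFamily_rowPair hπ (a := a) (b := w - a) ha
    (by simp; omega) (fun i => by rw [haq, haj])
    (fun i => by have := hj i; have := haj i; simp; omega)
  have hle := s.norm_sub_le_of_isDoubleCosetFamily hϖ hπ hK hK0 hKt hp hC
    s.rowPair_left_zero ha (by simpa using hpq) hP
  rw [add_sub_cancel] at hle
  rwa [hk]

lemma norm_sub_le_of_apply_j_le (hj : ∀ k, w.1 (s.j k) ≤ w.1 s.q - (n + 2) * l) :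
    ‖doubleCosetAvg μ (integralSL ι S O) f (zpowSL π w) -
        doubleCosetAvg μ (integralSL ι S O) f (zpowSL π (w + rootVector s.p s.q))‖ ≤
      2 ^ (1 + 1 / p.toReal) * C *
        ((Nat.card (O ⧸ Ideal.span {ϖ}) : ℝ) ^ ((n + 2) * l)) ^ (-heisExponent n p) := by
  obtain ⟨k, hk⟩ := Nat.exists_eq_succ_of_ne_zero (mul_ne_zero (Nat.succ_ne_zero (n + 1)) hl)
  have hkl : ((n : ℤ) + 2) * l = k + 1 := by exact_mod_cast hk
  have hnl : (n : ℤ) * l = k + 1 - 2 * l := by linarith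
  set a : weightLattice ι := l • s.colWeight
  have hap : a.1 s.p = -l := by simp [a, colWeight_p]
  have haq : a.1 s.q = k + 1 - l := by simp [a, colWeight_q]; linarith
  have haj (i : Fin n) : a.1 (s.j i) = -l := by simp [a, colWeight_j]
  have ha : a.1 s.q = a.1 s.p + (k + 1) := by omega
  have hP := s.isDoubleCosetFamily_colPair hπ (a := a) (b := w - a) ha
    (by simp; omega) (fun i => by rw [hap, haj])
    (fun i => by have := hj i; have := haj i; simp; omega)
  have hle := s.norm_sub_le_of_isDoubleCosetFamily hϖ hπ hK hK0 hKt hp hC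
    s.colPair_left_zero ha (by simpa using hpq) hP
  rw [add_sub_cancel] at hle
  rwa [hk]

lemma norm_sub_le_of_apply_j
    (hj : (∀ k, w.1 s.p + (n + 2) * l ≤ w.1 (s.j k)) ∨
      ∀ k, w.1 (s.j k) ≤ w.1 s.q - (n + 2) * l) :
    ‖doubleCosetAvg μ (integralSL ι S O) f (zpowSL π w) -
        doubleCosetAvg μ (integralSL ι S O) f (zpowSL π (w + rootVector s.p s.q))‖ ≤
      2 ^ (1 + 1 / p.toReal) * C *
        ((Nat.card (O ⧸ Ideal.span {ϖ}) : ℝ) ^ ((n + 2) * l)) ^ (-heisExponent n p) :=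
  hj.elim (s.norm_sub_le_of_le_apply_j hϖ hπ hK hK0 hKt hp hC hl hpq)
    (s.norm_sub_le_of_apply_j_le hϖ hπ hK hK0 hKt hp hC hl hpq)

end HeisenbergIndex

end RootStep

section Chain

variable {n : ℕ} {ι : Type*} [Fintype ι] [DecidableEq ι]

/-- The direction in the weight lattice with the values `1` at `c k` and `-1` at `b k`. -/
def chainDirection (b c : Fin n → ι) : weightLattice ι := ∑ k, rootVector (c k) (b k)

section

variable {b c : Fin n → ι} {m : ι} (hb : Function.Injective b) (hc : Function.Injective c)
  (hbc : ∀ i j, b i ≠ c j) (hbm : ∀ i, b i ≠ m) (hcm : ∀ i, c i ≠ m)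

include hc hbc in
lemma chainDirection_right (i : Fin n) : (chainDirection b c).1 (c i) = 1 := by
  simp [chainDirection, rootVector_apply, hc.eq_iff, fun j k => (hbc k j).symm]

include hb hbc in
lemma chainDirection_left (i : Fin n) : (chainDirection b c).1 (b i) = -1 := by
  simp [chainDirection, rootVector_apply, hb.eq_iff, hbc]

include hbm hcm in
lemma chainDirection_of_ne : (chainDirection b c).1 m = 0 := by
  simp [chainDirection, rootVector_apply, fun k => (hbm k).symm, fun k => (hcm k).symm]

variable {Ψ : weightLattice ι → ℂ} {β : ℝ} {l : ℕ}
  (hΨ : ∀ (s : HeisenbergIndex n ι) (w : weightLattice ι), w.1 s.q ≤ w.1 s.p →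
    ((∀ k, w.1 s.p + (n + 2) * l ≤ w.1 (s.j k)) ∨ ∀ k, w.1 (s.j k) ≤ w.1 s.q - (n + 2) * l) →
    ‖Ψ w - Ψ (w + rootVector s.p s.q)‖ ≤ β)

include hb hc hbc hbm hcm hΨ

-- The root `e_(c k) - e_(b k)` is reached through the index `m`, at which `w` vanishes: the entries
-- at `c` are far above those at `m`, `b k`, and the entries at `b` far below those at `m`, `c k`.
lemma norm_sub_add_rootVector_le {w : weightLattice ι} (hwm : w.1 m = 0)
    (hwc : ∀ i, (n + 2) * l + 1 ≤ w.1 (c i)) (hwb : ∀ i, w.1 (b i) ≤ -((n + 2) * l)) (k : Fin n) :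
    ‖Ψ w - Ψ (w + rootVector (c k) (b k))‖ ≤ 2 * β := by
  have hnl : (0 : ℤ) ≤ (n + 2) * l := by positivity
  have hroot : w + rootVector m (b k) + rootVector (c k) m = w + rootVector (c k) (b k) := by
    rw [add_assoc]
    congr 1
    ext i
    simp [rootVector]
  have hfirst := hΨ ⟨m, b k, c, (hbm k).symm, hc, hcm, fun i => (hbc k i).symm⟩ w
    (by have := hwb k; simp only; omega) (Or.inl fun i => by have := hwc i; simp only; omega)
  have hsecond := hΨ ⟨c k, m, b, hcm k, hb, fun i => hbc i k, hbm⟩ (w + rootVector m (b k))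
    (by have := hwc k; simp [rootVector_apply, hwm, hcm, (hbm k).symm, (hbc k k).symm]; omega)
    (Or.inr fun i => by
      have := hwb i
      simp [rootVector_apply, hwm, hbm, (hbm k).symm]
      split_ifs <;> omega)
  have htriangle := norm_sub_le_norm_sub_add_norm_sub (Ψ w) (Ψ (w + rootVector m (b k)))
    (Ψ (w + rootVector m (b k) + rootVector (c k) m))
  rw [hroot] at hsecond htriangle
  linarith

lemma norm_sub_add_sum_rootVector_le (s : Finset (Fin n)) {w : weightLattice ι} (hwm : w.1 m = 0)
    (hwc : ∀ i, (n + 2) * l + 1 ≤ w.1 (c i)) (hwb : ∀ i, w.1 (b i) ≤ -((n + 2) * l)) :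
    ‖Ψ w - Ψ (w + ∑ k ∈ s, rootVector (c k) (b k))‖ ≤ 2 * s.card * β := by
  induction s using Finset.induction_on generalizing w with
  | empty => simp
  | insert k s hk ih =>
    have hstep := norm_sub_add_rootVector_le hb hc hbc hbm hcm hΨ hwm hwc hwb k
    have hrest := @ih (w + rootVector (c k) (b k))
      (by simp [rootVector_apply, hwm, (hbm k).symm, (hcm k).symm])
      (fun i => by
        have := hwc i
        simp [rootVector_apply, (hbc k i).symm]
        split_ifs <;> omega)
      (fun i => by
        have := hwb i
        simp [rootVector_apply, hbc i k]
        split_ifs <;> omega)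
    rw [Finset.sum_insert hk, ← add_assoc, Finset.card_insert_of_notMem hk]
    push_cast
    have htriangle := norm_sub_le_norm_sub_add_norm_sub (Ψ w) (Ψ (w + rootVector (c k) (b k)))
      (Ψ (w + rootVector (c k) (b k) + ∑ k ∈ s, rootVector (c k) (b k)))
    linarith

lemma norm_sub_le_of_chain {t : ℕ} (ht : (n + 2) * l + 1 ≤ t) :
    ‖Ψ (t • chainDirection b c) - Ψ ((t + 1) • chainDirection b c)‖ ≤ 2 * n * β := by
  have ht' : ((n : ℤ) + 2) * l + 1 ≤ t := by exact_mod_cast ht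
  have hle := norm_sub_add_sum_rootVector_le hb hc hbc hbm hcm hΨ Finset.univ
    (w := t • chainDirection b c) (by simp [chainDirection_of_ne hbm hcm])
    (fun i => by simpa [chainDirection_right hc hbc] using ht')
    (fun i => by simp [chainDirection_left hb hbc]; omega)
  rwa [Finset.card_univ, Fintype.card_fin, ← chainDirection, ← succ_nsmul] at hle

end

lemma norm_le_of_geometric_of_tendsto {n : ℕ} {Ψ : ℕ → ℂ} {β θ : ℝ} (hθ : θ < 1)
    (hΨ : ∀ l t : ℕ, l ≠ 0 → (n + 2) * l + 1 ≤ t → ‖Ψ t - Ψ (t + 1)‖ ≤ β * θ ^ l)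
    (hlim : Tendsto Ψ atTop (nhds 0)) (l : ℕ) :
    ‖Ψ ((n + 2) * (l + 1) + 1)‖ ≤ (n + 2) * β * θ / (1 - θ) * θ ^ l := by
  have hstep (l : ℕ) : dist (Ψ ((n + 2) * (l + 1) + 1)) (Ψ ((n + 2) * (l + 1 + 1) + 1)) ≤
      (n + 2) * β * θ * θ ^ l := by
    refine (dist_le_Ico_sum_of_dist_le (f := Ψ) (d := fun _ => β * θ ^ (l + 1))
      (by gcongr; omega) fun {t} ht _ => ?_).trans_eq ?_
    · rw [dist_eq_norm]
      exact hΨ (l + 1) t l.succ_ne_zero ht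
    · rw [Finset.sum_const, Nat.card_Ico, nsmul_eq_mul,
        show (n + 2) * (l + 1 + 1) + 1 - ((n + 2) * (l + 1) + 1) = n + 2 by
          rw [Nat.mul_succ (n + 2) (l + 1)]; omega]
      push_cast
      ring
  have hsubseq : Tendsto (fun l => Ψ ((n + 2) * (l + 1) + 1)) atTop (nhds 0) := by
    refine hlim.comp (tendsto_atTop_mono (fun l => ?_) tendsto_id)
    rw [id]
    nlinarith
  have hdist := dist_le_of_le_geometric_of_tendsto θ _ hθ hstep hsubseq l
  rw [dist_zero_right] at hdist
  exact hdist.trans_eq (by ring)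

end Chain

section LocalField

open ValuativeRel Topology

variable {F : Type*} [Field F] [ValuativeRel F] [TopologicalSpace F] [IsNonarchimedeanLocalField F]

variable (F) in
lemma secondCountableTopology_and_t2Space : SecondCountableTopology F ∧ T2Space F := by
  let := IsTopologicalAddGroup.rightUniformSpace F
  have := isUniformAddGroup_of_addCommGroup (G := F)
  let : (Valued.v (R := F)).RankOne :=
  { hom' := IsRankLeOne.nonempty.some.emb (R := F).comp MonoidWithZeroHom.ValueGroup₀.embedding
    strictMono' := IsRankLeOne.nonempty.some.strictMono.comp
        MonoidWithZeroHom.ValueGroup₀.embedding_strictMono }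
  open scoped Valued in
  have : ProperSpace F := .of_nontriviallyNormedField_of_weaklyLocallyCompactSpace F
  open scoped Valued in
  exact ⟨inferInstance, inferInstance⟩

instance : SecondCountableTopology F := (secondCountableTopology_and_t2Space F).1

instance : T2Space F := (secondCountableTopology_and_t2Space F).2

lemma isOpen_setOf_valuation_le_one : IsOpen {x : F | valuation F x ≤ 1} :=
  (valuation F).isOpen_integer

lemma exists_valuation_le_of_isCompact {s : Set F} (hs : IsCompact s) :
    ∃ γ, ∀ y ∈ s, valuation F y ≤ γ := by
  refine hs.induction_on ⟨0, by simp⟩ (fun s t hst ⟨γ, hγ⟩ => ⟨γ, fun y hy => hγ y (hst hy)⟩)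
    (fun s t ⟨γ, hγ⟩ ⟨δ, hδ⟩ => ⟨max γ δ, ?_⟩) fun x _ => ?_
  · rintro y (hy | hy)
    exacts [le_max_of_le_left (hγ y hy), le_max_of_le_right (hδ y hy)]
  · have hopen : IsOpen {y : F | valuation F (y - x) ≤ 1} :=
      isOpen_setOf_valuation_le_one.preimage (continuous_sub_right x)
    refine ⟨_, mem_nhdsWithin_of_mem_nhds (hopen.mem_nhds (by simp)),
      max 1 (valuation F x), fun y (hy : valuation F (y - x) ≤ 1) => ?_⟩
    calc valuation F y = valuation F (y - x + x) := by rw [sub_add_cancel]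
      _ ≤ max (valuation F (y - x)) (valuation F x) := (valuation F).map_add _ _
      _ ≤ max 1 (valuation F x) := max_le_max_right _ hy

lemma eventually_inv_pow_notMem {x : F} (hx : valuation F x < 1) (hx0 : x ≠ 0) {s : Set F}
    (hs : IsCompact s) : ∀ᶠ t : ℕ in atTop, (x ^ t)⁻¹ ∉ s := by
  obtain ⟨γ, hγ⟩ := exists_valuation_le_of_isCompact hs
  have hinv : 1 < (valuation F x)⁻¹ := (one_lt_inv₀ ((valuation F).pos_iff.2 hx0)).2 hx
  obtain ⟨k, hk⟩ := MulArchimedean.arch γ hinv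
  filter_upwards [eventually_gt_atTop k] with t hkt hts
  refine (hγ _ hts).not_gt (hk.trans_lt ?_)
  rw [map_inv₀, map_pow, ← inv_pow]
  exact pow_lt_pow_right₀ hinv hkt

section SpecialLinear

open Matrix

variable {ι : Type*} [Fintype ι] [DecidableEq ι]

lemma isClosedEmbedding_SL_entries :
    IsClosedEmbedding fun (g : SpecialLinearGroup ι F) (i j : ι) => g i j :=
  SpecialLinearGroup.isClosedEmbedding_val

instance : T2Space (SpecialLinearGroup ι F) :=
  isClosedEmbedding_SL_entries.isEmbedding.t2Space

instance : SecondCountableTopology (SpecialLinearGroup ι F) :=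
  isClosedEmbedding_SL_entries.isEmbedding.secondCountableTopology

instance : LocallyCompactSpace (SpecialLinearGroup ι F) :=
  isClosedEmbedding_SL_entries.locallyCompactSpace

lemma coe_integralSL : (integralSL ι F 𝒪[F] : Set (SpecialLinearGroup ι F)) =
    (fun (g : SpecialLinearGroup ι F) (i j : ι) => g i j) ⁻¹'
      Set.univ.pi fun _ => Set.univ.pi fun _ => {x | valuation F x ≤ 1} := by
  ext g
  simp only [SetLike.mem_coe, mem_integralSL, Set.mem_preimage, Set.mem_univ_pi]
  refine forall₂_congr fun i j => ⟨?_, fun h => ⟨⟨_, h⟩, rfl⟩⟩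
  rintro ⟨x, hx⟩
  exact hx ▸ x.2

lemma isCompact_integralSL : IsCompact (integralSL ι F 𝒪[F] : Set (SpecialLinearGroup ι F)) := by
  rw [coe_integralSL]
  exact isClosedEmbedding_SL_entries.isCompact_preimage (isCompact_univ_pi fun _ =>
    isCompact_univ_pi fun _ => IsNonarchimedeanLocalField.isCompact_closedBall F 1)

lemma isOpen_integralSL : IsOpen (integralSL ι F 𝒪[F] : Set (SpecialLinearGroup ι F)) := by
  rw [coe_integralSL]
  exact (isOpen_set_pi Set.finite_univ fun _ _ => isOpen_set_pi Set.finite_univ fun _ _ =>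
    isOpen_setOf_valuation_le_one).preimage isClosedEmbedding_SL_entries.continuous

lemma eventually_zpowSL_notMem {π : Fˣ} (hπ : valuation F (π : F) < 1) {v : weightLattice ι}
    {m : ι} (hm : v.1 m = -1) {L : Set (SpecialLinearGroup ι F)} (hL : IsCompact L) :
    ∀ᶠ t : ℕ in atTop, zpowSL π (t • v) ∉ L := by
  have hentry : Continuous fun g : SpecialLinearGroup ι F => g m m :=
    (continuous_apply_apply m m).comp isClosedEmbedding_SL_entries.continuous
  filter_upwards [eventually_inv_pow_notMem hπ π.ne_zero (hL.image hentry)] with t ht h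
  refine ht ⟨_, h, ?_⟩
  simp [zpowSL, diagSL_apply, hm]

end SpecialLinear

lemma finite_quotient_span_irreducible {ϖ : 𝒪[F]} (hϖ : Irreducible ϖ) :
    Finite (𝒪[F] ⧸ Ideal.span {ϖ}) := by
  rw [← hϖ.maximalIdeal_eq]
  exact inferInstanceAs (Finite 𝓀[F])

end LocalField

section Approximation

open Topology

variable {X : Type*} [TopologicalSpace X]

lemma exists_zeroAtInfty_eq_of_forall_norm_sub_le {φ : X → ℂ}
    (h : ∀ δ : ℝ, 0 < δ → ∃ f : C₀(X, ℂ), ∀ x, ‖φ x - f x‖ ≤ δ) : ∃ f : C₀(X, ℂ), ⇑f = φ := by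
  choose f hf using fun k : ℕ => h (1 / (k + 1)) (by positivity)
  have hunif : TendstoUniformly (fun k => ⇑(f k)) φ atTop := by
    rw [Metric.tendstoUniformly_iff]
    intro δ hδ
    filter_upwards [tendsto_one_div_add_atTop_nhds_zero_nat.eventually (gt_mem_nhds hδ)] with k hk x
    rw [dist_eq_norm]
    exact (hf k x).trans_lt hk
  exact ⟨⟨⟨φ, hunif.continuous (Frequently.of_forall fun k => (f k).continuous)⟩,
    hunif.tendsto_of_eventually_tendsto (Eventually.of_forall fun k => (f k).zero_at_infty')
      tendsto_const_nhds⟩, rfl⟩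

lemma exists_hasCompactSupport_eLpNorm_sub_mul_le [NormalSpace X] [R1Space X]
    [WeaklyLocallyCompactSpace X] [MeasurableSpace X] [BorelSpace X] {μ : Measure X} [μ.Regular]
    {p : ℝ≥0∞} (hp : p ≠ ∞) {ξ : X → ℂ} (hξ : MemLp ξ p μ) {M δ : ℝ} (hM : 0 ≤ M) (hδ : 0 < δ) :
    ∃ ξ' : X → ℂ, HasCompactSupport ξ' ∧ Continuous ξ' ∧ MemLp ξ' p μ ∧
      (eLpNorm (ξ - ξ') p μ).toReal * M ≤ δ := by
  have hκ : 0 < δ / (M + 1) := by positivity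
  obtain ⟨ξ', hsupp, hle, hcont, hmem⟩ :=
    hξ.exists_hasCompactSupport_eLpNorm_sub_le hp (ENNReal.ofReal_pos.2 hκ).ne'
  refine ⟨ξ', hsupp, hcont, hmem, ?_⟩
  calc (eLpNorm (ξ - ξ') p μ).toReal * M ≤ δ / (M + 1) * (M + 1) := by
        gcongr
        · exact ENNReal.toReal_le_of_le_ofReal hκ.le hle
        · linarith
    _ = δ := div_mul_cancel₀ _ (by positivity)

end Approximation

section FourierAlgebra

variable {G : Type u} [Group G] [MeasurableSpace G]

/-- The coefficient `g ↦ ⟨λ(g) ξ, η⟩` of the left regular representation, for functions `ξ` and `η`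
rather than classes in `L²`. -/
def coefficient (μ : Measure G) (ξ η : G → ℂ) (g : G) : ℂ := ∫ x, ξ (g⁻¹ * x) * conj (η x) ∂μ

section

variable [MeasurableMul G] {μ : Measure G} [μ.IsMulLeftInvariant] {ξ ξ' η η' : G → ℂ}

lemma memLp_comp_mul_left (hξ : MemLp ξ 2 μ) (g : G) : MemLp (fun x => ξ (g * x)) 2 μ :=
  hξ.comp_measurePreserving (measurePreserving_mul_left μ g)

lemma integrable_coefficient (hξ : MemLp ξ 2 μ) (hη : MemLp η 2 μ) (g : G) :
    Integrable (fun x => ξ (g⁻¹ * x) * conj (η x)) μ :=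
  (memLp_comp_mul_left hξ g⁻¹).integrable_mul hη.star

lemma norm_coefficient_le (hξ : MemLp ξ 2 μ) (hη : MemLp η 2 μ) (g : G) :
    ‖coefficient μ ξ η g‖ ≤ (eLpNorm ξ 2 μ).toReal * (eLpNorm η 2 μ).toReal := by
  have hξg := memLp_comp_mul_left hξ g⁻¹
  have hinner : coefficient μ ξ η g = ⟪hη.toLp, hξg.toLp⟫_ℂ := by
    rw [L2.inner_def]
    refine integral_congr_ae ?_
    filter_upwards [hη.coeFn_toLp, hξg.coeFn_toLp] with x hηx hξx
    rw [hηx, hξx, RCLike.inner_apply]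
  have hnorm : eLpNorm (fun x => ξ (g⁻¹ * x)) 2 μ = eLpNorm ξ 2 μ :=
    eLpNorm_comp_measurePreserving hξ.1 (measurePreserving_mul_left μ g⁻¹)
  calc ‖coefficient μ ξ η g‖ ≤ ‖hη.toLp‖ * ‖hξg.toLp‖ := hinner ▸ norm_inner_le_norm _ _
    _ = (eLpNorm ξ 2 μ).toReal * (eLpNorm η 2 μ).toReal := by
      rw [Lp.norm_toLp, Lp.norm_toLp, hnorm, mul_comm]

lemma coefficient_sub_coefficient (hξ : MemLp ξ 2 μ) (hξ' : MemLp ξ' 2 μ) (hη : MemLp η 2 μ)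
    (hη' : MemLp η' 2 μ) (g : G) :
    coefficient μ ξ η g - coefficient μ ξ' η' g =
      coefficient μ (ξ - ξ') η g + coefficient μ ξ' (η - η') g := by
  simp only [coefficient]
  rw [← integral_sub (integrable_coefficient hξ hη g) (integrable_coefficient hξ' hη' g),
    ← integral_add (integrable_coefficient (hξ.sub hξ') hη g)
      (integrable_coefficient hξ' (hη.sub hη') g)]
  refine integral_congr_ae (Eventually.of_forall fun x => ?_)
  simp only [Pi.sub_apply, map_sub]
  ring

end

section

variable [TopologicalSpace G] [IsTopologicalGroup G] [T2Space G] [SecondCountableTopology G]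
  [LocallyCompactSpace G] [BorelSpace G] {μ : Measure G} [μ.IsHaarMeasure]

lemma exists_zeroAtInfty_eq_coefficient {ξ η : G → ℂ} (hξ : Continuous ξ) (hη : Continuous η)
    (hξs : HasCompactSupport ξ) (hηs : HasCompactSupport η) :
    ∃ f : C₀(G, ℂ), ⇑f = coefficient μ ξ η := by
  have hset (g : G) : coefficient μ ξ η g = ∫ x in tsupport η, ξ (g⁻¹ * x) * conj (η x) ∂μ := by
    rw [coefficient, setIntegral_eq_integral_of_forall_compl_eq_zero]
    intro x hx
    rw [image_eq_zero_of_notMem_tsupport hx, map_zero, mul_zero]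
  have hcont : Continuous (coefficient μ ξ η) := by
    simp only [funext hset]
    refine continuous_parametric_integral_of_continuous ?_ hηs
    simp only [Function.uncurry_def]
    fun_prop
  have hsupp : HasCompactSupport (coefficient μ ξ η) := by
    refine HasCompactSupport.intro (hηs.mul hξs.inv) fun g hg => ?_
    rw [hset]
    refine setIntegral_eq_zero_of_forall_eq_zero fun x hx => ?_
    rw [image_eq_zero_of_notMem_tsupport (f := ξ), zero_mul]
    exact fun h => hg ⟨x, hx, _, Set.inv_mem_inv.2 h, by simp⟩
  exact ⟨⟨⟨_, hcont⟩, hsupp.is_zero_at_infty⟩, rfl⟩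

lemma exists_zeroAtInfty_norm_coefficient_sub_le {ξ η : G → ℂ} (hξ : MemLp ξ 2 μ)
    (hη : MemLp η 2 μ) {δ : ℝ} (hδ : 0 < δ) :
    ∃ f : C₀(G, ℂ), ∀ g, ‖coefficient μ ξ η g - f g‖ ≤ δ := by
  obtain ⟨ξ', hξs, hξc, hξ', hξδ⟩ := exists_hasCompactSupport_eLpNorm_sub_mul_le
    ENNReal.ofNat_ne_top hξ (ENNReal.toReal_nonneg (a := eLpNorm η 2 μ)) (half_pos hδ)
  obtain ⟨η', hηs, hηc, hη', hηδ⟩ := exists_hasCompactSupport_eLpNorm_sub_mul_le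
    ENNReal.ofNat_ne_top hη (ENNReal.toReal_nonneg (a := eLpNorm ξ' 2 μ)) (half_pos hδ)
  obtain ⟨f, hf⟩ := exists_zeroAtInfty_eq_coefficient (μ := μ) hξc hηc hξs hηs
  refine ⟨f, fun g => ?_⟩
  rw [hf, coefficient_sub_coefficient hξ hξ' hη hη']
  calc _ ≤ ‖coefficient μ (ξ - ξ') η g‖ + ‖coefficient μ ξ' (η - η') g‖ := norm_add_le _ _
    _ ≤ δ / 2 + δ / 2 := add_le_add ((norm_coefficient_le (hξ.sub hξ') hη g).trans hξδ)
        ((norm_coefficient_le hξ' (hη.sub hη') g).trans (by rwa [mul_comm]))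
    _ = δ := add_halves δ

lemma MemFourierAlgebra.exists_zeroAtInfty {φ : G → ℂ} (h : MemFourierAlgebra μ φ) :
    ∃ f : C₀(G, ℂ), ⇑f = φ := by
  obtain ⟨ξ, η, hξ, hη, hφ⟩ := h
  obtain rfl : φ = coefficient μ ξ η := funext hφ
  exact exists_zeroAtInfty_eq_of_forall_norm_sub_le fun δ hδ =>
    exists_zeroAtInfty_norm_coefficient_sub_le hξ hη hδ

lemma HasAPcbSchur.hasC0SchurApproximation {p : ℝ≥0∞} (hp : p ≠ 0) (h : HasAPcbSchur p μ) :
    HasC0SchurApproximation p μ := by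
  obtain ⟨C, ι, _, _, _, φ, hφ, hconv, hC⟩ := h
  choose f hf using fun a => (hφ a).exists_zeroAtInfty
  refine ⟨C, ι, _, ‹_›, ‹_›, f, by simpa only [hf] using hconv, fun a => ?_⟩
  rw [hf]
  exact (hC a).msNormLE hp

end

end FourierAlgebra

section AverageLimits

open Topology

lemma norm_setIntegral_sub_le {X : Type*} [MeasurableSpace X] {μ : Measure X} {s : Set X}
    {f : X → ℂ} (hs : μ s ≠ ∞) (hf : IntegrableOn f s μ) {z : ℂ} {δ : ℝ}
    (h : ∀ x ∈ s, ‖f x - z‖ ≤ δ) :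
    ‖∫ x in s, f x ∂μ - (μ s).toReal * z‖ ≤ δ * (μ s).toReal := by
  have hsub : ∫ x in s, f x ∂μ - (μ s).toReal * z = ∫ x in s, (f x - z) ∂μ := by
    rw [integral_sub hf (integrableOn_const hs), setIntegral_const, Measure.real,
      Complex.real_smul]
  exact hsub ▸ norm_setIntegral_le_of_norm_le_const hs.lt_top h

variable {G : Type*} [Group G] [TopologicalSpace G] [IsTopologicalGroup G]
  [T2Space G] [SecondCountableTopology G] [LocallyCompactSpace G] [MeasurableSpace G]
  [BorelSpace G] {μ : Measure G} [μ.IsHaarMeasure] {K : Subgroup G}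
  (hKo : IsOpen (K : Set G)) (hKc : IsCompact (K : Set G))

include hKo hKc

lemma norm_doubleCosetAvg_sub_le {f : G → ℂ} (hf : Continuous f) {g : G} {z : ℂ} {δ : ℝ}
    (h : ∀ u ∈ K, ∀ w ∈ K, ‖f (u * g * w) - z‖ ≤ δ) : ‖doubleCosetAvg μ K f g - z‖ ≤ δ := by
  have hKt : μ K ≠ ∞ := hKc.measure_lt_top.ne
  have hK0 : μ K ≠ 0 := (hKo.measure_pos μ ⟨1, K.one_mem⟩).ne'
  have hpos : 0 < (μ K).toReal := ENNReal.toReal_pos hK0 hKt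
  have hne : ((μ K).toReal : ℂ) ≠ 0 := by exact_mod_cast hpos.ne'
  have hinner (u : G) : Continuous fun w => f (u⁻¹ * g * w) := by fun_prop
  have houter : Continuous fun u => ∫ w in (K : Set G), f (u⁻¹ * g * w) ∂μ := by
    refine continuous_parametric_integral_of_continuous ?_ hKc
    simp only [Function.uncurry_def]
    fun_prop
  have hle : ‖(∫ u in (K : Set G), ∫ w in (K : Set G), f (u⁻¹ * g * w) ∂μ ∂μ) -
      (μ K).toReal * ((μ K).toReal * z)‖ ≤ δ * (μ K).toReal * (μ K).toReal :=
    norm_setIntegral_sub_le hKt (houter.continuousOn.integrableOn_compact hKc) fun u hu =>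
      norm_setIntegral_sub_le hKt ((hinner u).continuousOn.integrableOn_compact hKc)
        fun w hw => h _ (K.inv_mem hu) w hw
  have hfactor : doubleCosetAvg μ K f g - z = ((μ K).toReal ^ 2 : ℂ)⁻¹ *
      ((∫ u in (K : Set G), ∫ w in (K : Set G), f (u⁻¹ * g * w) ∂μ ∂μ) -
        (μ K).toReal * ((μ K).toReal * z)) := by
    rw [doubleCosetAvg, mul_sub, ← mul_assoc _ _ z, ← sq,
      inv_mul_cancel_left₀ (pow_ne_zero 2 hne)]
    push_cast
    rfl
  rw [hfactor, norm_mul, norm_inv, norm_pow, Complex.norm_real, Real.norm_of_nonneg hpos.le,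
    inv_mul_le_iff₀ (by positivity)]
  linarith

lemma tendsto_doubleCosetAvg_zero {f : G → ℂ} (hf : Continuous f)
    (hf0 : Tendsto f (cocompact G) (𝓝 0)) {x : ℕ → G}
    (hx : ∀ L : Set G, IsCompact L → ∀ᶠ t in atTop, x t ∉ L) :
    Tendsto (fun t => doubleCosetAvg μ K f (x t)) atTop (𝓝 0) := by
  rw [Metric.tendsto_nhds] at hf0 ⊢
  intro δ hδ
  obtain ⟨L, hL, hLf⟩ := mem_cocompact.1 (hf0 (δ / 2) (half_pos hδ))
  filter_upwards [hx _ ((hKc.mul hL).mul hKc)] with t ht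
  rw [dist_eq_norm]
  refine (norm_doubleCosetAvg_sub_le hKo hKc hf fun u hu w hw => ?_).trans_lt (half_lt_self hδ)
  have hnotMem : u * x t * w ∉ L := fun h =>
    ht ⟨u⁻¹ * (u * x t * w), ⟨u⁻¹, K.inv_mem hu, _, h, rfl⟩, w⁻¹, K.inv_mem hw, by group⟩
  rw [← dist_eq_norm]
  exact (hLf hnotMem).le

lemma tendsto_doubleCosetAvg_one {α : Type*} {l : Filter α} {f : α → G → ℂ}
    (hf : ∀ a, Continuous (f a))
    (hlim : ∀ L : Set G, IsCompact L → TendstoUniformlyOn f (fun _ => 1) l L) (g : G) :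
    Tendsto (fun a => doubleCosetAvg μ K (f a) g) l (𝓝 1) := by
  rw [Metric.tendsto_nhds]
  intro δ hδ
  have huniform := Metric.tendstoUniformlyOn_iff.1
    (hlim _ ((hKc.mul (isCompact_singleton (x := g))).mul hKc)) (δ / 2) (half_pos hδ)
  filter_upwards [huniform] with a ha
  rw [dist_eq_norm]
  refine (norm_doubleCosetAvg_sub_le hKo hKc (hf a) fun u hu w hw => ?_).trans_lt
    (half_lt_self hδ)
  rw [← dist_eq_norm, dist_comm]
  exact (ha (u * g * w) ⟨u * g, ⟨u, hu, g, rfl, rfl⟩, w, hw, rfl⟩).le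

end AverageLimits

section Decay

open Matrix ValuativeRel Topology

lemma exists_disjoint_injective {n : ℕ} {ι : Type*} [Fintype ι] (h : 2 * n + 1 ≤ Fintype.card ι) :
    ∃ (b c : Fin n → ι) (m : ι), Function.Injective b ∧ Function.Injective c ∧
      (∀ i j, b i ≠ c j) ∧ (∀ i, b i ≠ m) ∧ ∀ i, c i ≠ m := by
  obtain ⟨e⟩ : Nonempty ((Fin n ⊕ Fin n) ⊕ Unit ↪ ι) :=
    Function.Embedding.nonempty_of_card_le (by simpa [← two_mul] using h)
  exact ⟨fun i => e (.inl (.inl i)), fun i => e (.inl (.inr i)), e (.inr ()),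
    fun i j => by simp, fun i j => by simp, by simp, by simp, by simp⟩

section

variable {O : Type*} [CommRing O]

/-- The ratio of the geometric decay of the averages over the double cosets of `zpowSL π w` when
`n + 2` steps are taken along `chainDirection`. -/
def decayRatio (ϖ : O) (n : ℕ) (p : ℝ≥0∞) : ℝ :=
  (Nat.card (O ⧸ Ideal.span {ϖ}) : ℝ) ^ (-(heisExponent n p * (n + 2)))

lemma decayRatio_nonneg (ϖ : O) (n : ℕ) (p : ℝ≥0∞) : 0 ≤ decayRatio ϖ n p :=
  Real.rpow_nonneg (Nat.cast_nonneg _) _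

lemma decayRatio_lt_one {ϖ : O} [Finite (O ⧸ Ideal.span {ϖ})] (hϖ : ¬IsUnit ϖ) {n : ℕ} {p : ℝ≥0∞}
    (hε : 0 < heisExponent n p) : decayRatio ϖ n p < 1 := by
  have : Nontrivial (O ⧸ Ideal.span {ϖ}) :=
    Ideal.Quotient.nontrivial_iff.2 (by simpa [Ideal.span_singleton_eq_top] using hϖ)
  exact Real.rpow_lt_one_of_one_lt_of_neg (by exact_mod_cast Finite.one_lt_card)
    (by rw [neg_lt_zero]; positivity)

lemma rpow_neg_heisExponent_eq_decayRatio_pow (ϖ : O) (n l : ℕ) (p : ℝ≥0∞) :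
    ((Nat.card (O ⧸ Ideal.span {ϖ}) : ℝ) ^ ((n + 2) * l)) ^ (-heisExponent n p) =
      decayRatio ϖ n p ^ l := by
  rw [decayRatio, ← Real.rpow_natCast, ← Real.rpow_mul (Nat.cast_nonneg _),
    ← Real.rpow_natCast (_ ^ _), ← Real.rpow_mul (Nat.cast_nonneg _)]
  congr 1
  push_cast
  ring

end

variable {F : Type*} [Field F] [ValuativeRel F] [TopologicalSpace F] [IsNonarchimedeanLocalField F]
  {ι : Type*} [Fintype ι] [DecidableEq ι] [MeasurableSpace (SpecialLinearGroup ι F)]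
  [BorelSpace (SpecialLinearGroup ι F)] {μ : Measure (SpecialLinearGroup ι F)} [μ.IsHaarMeasure]
  {n : ℕ} [NeZero n] {p : ℝ≥0∞} (hp : p ≠ 0)

include hp

lemma norm_doubleCosetAvg_zpowSL_chainDirection_le {ϖ : 𝒪[F]} (hϖ : Irreducible ϖ) {π : Fˣ}
    (hπ : (π : F) = algebraMap 𝒪[F] F ϖ) (hratio : decayRatio ϖ n p < 1) {b c : Fin n → ι} {m : ι}
    (hb : Function.Injective b) (hc : Function.Injective c) (hbc : ∀ i j, b i ≠ c j)
    (hbm : ∀ i, b i ≠ m) (hcm : ∀ i, c i ≠ m) {f : C₀(SpecialLinearGroup ι F, ℂ)} {C : ℝ≥0}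
    (hC : MSNormLE p μ (herzSchur f) C) (l : ℕ) :
    ‖doubleCosetAvg μ (integralSL ι F 𝒪[F]) f
        (zpowSL π (((n + 2) * (l + 1) + 1) • chainDirection b c))‖ ≤
      (n + 2) * (2 * n * (2 ^ (1 + 1 / p.toReal) * C)) * decayRatio ϖ n p /
        (1 - decayRatio ϖ n p) * decayRatio ϖ n p ^ l := by
  have := finite_quotient_span_irreducible hϖ
  have hKo : IsOpen (integralSL ι F 𝒪[F] : Set (SpecialLinearGroup ι F)) := isOpen_integralSL
  have hKc : IsCompact (integralSL ι F 𝒪[F] : Set (SpecialLinearGroup ι F)) := isCompact_integralSL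
  have hK0 : μ (integralSL ι F 𝒪[F]) ≠ 0 := (hKo.measure_pos μ ⟨1, one_mem _⟩).ne'
  have hπv : valuation F (π : F) < 1 :=
    hπ ▸ (Valuation.integer.integers (valuation F)).valuation_irreducible_lt_one hϖ
  set Ψ := fun w => doubleCosetAvg μ (integralSL ι F 𝒪[F]) f (zpowSL π w)
  refine norm_le_of_geometric_of_tendsto (Ψ := fun t => Ψ (t • chainDirection b c)) hratio
    (fun l t hl ht => ?_) ?_ l
  · refine (norm_sub_le_of_chain hb hc hbc hbm hcm (Ψ := Ψ) (fun s w hpq hj =>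
      s.norm_sub_le_of_apply_j hϖ hπ hKo.measurableSet hK0 hKc.measure_lt_top.ne hp hC hl hpq hj)
      ht).trans_eq ?_
    rw [rpow_neg_heisExponent_eq_decayRatio_pow]
    ring
  · exact tendsto_doubleCosetAvg_zero hKo hKc f.continuous f.zero_at_infty' fun L hL =>
      eventually_zpowSL_notMem hπv (chainDirection_left hb hbc 0) hL

lemma exists_forall_norm_doubleCosetAvg_le (hι : 2 * n + 1 ≤ Fintype.card ι)
    (hε : 0 < heisExponent n p) (C : ℝ≥0) {δ : ℝ} (hδ : 0 < δ) :
    ∃ g : SpecialLinearGroup ι F, ∀ f : C₀(SpecialLinearGroup ι F, ℂ),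
      MSNormLE p μ (herzSchur f) C → ‖doubleCosetAvg μ (integralSL ι F 𝒪[F]) f g‖ ≤ δ := by
  obtain ⟨b, c, m, hb, hc, hbc, hbm, hcm⟩ := exists_disjoint_injective hι
  obtain ⟨ϖ, hϖ⟩ := IsDiscreteValuationRing.exists_irreducible 𝒪[F]
  obtain ⟨π, hπ⟩ : ∃ π : Fˣ, (π : F) = algebraMap 𝒪[F] F ϖ :=
    ⟨Units.mk0 _ (by simpa using hϖ.ne_zero), rfl⟩
  have := finite_quotient_span_irreducible hϖ
  have hratio := decayRatio_lt_one hϖ.not_isUnit hε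
  have hlim := (tendsto_pow_atTop_nhds_zero_of_lt_one (decayRatio_nonneg ϖ n p) hratio).const_mul
    ((n + 2) * (2 * n * (2 ^ (1 + 1 / p.toReal) * C)) * decayRatio ϖ n p / (1 - decayRatio ϖ n p))
  rw [mul_zero] at hlim
  obtain ⟨l, hl⟩ := (hlim.eventually (ge_mem_nhds hδ)).exists
  exact ⟨_, fun f hC => (norm_doubleCosetAvg_zpowSL_chainDirection_le hp hϖ hπ hratio
    hb hc hbc hbm hcm hC l).trans hl⟩

lemma not_hasC0SchurApproximation (hι : 2 * n + 1 ≤ Fintype.card ι)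
    (hε : 0 < heisExponent n p) : ¬ HasC0SchurApproximation p μ := by
  rintro ⟨C, α, _, _, _, f, hconv, hC⟩
  obtain ⟨g, hg⟩ := exists_forall_norm_doubleCosetAvg_le hp hι hε C (μ := μ) (one_half_pos (α := ℝ))
  have hone := tendsto_doubleCosetAvg_one (μ := μ) isOpen_integralSL isCompact_integralSL
    (fun a => (f a).continuous) hconv g
  have hle := le_of_tendsto hone.norm (Eventually.of_forall fun a => hg (f a) (hC a))
  norm_num at hle

end Decay

end SchurAP

end

theorem theoremD_general {F : Type*} [Field F] [ValuativeRel F] [TopologicalSpace F]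
    [IsNonarchimedeanLocalField F]
    (r n : ℕ) (hn : 1 ≤ n) (hr : 2 * n + 1 ≤ r)
    (p : ℝ≥0∞)
    (hp : (0 < p ∧ p < ENNReal.ofReal (2 - 2 / ((n : ℝ) + 2))) ∨
      ENNReal.ofReal (2 + 2 / (n : ℝ)) < p)
    [MeasurableSpace (Matrix.SpecialLinearGroup (Fin r) F)]
    [BorelSpace (Matrix.SpecialLinearGroup (Fin r) F)]
    (μ : Measure (Matrix.SpecialLinearGroup (Fin r) F)) [μ.IsHaarMeasure] :
    ¬ SchurAP.HasAPcbSchur p μ ∧ ¬ SchurAP.HasC0SchurApproximation p μ := by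
  have : NeZero n := ⟨by omega⟩
  have hp0 : p ≠ 0 := by
    rcases hp with hp | hp
    exacts [hp.1.ne', hp.ne_bot]
  have hε : 0 < SchurAP.heisExponent n p := hp.elim
    (fun h => SchurAP.heisExponent_pos_of_lt h.1 h.2) (SchurAP.heisExponent_pos_of_gt hn)
  have hC0 : ¬ SchurAP.HasC0SchurApproximation p μ :=
    SchurAP.not_hasC0SchurApproximation hp0 (by simpa using hr) hε
  exact ⟨fun h => hC0 (h.hasC0SchurApproximation hp0), hC0⟩

theorem theoremD {F : Type*} [Field F] [ValuativeRel F] [TopologicalSpace F]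
    [IsNonarchimedeanLocalField F]
    (r n : ℕ) (hn : 1 ≤ n) (hr : 2 * n + 1 ≤ r)
    (p : ℝ≥0∞)
    (hp : (1 ≤ p ∧ p < ENNReal.ofReal (2 - 2 / ((n : ℝ) + 2))) ∨
      ENNReal.ofReal (2 + 2 / (n : ℝ)) < p)
    [MeasurableSpace (Matrix.SpecialLinearGroup (Fin r) F)]
    [BorelSpace (Matrix.SpecialLinearGroup (Fin r) F)]
    (μ : Measure (Matrix.SpecialLinearGroup (Fin r) F)) [μ.IsHaarMeasure] :
    ¬ SchurAP.HasAPcbSchur p μ ∧ ¬ SchurAP.HasC0SchurApproximation p μ :=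
  theoremD_general r n hn hr p (hp.imp_left fun h => ⟨zero_lt_one.trans_le h.1, h.2⟩) μ
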